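/- **Theorem (Yang–Mills: special Hamiltonian forms are a subalgebra).** Let $X$ be a smooth pseudo-Riemannian manifold of dimension $n\ge 1$ with metric $g$, let $G$ be a Lie group of dimension $m$ whose Lie algebra $\mathfrak g$ has basis $e_i$, structure constants $[e_j,e_k]=f^i_{jk}e_i$ and carries an $\mathrm{Ad}$-invariant non-degenerate symmetric bilinear form, and let $P\to X$ be a principal $G$-bundle. Let $Y\to X$ be the bundle of principal connections of $P$. A chart $(x^\mu)$ of $X$ together with a local section $s$ of $P$ over its domain induces coordinates $(x^\mu,A^i_\mu)$ on $Y$, representing $s^*\theta=A^i_\mu\,dx^\mu\otimes e_i$, and coordinates $(x^\mu,A^i_\mu,p^{\mu\nu}_i)$ on $M=\bigwedge^n_2Y/\bigwedge^n_1Y$, representing the class of $p^{\mu\nu}_i\,dA^i_\mu\wedge d^{n-1}x_\nu$ modulo semi-basic forms, where $d^{n-1}x_\nu=\iota_{\partial/\partial x^\nu}d^nx$. On $M$ consider the graded Dirac structure $S^n=\langle d^nx,\ dA^i_\mu\wedge d^{n-1}x_\nu,\ \sum_\nu dp^{\mu\nu}_i\wedge d^{n-1}x_\nu\rangle$, $$\sharp_n(d^nx)=0,\qquad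 \sharp_n(dA^i_\mu\wedge d^{n-1}x_\nu)=-\frac{\partial}{\partial p^{\mu\nu}_i},\qquad \sharp_n\Big(\sum_\nu dp^{\mu\nu}_i\wedge d^{n-1}x_\nu\Big)=\frac{\partial}{\partial A^i_\mu}.$$ The image of the reduced Legendre transformation $p^{\mu\nu}_i=\partial L/\partial A^i_{\mu,\nu}$ (with $A^i_{\mu,\nu}$ standing for $\partial A^i_\mu/\partial x^\nu$) of the Yang–Mills Lagrangian $L=-\frac14F_i^{\mu\nu}F^i_{\mu\nu}\sqrt{|\det g|}$, $F^i_{\mu\nu}=\partial_\mu A^i_\nu-\partial_\nu A^i_\mu+f^i_{jk}A^j_\mu A^k_\nu$, is the submanifold $N=\{p^{\mu\nu}_i+p^{\nu\mu}_i=0\}$ of $M$. The graded Dirac structure is pulled back to $N$: $\widetilde S^n$ consists of the restrictions $\alpha|_N$ of those $\alpha\in S^n$ for which $\sharp_n(\alpha)$ is tangent to $N$, with $\widetilde\sharp_n(\alpha|_N)=\sharp_n(\alpha)$; for $1\le a\le n$, $\widetilde S^a$ is spanned by the contractions $\iota_U\alpha$ of $\alpha\in\widetilde S^n$ with $(n-a)$-vectors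 $U$; $\widetilde K_p$ is the annihilator of $\widetilde S^p$ in the $p$-vectors; and $\widetilde\sharp_a(\iota_U\alpha)=\widetilde\sharp_n(\alpha)\wedge U+\widetilde K_{n+1-a}$ (with $\widetilde\sharp_n$ also read modulo $\widetilde K_1$). These maps $\widetilde\sharp_a$ on $\widetilde S^a$ are well defined. For $0\le a\le n-1$, an $a$-form $\alpha$ on $N$ is Hamiltonian if $d\alpha$ takes values in $\widetilde S^{a+1}$, and special Hamiltonian if moreover $\alpha\wedge\varepsilon$ is a Hamiltonian $(n-1)$-form for every closed $(n-1-a)$-form $\varepsilon$ pulled back from $X$. The bracket of a Hamiltonian $a$-form $\alpha$ and a Hamiltonian $b$-form $\beta$ is the $(a+b-(n-1))$-form $$\{\alpha,\beta\}=(-1)^{n-1-b}\,\iota_{\widetilde\sharp_{b+1}(d\beta)}d\alpha$$ (it is $0$ if $a+b<n-1$). Then the special Hamiltonian forms define a subalgebra: in each degree $0\le a\le n-1$ they form a linear subspace of $\Omega^a(N)$, and for special Hamiltonian forms $\alpha$ and $\beta$ of degrees $a$ and $b$ with $a+b\ge n-1$ the bracket $\{\alpha,\beta\}$ is a well-defined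 smooth form on $N$ and is special Hamiltonian. -/

import Mathlib

open scoped Manifold ContDiff

namespace YangMills

noncomputable section

/-! ## Multilinear algebra: wedge products, contractions by multivectors -/

section Algebra

variable {E : Type*} [NormedAddCommGroup E] [NormedSpace ℝ E]

/-- The exterior product of alternating forms (sum over shuffles, without factorials). -/
def wedgeAlt {a b : ℕ} (α : E [⋀^Fin a]→ₗ[ℝ] ℝ) (β : E [⋀^Fin b]→ₗ[ℝ] ℝ) :
    E [⋀^Fin (a + b)]→ₗ[ℝ] ℝ :=
  ((LinearMap.mul' ℝ ℝ).compAlternatingMap (α.domCoprod β)).domDomCongr finSumFinEquiv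

theorem continuous_wedgeAlt {a b : ℕ} (α : E [⋀^Fin a]→L[ℝ] ℝ) (β : E [⋀^Fin b]→L[ℝ] ℝ) :
    Continuous (wedgeAlt α.toAlternatingMap β.toAlternatingMap) := by
  have h : ∀ v : Fin (a + b) → E, wedgeAlt α.toAlternatingMap β.toAlternatingMap v =
      ∑ σ : Equiv.Perm.ModSumCongr (Fin a) (Fin b), LinearMap.mul' ℝ ℝ
        (AlternatingMap.domCoprod.summand α.toAlternatingMap β.toAlternatingMap σ
          (fun i => v (finSumFinEquiv i))) := by
    intro v
    simp [wedgeAlt, AlternatingMap.domCoprod_apply, map_sum, Function.comp_def]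
  rw [show (⇑(wedgeAlt α.toAlternatingMap β.toAlternatingMap)) = _ from funext h]
  refine continuous_finsetSum _ fun σ _ => ?_
  induction σ using Quotient.inductionOn' with | _ σ
  have h2 : (fun v : Fin (a + b) → E => LinearMap.mul' ℝ ℝ
        (AlternatingMap.domCoprod.summand α.toAlternatingMap β.toAlternatingMap
          (Quotient.mk'' σ) (fun i => v (finSumFinEquiv i)))) =
      fun v => Equiv.Perm.sign σ •
        (α (fun i => v (finSumFinEquiv (σ (Sum.inl i)))) *
          β (fun i => v (finSumFinEquiv (σ (Sum.inr i))))) := by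
    funext v
    rw [AlternatingMap.domCoprod.summand_mk'', _root_.smul_apply,
      MultilinearMap.domDomCongr_apply, MultilinearMap.domCoprod_apply]
    rw [Units.smul_def, Units.smul_def, map_zsmul]
    simp
  rw [h2]
  refine Continuous.const_smul (Continuous.mul ?_ ?_) _
  · exact α.cont.comp (by fun_prop)
  · exact β.cont.comp (by fun_prop)

/-- The exterior product of continuous alternating forms. -/
def wedge {a b : ℕ} (α : E [⋀^Fin a]→L[ℝ] ℝ) (β : E [⋀^Fin b]→L[ℝ] ℝ) :
    E [⋀^Fin (a + b)]→L[ℝ] ℝ :=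
  { wedgeAlt α.toAlternatingMap β.toAlternatingMap with
    cont := continuous_wedgeAlt α β }

/-- The linear functional on the exterior algebra given by the `k`-form `η`: on
`v₁ ∧ ⋯ ∧ vₖ` it is `η (v₁, …, vₖ)`, and it vanishes in all degrees other than `k`. -/
def evalForm {k : ℕ} (η : E [⋀^Fin k]→ₗ[ℝ] ℝ) : ExteriorAlgebra ℝ E →ₗ[ℝ] ℝ :=
  ExteriorAlgebra.liftAlternating (Pi.single k η)

/-- The contraction `ι_U η`, with `(ι_U η) (v₁, …, vₐ) = η (U ∧ v₁ ∧ ⋯ ∧ vₐ)`. For a `p`-vector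
`U` and a `k`-form `η` it is an `a`-form with `p + a = k`, and
`ι_{u₁ ∧ ⋯ ∧ uₚ} η = η (u₁, …, uₚ, …)`. -/
def contract {k : ℕ} (a : ℕ) (U : ExteriorAlgebra ℝ E) (η : E [⋀^Fin k]→ₗ[ℝ] ℝ) :
    E [⋀^Fin a]→ₗ[ℝ] ℝ :=
  ((evalForm η).comp (LinearMap.mulLeft ℝ U)).compAlternatingMap (ExteriorAlgebra.ιMulti ℝ a)

/-- The exterior product `φ₁ ∧ ⋯ ∧ φₙ` of covectors, `v ↦ det (φᵢ (vⱼ))`. -/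
def covectorWedge {n : ℕ} (φ : Fin n → E →ₗ[ℝ] ℝ) : E [⋀^Fin n]→ₗ[ℝ] ℝ :=
  Matrix.detRowAlternating.compLinearMap (LinearMap.pi φ)

end Algebra

/-! ## Coordinate models of the phase space and of the constraint submanifold -/

/-- Coordinates `x^μ`. -/
abbrev Base (n : ℕ) : Type := EuclideanSpace ℝ (Fin n)

/-- Coordinates `p^{μν}_i`, written `p i μ ν`. -/
abbrev Momenta (n m : ℕ) : Type := Fin m → Fin n → Fin n → ℝ

/-- Coordinates `(x^μ, A^i_μ, p^{μν}_i)` on the reduced multisymplectic phase space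
`M = ⋀ⁿ₂ Y / ⋀ⁿ₁ Y` of the bundle of connections `Y` (with coordinates `(x^μ, A^i_μ)`), where
`(x, A, p)` is the class of `p^{μν}_i dA^i_μ ∧ d^{n-1}x_ν`. -/
abbrev Phase (n m : ℕ) : Type := Base n × (Fin m → Fin n → ℝ) × Momenta n m

/-- The momenta with `p^{μν}_i + p^{νμ}_i = 0`. -/
def skewMomenta (n m : ℕ) : Submodule ℝ (Momenta n m) where
  carrier := {p | ∀ i μ ν, p i μ ν + p i ν μ = 0}
  add_mem' := by
    intro p q hp hq i μ ν
    have h1 := hp i μ ν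
    have h2 := hq i μ ν
    simp only [Pi.add_apply]
    linarith
  zero_mem' := by intro i μ ν; simp
  smul_mem' := by
    intro r p hp i μ ν
    have h1 := hp i μ ν
    simp only [Pi.smul_apply, smul_eq_mul]
    rw [← mul_add, h1, mul_zero]

/-- Coordinates `(x^μ, A^i_μ, p^{μν}_i)`, `p^{μν}_i + p^{νμ}_i = 0`, on the constraint
submanifold `N` of `M`. -/
abbrev Constr (n m : ℕ) : Type := Base n × (Fin m → Fin n → ℝ) × skewMomenta n m

/-- The inclusion of `N` in `M`. -/
def incl (n m : ℕ) : Constr n m →L[ℝ] Phase n m :=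
  (ContinuousLinearMap.id ℝ (Base n)).prodMap
    ((ContinuousLinearMap.id ℝ (Fin m → Fin n → ℝ)).prodMap (skewMomenta n m).subtypeL)

/-! ## The graded Dirac structure on `M` and its pullback to `N` -/

section Dirac

variable (n m : ℕ)

/-- The covector `dx^μ` on `M`. -/
def dx (μ : Fin n) : Phase n m →ₗ[ℝ] ℝ where
  toFun z := z.1 μ
  map_add' _ _ := rfl
  map_smul' _ _ := rfl

/-- The covector `dA^i_μ` on `M`. -/
def dA (i : Fin m) (μ : Fin n) : Phase n m →ₗ[ℝ] ℝ where
  toFun z := z.2.1 i μ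
  map_add' _ _ := rfl
  map_smul' _ _ := rfl

/-- The covector `dp^{μν}_i` on `M`. -/
def dp (i : Fin m) (μ ν : Fin n) : Phase n m →ₗ[ℝ] ℝ where
  toFun z := z.2.2 i μ ν
  map_add' _ _ := rfl
  map_smul' _ _ := rfl

/-- The form `dⁿx = dx¹ ∧ ⋯ ∧ dxⁿ`. -/
def dnx : Phase n m [⋀^Fin n]→ₗ[ℝ] ℝ := covectorWedge (dx n m)

/-- The form `φ ∧ d^{n-1}x_ν`, where `d^{n-1}x_ν = ι_{∂/∂x^ν} dⁿx`. It is obtained from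
`dx¹ ∧ ⋯ ∧ dxⁿ` by replacing the factor `dx^ν` by `φ`. -/
def wedgeDnx (φ : Phase n m →ₗ[ℝ] ℝ) (ν : Fin n) : Phase n m [⋀^Fin n]→ₗ[ℝ] ℝ :=
  covectorWedge (Function.update (dx n m) ν φ)

/-- The vector `∂/∂A^i_μ` on `M`. -/
def vecA (i : Fin m) (μ : Fin n) : Phase n m := (0, Pi.single i (Pi.single μ 1), 0)

/-- The vector `∂/∂p^{μν}_i` on `M`. -/
def vecP (i : Fin m) (μ ν : Fin n) : Phase n m :=
  (0, 0, Pi.single i (Pi.single μ (Pi.single ν 1)))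

/-- The graph of `♯ₙ : Sⁿ → TM` for the canonical graded Dirac structure on `M`:
`Sⁿ = ⟨dⁿx, dA^i_μ ∧ d^{n-1}x_ν, dp^{μν}_i ∧ d^{n-1}x_ν⟩` (sum over `ν` in the last form), with
`♯ₙ(dⁿx) = 0`, `♯ₙ(dA^i_μ ∧ d^{n-1}x_ν) = -∂/∂p^{μν}_i`,
`♯ₙ(dp^{μν}_i ∧ d^{n-1}x_ν) = ∂/∂A^i_μ`. -/
def sharpGraphM : Submodule ℝ ((Phase n m [⋀^Fin n]→ₗ[ℝ] ℝ) × Phase n m) :=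
  Submodule.span ℝ
    ({(dnx n m, 0)} ∪
      {w | ∃ i μ ν, w = (wedgeDnx n m (dA n m i μ) ν, -vecP n m i μ ν)} ∪
      {w | ∃ i μ, w = (∑ ν, wedgeDnx n m (dp n m i μ ν) ν, vecA n m i μ)})

/-- The graph of `♯ₙ` on `N`, pulled back from `M`: it consists of the pairs
`(α|_N, v)` with `α ∈ Sⁿ` such that `♯ₙ(α) = v` is tangent to `N`. -/
def sharpGraphN : Submodule ℝ ((Constr n m [⋀^Fin n]→ₗ[ℝ] ℝ) × Constr n m) :=
  Submodule.span ℝ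
    {w | ∃ α, (α, incl n m w.2) ∈ sharpGraphM n m ∧
      w.1 = α.compLinearMap (incl n m).toLinearMap}

/-- The fibre `S^a` (for `a ≤ n`) of the bundle of `a`-forms of the graded Dirac structure on `N`:
the span of the contractions of the elements of `Sⁿ` by `(n-a)`-vectors. -/
def formsS (a : ℕ) : Submodule ℝ (Constr n m [⋀^Fin a]→ₗ[ℝ] ℝ) :=
  Submodule.span ℝ
    {σ | ∃ w ∈ sharpGraphN n m, ∃ U ∈ ⋀[ℝ]^(n - a) (Constr n m), σ = contract a U w.1}

/-- The annihilator `K_p` of `S^p` in the space of `p`-vectors on `N`. -/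
def annK (p : ℕ) : Set (ExteriorAlgebra ℝ (Constr n m)) :=
  {U | U ∈ ⋀[ℝ]^p (Constr n m) ∧ ∀ σ ∈ formsS n m p, contract 0 U σ = 0}

/-- The graph of `♯_a : S^a → ⋁_{n+1-a} / K_{n+1-a}` on `N`, as a relation between `a`-forms and
`(n+1-a)`-vectors: `(σ, V)` belongs to it iff `σ ∈ S^a` and `♯_a(σ) = V + K_{n+1-a}`, where
`♯_a(ι_U α) = ♯ₙ(α) ∧ U + K_{n+1-a}` for `α ∈ Sⁿ` and every `(n-a)`-vector `U`. -/
def sharpGraph (a : ℕ) :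
    Submodule ℝ ((Constr n m [⋀^Fin a]→ₗ[ℝ] ℝ) × ExteriorAlgebra ℝ (Constr n m)) :=
  Submodule.span ℝ
    ({s | ∃ w ∈ sharpGraphN n m, ∃ U ∈ ⋀[ℝ]^(n - a) (Constr n m),
        s = (contract a U w.1, ExteriorAlgebra.ι ℝ w.2 * U)} ∪
      {s | s.1 = 0 ∧ s.2 ∈ annK n m (n + 1 - a)})

end Dirac

/-! ## Principal bundles, gauge charts, and the transformation of the coordinates -/

section Geometry

/-- A smooth principal bundle `P → X` with structure group `G` acting on the right, where
`dim X = n` and `dim G = m`. -/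
structure PrincipalBundle (n m : ℕ) (X G P : Type*)
    [TopologicalSpace X] [ChartedSpace (EuclideanSpace ℝ (Fin n)) X]
    [TopologicalSpace G] [ChartedSpace (EuclideanSpace ℝ (Fin m)) G] [Group G]
    [TopologicalSpace P] [ChartedSpace (EuclideanSpace ℝ (Fin (n + m))) P] where
  proj : P → X
  act : P → G → P
  act_one : ∀ p, act p 1 = p
  act_mul : ∀ p g h, act p (g * h) = act (act p g) h
  proj_act : ∀ p g, proj (act p g) = proj p
  contMDiff_proj : ContMDiff (𝓡 (n + m)) (𝓡 n) ∞ proj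
  contMDiff_act :
    ContMDiff ((𝓡 (n + m)).prod (𝓡 m)) (𝓡 (n + m)) ∞ (fun q : P × G => act q.1 q.2)
  /-- Around each point there is an equivariant diffeomorphism
  `(proj, ψ) : proj⁻¹(U) → U × G`, with inverse `φ`. -/
  locally_trivial : ∀ x : X, ∃ U : Set X, IsOpen U ∧ x ∈ U ∧ ∃ (φ : X × G → P) (ψ : P → G),
    ContMDiffOn ((𝓡 n).prod (𝓡 m)) (𝓡 (n + m)) ∞ φ (U ×ˢ Set.univ) ∧
    ContMDiffOn (𝓡 (n + m)) (𝓡 m) ∞ ψ (proj ⁻¹' U) ∧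
    (∀ y ∈ U, ∀ g, proj (φ (y, g)) = y ∧ ψ (φ (y, g)) = g) ∧
    (∀ p, proj p ∈ U → φ (proj p, ψ p) = p ∧ ∀ g, ψ (act p g) = ψ p * g)

/-- A pseudo-Riemannian metric on an `n`-dimensional manifold. -/
structure PseudoMetric (n : ℕ) (X : Type*)
    [TopologicalSpace X] [ChartedSpace (EuclideanSpace ℝ (Fin n)) X] where
  toFun : ∀ x : X, TangentSpace (𝓡 n) x →L[ℝ] TangentSpace (𝓡 n) x →L[ℝ] ℝ
  symm : ∀ x v w, toFun x v w = toFun x w v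
  nondegenerate : ∀ x v, (∀ w, toFun x v w = 0) → v = 0
  smooth : ∀ e ∈ IsManifold.maximalAtlas (𝓡 n) ∞ X, ∀ v w : Base n,
    ContDiffOn ℝ ∞ (fun u : Base n => toFun (e.symm u)
      (mfderiv (𝓡 n) (𝓡 n) e.symm u v) (mfderiv (𝓡 n) (𝓡 n) e.symm u w)) e.target

section LieGroup

variable {m : ℕ} {G : Type*}
  [TopologicalSpace G] [ChartedSpace (EuclideanSpace ℝ (Fin m)) G] [Group G]

/-- The adjoint action of `g` on the Lie algebra: the derivative of `y ↦ g y g⁻¹` at `1`. -/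
def Ad (g : G) : GroupLieAlgebra (𝓡 m) G → GroupLieAlgebra (𝓡 m) G :=
  fun ξ => mfderiv (𝓡 m) (𝓡 m) (fun y : G => g * y * g⁻¹) 1 ξ

end LieGroup

variable {n m : ℕ} {X G P : Type*}
  [TopologicalSpace X] [ChartedSpace (EuclideanSpace ℝ (Fin n)) X]
  [TopologicalSpace G] [ChartedSpace (EuclideanSpace ℝ (Fin m)) G] [Group G]
  [TopologicalSpace P] [ChartedSpace (EuclideanSpace ℝ (Fin (n + m))) P]

/-- A gauge chart: a chart of `X` together with a smooth section `s` of `P` over its domain. With a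
basis `e_i` of the Lie algebra, it gives the coordinates `(x^μ, A^i_μ)` on the bundle of connections
that represent the local potential `s^*θ = A^i_μ dx^μ ⊗ e_i` of a connection form `θ`. -/
structure GaugeChart (Q : PrincipalBundle n m X G P) where
  chart : OpenPartialHomeomorph X (EuclideanSpace ℝ (Fin n))
  chart_mem : chart ∈ IsManifold.maximalAtlas (𝓡 n) ∞ X
  sec : X → P
  contMDiffOn_sec : ContMDiffOn (𝓡 n) (𝓡 (n + m)) ∞ sec chart.source
  proj_sec : ∀ x ∈ chart.source, Q.proj (sec x) = x

variable {Q : PrincipalBundle n m X G P}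

namespace GaugeChart

/-- The domain of the induced coordinates on `N`. -/
def dom (c : GaugeChart Q) : Set (Constr n m) := {z | z.1 ∈ c.chart.target}

open Classical in
/-- The gauge transformation `h` between the sections of two gauge charts: `s'(q) = s(q) h(q)`. -/
def gauge (c c' : GaugeChart Q) (q : X) : G :=
  if hq : ∃ g : G, Q.act (c.sec q) g = c'.sec q then hq.choose else 1

/-- The change of the coordinates `x^μ`. -/
def changeX (c c' : GaugeChart Q) (x : Base n) : Base n := c'.chart (c.chart.symm x)

/-- The matrix `∂x'^μ/∂x^α` at `x`. -/
def jac (c c' : GaugeChart Q) (x : Base n) : Matrix (Fin n) (Fin n) ℝ :=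
  fun μ α => (fderiv ℝ (changeX c c') x (EuclideanSpace.single α 1)) μ

/-- The value on `w` of the Lie algebra valued form `h⁻¹ dh`, in the chart of `c` at `x`. -/
def maurerCartan (c c' : GaugeChart Q) (x : Base n) (w : Base n) : GroupLieAlgebra (𝓡 m) G :=
  mfderiv (𝓡 n) (𝓡 m)
    (fun u : Base n => (gauge c c' (c.chart.symm x))⁻¹ * gauge c c' (c.chart.symm u)) x w

/-- The change of the coordinates `A^i_μ`, that is, `A' = Ad_{h⁻¹} A + h⁻¹ dh`, where
`A'_μ` is the value of this form on `∂/∂x'^μ = (∂x^α/∂x'^μ) ∂/∂x^α`. -/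
def changeA (b : Module.Basis (Fin m) ℝ (GroupLieAlgebra (𝓡 m) G)) (c c' : GaugeChart Q)
    (x : Base n) (A : Fin m → Fin n → ℝ) : Fin m → Fin n → ℝ :=
  fun i μ =>
    let w : Base n :=
      fderiv ℝ (changeX c' c) (changeX c c' x) (EuclideanSpace.single μ 1)
    b.repr (Ad (gauge c c' (c.chart.symm x))⁻¹ (∑ j, (∑ α, A j α * w α) • b j) +
      maurerCartan c c' x w) i

/-- The change of the coordinates `p^{μν}_i` that makes `p^{μν}_i dA^i_μ ∧ d^{n-1}x_ν` invariant
modulo semi-basic forms: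
`p'^{μν}_i = det(∂x'/∂x)⁻¹ (∂x'^μ/∂x^α) (∂x'^ν/∂x^β) (Ad_h)^j_i p^{αβ}_j`. -/
def changeP (b : Module.Basis (Fin m) ℝ (GroupLieAlgebra (𝓡 m) G)) (c c' : GaugeChart Q)
    (x : Base n) (p : Momenta n m) : Momenta n m :=
  fun i μ ν => (jac c c' x).det⁻¹ * ∑ α, ∑ β, ∑ j, jac c c' x μ α * jac c c' x ν β *
    b.repr (Ad (gauge c c' (c.chart.symm x)) (b i)) j * p j α β

theorem changeP_mem (b : Module.Basis (Fin m) ℝ (GroupLieAlgebra (𝓡 m) G)) (c c' : GaugeChart Q)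
    (x : Base n) {p : Momenta n m} (hp : p ∈ skewMomenta n m) :
    changeP b c c' x p ∈ skewMomenta n m := by
  intro i μ ν
  simp only [changeP]
  rw [← mul_add]
  have h : ∑ α, ∑ β, ∑ j, jac c c' x ν α * jac c c' x μ β *
        b.repr (Ad (gauge c c' (c.chart.symm x)) (b i)) j * p j α β =
      ∑ α, ∑ β, ∑ j, jac c c' x μ α * jac c c' x ν β *
        b.repr (Ad (gauge c c' (c.chart.symm x)) (b i)) j * p j β α := by
    rw [Finset.sum_comm]
    refine Finset.sum_congr rfl fun α _ => Finset.sum_congr rfl fun β _ =>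
      Finset.sum_congr rfl fun j _ => ?_
    ring
  rw [h]
  simp only [← Finset.sum_add_distrib, ← mul_add]
  have h0 : ∀ j α β, p j α β + p j β α = 0 := hp
  simp [h0]

/-- The change of coordinates on `N` between two gauge charts. -/
def transition (b : Module.Basis (Fin m) ℝ (GroupLieAlgebra (𝓡 m) G)) (c c' : GaugeChart Q)
    (z : Constr n m) : Constr n m :=
  (changeX c c' z.1, changeA b c c' z.1 z.2.1,
    ⟨changeP b c c' z.1 z.2.2.1, changeP_mem b c c' z.1 z.2.2.2⟩)

end GaugeChart

/-! ## The Yang–Mills Lagrangian and its Legendre transformation -/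

/-- The matrix `g_{μν}` of the metric in a chart, at the point with coordinates `x`. -/
def PseudoMetric.matrix (g : PseudoMetric n X)
    (e : OpenPartialHomeomorph X (EuclideanSpace ℝ (Fin n))) (x : Base n) :
    Matrix (Fin n) (Fin n) ℝ :=
  fun μ ν => g.toFun (e.symm x)
    (mfderiv (𝓡 n) (𝓡 n) e.symm x (EuclideanSpace.single μ 1 : Base n))
    (mfderiv (𝓡 n) (𝓡 n) e.symm x (EuclideanSpace.single ν 1 : Base n))

/-- The components of the curvature,
`F^i_{μν} = ∂A^i_ν/∂x^μ - ∂A^i_μ/∂x^ν + f^i_{jk} A^j_μ A^k_ν`, with the structure constants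
`[e_j, e_k] = f^i_{jk} e_i`. The coordinate `a i μ ν` on the first jet bundle stands for
`A^i_{μ,ν} = ∂A^i_μ/∂x^ν`. -/
def curvature (b : Module.Basis (Fin m) ℝ (GroupLieAlgebra (𝓡 m) G))
    (A : Fin m → Fin n → ℝ) (a : Fin m → Fin n → Fin n → ℝ) (i : Fin m) (μ ν : Fin n) : ℝ :=
  a i ν μ - a i μ ν + ∑ j, ∑ k, b.repr ⁅b j, b k⁆ i * A j μ * A k ν

/-- The Yang–Mills Lagrangian `L = -1/4 F^{μν}_i F^i_{μν} √|det g|` in a gauge chart, indices being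
raised and lowered with the metric `g` of `X` and the inner product `κ` of the Lie algebra. -/
def lagrangian (b : Module.Basis (Fin m) ℝ (GroupLieAlgebra (𝓡 m) G)) (g : PseudoMetric n X)
    (κ : GroupLieAlgebra (𝓡 m) G →ₗ[ℝ] GroupLieAlgebra (𝓡 m) G →ₗ[ℝ] ℝ) (c : GaugeChart Q)
    (x : Base n) (A : Fin m → Fin n → ℝ) (a : Fin m → Fin n → Fin n → ℝ) : ℝ :=
  -(1 / 4) * (∑ i, ∑ j, ∑ μ, ∑ ν, ∑ α, ∑ β,
    κ (b i) (b j) * (g.matrix c.chart x)⁻¹ μ α * (g.matrix c.chart x)⁻¹ ν β *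
      curvature b A a i μ ν * curvature b A a j α β) * √|(g.matrix c.chart x).det|

/-- The (reduced) Legendre transformation `J¹Y → M`, `p^{μν}_i = ∂L/∂A^i_{μ,ν}`, in the coordinates
given by a gauge chart. -/
def legendre (b : Module.Basis (Fin m) ℝ (GroupLieAlgebra (𝓡 m) G)) (g : PseudoMetric n X)
    (κ : GroupLieAlgebra (𝓡 m) G →ₗ[ℝ] GroupLieAlgebra (𝓡 m) G →ₗ[ℝ] ℝ) (c : GaugeChart Q)
    (j : Base n × (Fin m → Fin n → ℝ) × (Fin m → Fin n → Fin n → ℝ)) : Phase n m :=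
  (j.1, j.2.1, fun i μ ν =>
    fderiv ℝ (lagrangian b g κ c j.1 j.2.1) j.2.2 (Pi.single i (Pi.single μ (Pi.single ν 1))))

/-! ## Differential forms on `X` and on `N` -/

/-- The local expression in a chart `e` of a form `ε` on `X`. -/
def localForm {k : ℕ} (ε : ∀ x : X, TangentSpace (𝓡 n) x [⋀^Fin k]→L[ℝ] ℝ)
    (e : OpenPartialHomeomorph X (EuclideanSpace ℝ (Fin n))) (u : Base n) :
    Base n [⋀^Fin k]→L[ℝ] ℝ :=
  (ε (e.symm u)).compContinuousLinearMap (mfderiv (𝓡 n) (𝓡 n) e.symm u)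

/-- A smooth closed `k`-form on `X`. -/
structure ClosedForm (n : ℕ) (X : Type*) [TopologicalSpace X]
    [ChartedSpace (EuclideanSpace ℝ (Fin n)) X] (k : ℕ) where
  toFun : ∀ x : X, TangentSpace (𝓡 n) x [⋀^Fin k]→L[ℝ] ℝ
  smooth : ∀ e ∈ IsManifold.maximalAtlas (𝓡 n) ∞ X, ContDiffOn ℝ ∞ (localForm toFun e) e.target
  closed : ∀ e ∈ IsManifold.maximalAtlas (𝓡 n) ∞ X, ∀ u ∈ e.target,
    extDeriv (localForm toFun e) u = 0

/-- The local expressions on `N` of the basic form `τ^*ε`, where `τ : N → X`. -/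
def basic {k : ℕ} (ε : ClosedForm n X k) (c : GaugeChart Q) (z : Constr n m) :
    Constr n m [⋀^Fin k]→L[ℝ] ℝ :=
  (localForm ε.toFun c.chart z.1).compContinuousLinearMap
    (ContinuousLinearMap.fst ℝ (Base n) ((Fin m → Fin n → ℝ) × skewMomenta n m))

/-- The space `Ω^k(N)` of smooth `k`-forms on `N`: families of smooth local expressions
in the coordinates of all gauge charts, that are related by pullback along the changes of
coordinates. The value outside the coordinate domain is irrelevant and fixed to be `0`. -/
def Form (Q : PrincipalBundle n m X G P)
    (b : Module.Basis (Fin m) ℝ (GroupLieAlgebra (𝓡 m) G)) (k : ℕ) :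
    Submodule ℝ (GaugeChart Q → Constr n m → Constr n m [⋀^Fin k]→L[ℝ] ℝ) where
  carrier := {η | (∀ c, ContDiffOn ℝ ∞ (η c) c.dom) ∧ (∀ c, ∀ z ∉ c.dom, η c z = 0) ∧
    ∀ c c' : GaugeChart Q, ∀ z ∈ c.dom, c.chart.symm z.1 ∈ c'.chart.source →
      η c z = (η c' (GaugeChart.transition b c c' z)).compContinuousLinearMap
        (fderiv ℝ (GaugeChart.transition b c c') z)}
  add_mem' := by
    rintro η ζ ⟨h1, h2, h3⟩ ⟨k1, k2, k3⟩
    refine ⟨fun c => (h1 c).add (k1 c), fun c z hz => ?_, fun c c' z hz hz' => ?_⟩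
    · simp [h2 c z hz, k2 c z hz]
    · simp only [Pi.add_apply]
      rw [h3 c c' z hz hz', k3 c c' z hz hz']
      rfl
  zero_mem' := by
    refine ⟨fun c => contDiffOn_const, fun c z hz => rfl, fun c c' z hz hz' => ?_⟩
    rfl
  smul_mem' := by
    rintro r η ⟨h1, h2, h3⟩
    refine ⟨fun c => (h1 c).const_smul r, fun c z hz => ?_, fun c c' z hz hz' => ?_⟩
    · simp [h2 c z hz]
    · simp only [Pi.smul_apply]
      rw [h3 c c' z hz hz']
      rfl

/-- The form given by the local expressions `η` is Hamiltonian of degree `a ≤ n - 1`: its exterior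
derivative takes values in `S^{a+1}`. -/
def IsHamiltonian {a : ℕ} (η : GaugeChart Q → Constr n m → Constr n m [⋀^Fin a]→L[ℝ] ℝ) : Prop :=
  a + 1 ≤ n ∧ ∀ c, ∀ z ∈ GaugeChart.dom c,
    (extDeriv (η c) z).toAlternatingMap ∈ formsS n m (a + 1)

/-- A Hamiltonian `a`-form `α` is special Hamiltonian if `α ∧ ε` is a Hamiltonian `(n-1)`-form for
every closed basic `(n-1-a)`-form `ε`. -/
def IsSpecialHamiltonian {a : ℕ}
    (α : GaugeChart Q → Constr n m → Constr n m [⋀^Fin a]→L[ℝ] ℝ) : Prop :=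
  IsHamiltonian α ∧ ∀ k, a + k = n - 1 → ∀ ε : ClosedForm n X k,
    IsHamiltonian (fun (c : GaugeChart Q) z => wedge (α c z) (basic ε c z))

/-- `γ` is the bracket `{α, β} = (-1)^{deg_H β} ι_{♯_{b+1}(dβ)} dα`, where
`deg_H β = n - 1 - b`, of the `a`-form `α` and the `b`-form `β`. -/
def IsBracket {a b d : ℕ}
    (α : GaugeChart Q → Constr n m → Constr n m [⋀^Fin a]→L[ℝ] ℝ)
    (β : GaugeChart Q → Constr n m → Constr n m [⋀^Fin b]→L[ℝ] ℝ)
    (γ : GaugeChart Q → Constr n m → Constr n m [⋀^Fin d]→L[ℝ] ℝ) : Prop :=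
  ∀ c, ∀ z ∈ GaugeChart.dom c, ∃ V,
    ((extDeriv (β c) z).toAlternatingMap, V) ∈ sharpGraph n m (b + 1) ∧
    (γ c z).toAlternatingMap =
      (-1 : ℝ) ^ (n - 1 - b) • contract d V (extDeriv (α c) z).toAlternatingMap

end Geometry

end

end YangMills

/-! Forms of all degrees are treated as linear functionals on the exterior algebra, where
contraction with vectors and multiplication by covectors are operators obeying the canonical
anticommutation relations. In a gauge chart the Dirac structure of N has constant coefficients and
is encoded by a `PolyModel`: covectors dx^μ, dual vectors ∂_μ and the components ω^ν of a
polysymplectic form. A vector X represents ♯ₙ(f) exactly when X is vertical and f = c dⁿx + Σ_ν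
ω^ν(X,·) ∧ d^{n-1}x_ν (`mem_sharpGraphN_iff`). Since X is determined only up to a kernel, a linear
choice of X, a `Selector`, is fixed. Antisymmetry of ω^ν gives i_Y f = -i_X g for two such pairs (f,
X), (g, Y); the resulting pairing (`diracGraph_pairing`) makes every ♯_a well defined modulo the
annihilator.

For a special Hamiltonian form α of degree a put f = dα and k = n-1-a. Two vertical contractions
kill f, and every product of f with k of the dx^μ lies in Sⁿ; the latter is tested on closed forms
with constant coefficients near a point (`IsSpecialHamiltonian.isSpecial`). Up to a horizontal form,
which is represented by 0 under ♯, f is recovered from those products, and so ♯(f) has an explicit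
representative built from the vectors X_l chosen for dx^l ∧ f and from the ∂_μ
(`IsSpecial.mem_sharpRel`).

Consequently, multiplying the bracket of α and β by dx^l ∧ dx^{l'} gives, up to a constant, Σ_ν
ω^ν(X_l, Y_{l'}) d^{n-1}x_ν (`exists_dxList_bracket`), a polysymplectic Poisson bracket. When it is
differentiated, d² = 0 supplies a symmetry that turns the vertical derivative of ω^ν(X_l, Y_{l'})
into ω^ν(Z, ·), with one vector Z for all ν in the role of a commutator of Hamiltonian vector fields
(`SpecialJet.omega_deriv`). Hence the products of the differential of the bracket with the dx^μ lie
again in Sⁿ. The bracket is moreover horizontal, and for a horizontal form the pointwise conditions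
suffice: in d(η ∧ ε) the terms that differentiate ε are horizontal of top degree, thus multiples of
dⁿx (`isSpecialHamiltonian_of_isSpecial`).

Changes of gauge chart are affine along the fibres and transform ω^ν as a vector density, so they
preserve the graph of ♯ (`GaugeChart.map_mem_sharpRel`). As the bracket does not depend on the
representative of ♯(dβ) (`contract_eq_of_diracGraph`), its local expressions glue. The image of the
Legendre transformation is found separately: the momenta are the skew part of an invertible matrix,
compatible with the exchange of μ and ν, applied to the curvature (`image_legendre`). -/

open scoped Manifold ContDiff

namespace YangMills

noncomputable section

/-! ## Interior and exterior multiplication on the dual of the exterior algebra -/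

section Operators

variable {E : Type*} [NormedAddCommGroup E] [NormedSpace ℝ E]

/-- The dual of the exterior algebra; it contains the forms of all degrees. -/
abbrev ExtDual (E : Type*) [NormedAddCommGroup E] [NormedSpace ℝ E] : Type _ :=
  ExteriorAlgebra ℝ E →ₗ[ℝ] ℝ

/-- The additive group structure, with the standard addition up to reducible unfolding. -/
instance : AddCommGroup (ExtDual E) :=
  { (inferInstance : AddCommMonoid (ExtDual E)) with
    neg := fun f => -f
    sub := fun f g => f - g
    sub_eq_add_neg := fun f g => sub_eq_add_neg f g
    zsmul := fun k f => k • f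
    zsmul_zero' := SubNegMonoid.zsmul_zero'
    zsmul_succ' := SubNegMonoid.zsmul_succ'
    zsmul_neg' := SubNegMonoid.zsmul_neg'
    neg_add_cancel := fun f => neg_add_cancel f }

/-- Left contraction of multivectors by a covector. -/
def covContract : (E →ₗ[ℝ] ℝ) →ₗ[ℝ] ExteriorAlgebra ℝ E →ₗ[ℝ] ExteriorAlgebra ℝ E :=
  CliffordAlgebra.contractLeft (Q := (0 : QuadraticForm ℝ E))

theorem covContract_ι_mul (φ : E →ₗ[ℝ] ℝ) (v : E) (U : ExteriorAlgebra ℝ E) :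
    covContract φ (ExteriorAlgebra.ι ℝ v * U) =
      φ v • U - ExteriorAlgebra.ι ℝ v * covContract φ U :=
  CliffordAlgebra.contractLeft_ι_mul (Q := (0 : QuadraticForm ℝ E)) φ v U

theorem covContract_one (φ : E →ₗ[ℝ] ℝ) : covContract φ (1 : ExteriorAlgebra ℝ E) = 0 :=
  CliffordAlgebra.contractLeft_one (Q := (0 : QuadraticForm ℝ E)) φ

theorem covContract_comm (φ ψ : E →ₗ[ℝ] ℝ) (U : ExteriorAlgebra ℝ E) :
    covContract φ (covContract ψ U) = -covContract ψ (covContract φ U) :=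
  CliffordAlgebra.contractLeft_comm (Q := (0 : QuadraticForm ℝ E)) φ ψ U

/-- Interior multiplication by a vector. -/
def interior : E →ₗ[ℝ] Module.End ℝ (ExtDual E) :=
  LinearMap.mk₂ ℝ (fun v f => f.comp (LinearMap.mulLeft ℝ (ExteriorAlgebra.ι ℝ v)))
    (fun v w f => by ext1; ext; simp [add_mul]) (fun c v f => by ext1; ext; simp)
    (fun v f g => by ext1; ext; simp) (fun c v f => by ext1; ext; simp)

/-- Exterior multiplication by a covector. -/
def exterior : (E →ₗ[ℝ] ℝ) →ₗ[ℝ] Module.End ℝ (ExtDual E) :=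
  LinearMap.mk₂ ℝ (fun φ f => f.comp (covContract φ))
    (fun v w f => by ext1; ext; simp) (fun c v f => by ext1; ext; simp)
    (fun v f g => by ext1; ext; simp) (fun c v f => by ext1; ext; simp)

@[simp] theorem interior_apply (v : E) (f : ExtDual E) (U : ExteriorAlgebra ℝ E) :
    interior v f U = f (ExteriorAlgebra.ι ℝ v * U) := rfl

@[simp] theorem exterior_apply (φ : E →ₗ[ℝ] ℝ) (f : ExtDual E) (U : ExteriorAlgebra ℝ E) :
    exterior φ f U = f (covContract φ U) := rfl

theorem interior_comm (v w : E) (f : ExtDual E) :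
    interior v (interior w f) = -interior w (interior v f) := by
  refine LinearMap.ext fun U => ?_
  have h := ExteriorAlgebra.ι_add_mul_swap (R := ℝ) w v
  simp only [interior_apply, LinearMap.neg_apply, ← mul_assoc]
  rw [eq_neg_of_add_eq_zero_left h, neg_mul, map_neg]

theorem exterior_comm (φ ψ : E →ₗ[ℝ] ℝ) (f : ExtDual E) :
    exterior φ (exterior ψ f) = -exterior ψ (exterior φ f) := by
  refine LinearMap.ext fun U => ?_
  simp only [exterior_apply, LinearMap.neg_apply]
  rw [covContract_comm, map_neg]

theorem exterior_self (φ : E →ₗ[ℝ] ℝ) (f : ExtDual E) : exterior φ (exterior φ f) = 0 :=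
  LinearMap.ext fun U => by
    have h := LinearMap.congr_fun (exterior_comm φ φ f) U
    rw [LinearMap.neg_apply] at h
    rw [LinearMap.zero_apply]
    linarith

/-- Dual to the antiderivation rule of `covContract`. Later computations with contractions and
products rest on this anticommutation relation. -/
theorem interior_exterior (v : E) (φ : E →ₗ[ℝ] ℝ) (f : ExtDual E) :
    interior v (exterior φ f) = φ v • f - exterior φ (interior v f) := by
  refine LinearMap.ext fun U => ?_
  simp [covContract_ι_mul]

/-- The projection to degree `0`. -/
def unitForm : ExtDual E := (ExteriorAlgebra.algebraMapInv (R := ℝ) (M := E)).toLinearMap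

theorem interior_unitForm (v : E) : interior v (unitForm : ExtDual E) = 0 := by
  refine LinearMap.ext fun U => ?_
  simp [unitForm, ExteriorAlgebra.algebraMapInv]

/-- The composition of the exterior multiplications by the members of a list of covectors. -/
def exteriorList (l : List (E →ₗ[ℝ] ℝ)) : Module.End ℝ (ExtDual E) := (l.map exterior).prod

@[simp] theorem exteriorList_nil (f : ExtDual E) : exteriorList [] f = f := rfl

@[simp] theorem exteriorList_cons (φ : E →ₗ[ℝ] ℝ) (l : List (E →ₗ[ℝ] ℝ)) (f : ExtDual E) :
    exteriorList (φ :: l) f = exterior φ (exteriorList l f) := by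
  simp [exteriorList]

theorem exteriorList_append (l l' : List (E →ₗ[ℝ] ℝ)) (f : ExtDual E) :
    exteriorList (l ++ l') f = exteriorList l (exteriorList l' f) := by
  simp [exteriorList]

theorem exteriorList_exterior (φ : E →ₗ[ℝ] ℝ) (l : List (E →ₗ[ℝ] ℝ)) (f : ExtDual E) :
    exteriorList l (exterior φ f) = (-1 : ℝ) ^ l.length • exterior φ (exteriorList l f) := by
  induction l with
  | nil => simp
  | cons ψ l ih =>
    rw [exteriorList_cons, ih, map_smul, exterior_comm, exteriorList_cons, List.length_cons,
      pow_succ, mul_neg_one]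
    module

theorem exteriorList_comm (l l' : List (E →ₗ[ℝ] ℝ)) (f : ExtDual E) :
    exteriorList l (exteriorList l' f) =
      (-1 : ℝ) ^ (l.length * l'.length) • exteriorList l' (exteriorList l f) := by
  induction l' with
  | nil => simp
  | cons ψ l' ih =>
    rw [exteriorList_cons, exteriorList_exterior, ih, map_smul, smul_smul, exteriorList_cons,
      List.length_cons, mul_add_one, pow_add, mul_comm]

theorem interior_exteriorList (v : E) (l : List (E →ₗ[ℝ] ℝ)) (hl : ∀ φ ∈ l, φ v = 0)
    (f : ExtDual E) :
    interior v (exteriorList l f) = (-1 : ℝ) ^ l.length • exteriorList l (interior v f) := by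
  induction l with
  | nil => simp
  | cons ψ l ih =>
    rw [exteriorList_cons, interior_exterior, ih fun φ hφ => hl φ (List.mem_cons_of_mem _ hφ),
      hl ψ List.mem_cons_self, zero_smul, zero_sub, map_smul, exteriorList_cons, List.length_cons,
      pow_succ, mul_neg_one]
    module

/-! ### Homogeneous elements -/

theorem ι_mul_mem {j : ℕ} (v : E) {U : ExteriorAlgebra ℝ E} (hU : U ∈ ⋀[ℝ]^j E) :
    ExteriorAlgebra.ι ℝ v * U ∈ ⋀[ℝ]^(j + 1) E := by
  rw [ExteriorAlgebra.exteriorPower, pow_succ']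
  exact Submodule.mul_mem_mul ⟨v, rfl⟩ hU

theorem mul_mem_exteriorPower {i j k : ℕ} (h : i + j = k) {U V : ExteriorAlgebra ℝ E}
    (hU : U ∈ ⋀[ℝ]^i E) (hV : V ∈ ⋀[ℝ]^j E) : U * V ∈ ⋀[ℝ]^k E := by
  subst h
  rw [ExteriorAlgebra.exteriorPower, pow_add]
  exact Submodule.mul_mem_mul hU hV

theorem ιMulti_mem {j : ℕ} (v : Fin j → E) : ExteriorAlgebra.ιMulti ℝ j v ∈ ⋀[ℝ]^j E :=
  ExteriorAlgebra.ιMulti_range ℝ j ⟨v, rfl⟩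

theorem exteriorPower_induction {j : ℕ} {C : ExteriorAlgebra ℝ E → Prop}
    (h : ∀ v : Fin j → E, C (ExteriorAlgebra.ιMulti ℝ j v)) (h0 : C 0)
    (hadd : ∀ x y, C x → C y → C (x + y)) (hsmul : ∀ (c : ℝ) x, C x → C (c • x))
    {U : ExteriorAlgebra ℝ E} (hU : U ∈ ⋀[ℝ]^j E) : C U := by
  rw [← ExteriorAlgebra.ιMulti_span_fixedDegree] at hU
  induction hU using Submodule.span_induction with
  | mem x hx => obtain ⟨v, rfl⟩ := hx; exact h v
  | zero => exact h0
  | add x y _ _ hx hy => exact hadd x y hx hy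
  | smul c x _ hx => exact hsmul c x hx

/-- The antiderivation rule applied factor by factor; passing the first vector produces the
alternating signs. -/
theorem covContract_ιMulti_succ (φ : E →ₗ[ℝ] ℝ) {j : ℕ} (v : Fin (j + 1) → E) :
    covContract φ (ExteriorAlgebra.ιMulti ℝ (j + 1) v) =
      ∑ i : Fin (j + 1), ((-1 : ℝ) ^ (i : ℕ) * φ (v i)) •
        ExteriorAlgebra.ιMulti ℝ j (i.removeNth v) := by
  induction j with
  | zero =>
    have h := covContract_ι_mul φ (v 0) 1
    rw [mul_one, covContract_one, mul_zero, sub_zero] at h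
    simp [ExteriorAlgebra.ιMulti_succ_apply, h]
  | succ j ih =>
    rw [ExteriorAlgebra.ιMulti_succ_apply, covContract_ι_mul, Fin.sum_univ_succ]
    have h0 : Matrix.vecTail v = Fin.removeNth 0 v := by
      ext i; simp [Matrix.vecTail, Fin.removeNth]
    rw [h0, ih, Finset.mul_sum, sub_eq_add_neg, ← Finset.sum_neg_distrib]
    congr 1
    · simp
    · refine Finset.sum_congr rfl fun i _ => ?_
      rw [ExteriorAlgebra.ιMulti_succ_apply (Fin.removeNth i.succ v), mul_smul_comm, ← neg_smul]
      congr 1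
      · simp [Fin.removeNth, pow_succ]
      · congr 1
        congr 1
        ext k
        simp [Matrix.vecTail, Fin.removeNth]

theorem covContract_mem (φ : E →ₗ[ℝ] ℝ) {j : ℕ} {U : ExteriorAlgebra ℝ E}
    (hU : U ∈ ⋀[ℝ]^(j + 1) E) : covContract φ U ∈ ⋀[ℝ]^j E := by
  refine exteriorPower_induction (C := fun U => covContract φ U ∈ ⋀[ℝ]^j E) (fun v => ?_)
    (by simp) (fun x y hx hy => by rw [map_add]; exact add_mem hx hy)
    (fun c x hx => by rw [map_smul]; exact Submodule.smul_mem _ c hx) hU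
  rw [covContract_ιMulti_succ]
  exact Submodule.sum_mem _ fun i _ => Submodule.smul_mem _ _ (ιMulti_mem _)

theorem covContract_eq_zero (φ : E →ₗ[ℝ] ℝ) {U : ExteriorAlgebra ℝ E}
    (hU : U ∈ ⋀[ℝ]^0 E) : covContract φ U = 0 := by
  refine exteriorPower_induction (C := fun U => covContract φ U = 0) (fun v => ?_)
    (by simp) (fun x y hx hy => by rw [map_add, hx, hy, add_zero])
    (fun c x hx => by rw [map_smul, hx, smul_zero]) hU
  rw [ExteriorAlgebra.ιMulti_zero_apply, covContract_one]

/-- The functional `f` vanishes in all degrees other than `k`. -/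
def HasDegree (k : ℕ) (f : ExtDual E) : Prop := ∀ j ≠ k, ∀ U ∈ ⋀[ℝ]^j E, f U = 0

theorem HasDegree.add {k : ℕ} {f g : ExtDual E} (hf : HasDegree k f) (hg : HasDegree k g) :
    HasDegree k (f + g) := fun j hj U hU => by simp [hf j hj U hU, hg j hj U hU]

theorem HasDegree.sub {k : ℕ} {f g : ExtDual E} (hf : HasDegree k f) (hg : HasDegree k g) :
    HasDegree k (f - g) := fun j hj U hU => by simp [hf j hj U hU, hg j hj U hU]

theorem HasDegree.smul {k : ℕ} {f : ExtDual E} (hf : HasDegree k f) (c : ℝ) :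
    HasDegree k (c • f) := fun j hj U hU => by simp [hf j hj U hU]

theorem HasDegree.sum {k : ℕ} {ι : Type*} (s : Finset ι) {f : ι → ExtDual E}
    (hf : ∀ i ∈ s, HasDegree k (f i)) : HasDegree k (∑ i ∈ s, f i) := fun j hj U hU => by
  rw [LinearMap.sum_apply]
  exact Finset.sum_eq_zero fun i hi => hf i hi j hj U hU

theorem HasDegree.interior {k : ℕ} {f : ExtDual E} (hf : HasDegree (k + 1) f) (v : E) :
    HasDegree k (interior v f) := fun j hj U hU => by
  rw [interior_apply]
  exact hf (j + 1) (by omega) _ (ι_mul_mem v hU)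

theorem HasDegree.interior_eq_zero {f : ExtDual E} (hf : HasDegree 0 f) (v : E) :
    YangMills.interior v f = 0 := by
  ext j u
  simp only [LinearMap.compAlternatingMap_apply, interior_apply, LinearMap.zero_apply]
  exact hf (j + 1) (by omega) _ (ι_mul_mem v (ιMulti_mem u))

theorem HasDegree.exterior {k : ℕ} {f : ExtDual E} (hf : HasDegree k f) (φ : E →ₗ[ℝ] ℝ) :
    HasDegree (k + 1) (exterior φ f) := fun j hj U hU => by
  rw [exterior_apply]
  cases j with
  | zero => rw [covContract_eq_zero φ hU, map_zero]
  | succ j => exact hf j (by omega) _ (covContract_mem φ hU)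

theorem HasDegree.exteriorList {k : ℕ} {f : ExtDual E} (hf : HasDegree k f)
    (l : List (E →ₗ[ℝ] ℝ)) : HasDegree (k + l.length) (exteriorList l f) := by
  induction l with
  | nil => simpa using hf
  | cons φ l ih => rw [exteriorList_cons, List.length_cons, ← add_assoc]; exact ih.exterior φ

theorem HasDegree.ext {k : ℕ} {f g : ExtDual E} (hf : HasDegree k f) (hg : HasDegree k g)
    (h : ∀ v : Fin k → E, f (ExteriorAlgebra.ιMulti ℝ k v) = g (ExteriorAlgebra.ιMulti ℝ k v)) :
    f = g := by
  ext j v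
  simp only [LinearMap.compAlternatingMap_apply]
  by_cases hj : j = k
  · subst hj; exact h v
  · rw [hf j hj _ (ιMulti_mem v), hg j hj _ (ιMulti_mem v)]

theorem HasDegree.eq_smul_unitForm {f : ExtDual E} (hf : HasDegree 0 f) :
    f = f 1 • unitForm := by
  ext j v
  simp only [LinearMap.compAlternatingMap_apply]
  cases j with
  | zero => simp [unitForm]
  | succ j =>
    rw [hf (j + 1) (by omega) _ (ιMulti_mem v), ExteriorAlgebra.ιMulti_succ_apply]
    simp [unitForm, ExteriorAlgebra.algebraMapInv]

theorem unitForm_hasDegree : HasDegree 0 (unitForm : ExtDual E) := fun j hj U hU => by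
  refine exteriorPower_induction (C := fun U => (unitForm : ExtDual E) U = 0) (fun v => ?_)
    (by simp) (fun x y hx hy => by rw [map_add, hx, hy, add_zero])
    (fun c x hx => by rw [map_smul, hx, smul_zero]) hU
  obtain ⟨j, rfl⟩ := Nat.exists_eq_succ_of_ne_zero hj
  rw [ExteriorAlgebra.ιMulti_succ_apply]
  simp [unitForm, ExteriorAlgebra.algebraMapInv]

/-! ### Forms as functionals on the exterior algebra -/

theorem evalForm_apply_ιMulti {k : ℕ} (η : E [⋀^Fin k]→ₗ[ℝ] ℝ) (v : Fin k → E) :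
    evalForm η (ExteriorAlgebra.ιMulti ℝ k v) = η v := by
  simp [evalForm]

theorem evalForm_hasDegree {k : ℕ} (η : E [⋀^Fin k]→ₗ[ℝ] ℝ) : HasDegree k (evalForm η) := by
  intro j hj U hU
  refine exteriorPower_induction (C := fun U => evalForm η U = 0) (fun v => ?_)
    (by simp) (fun x y hx hy => by rw [map_add, hx, hy, add_zero])
    (fun c x hx => by rw [map_smul, hx, smul_zero]) hU
  simp [evalForm, hj]

/-- `evalForm` as a linear map. -/
def evalFormL (k : ℕ) : (E [⋀^Fin k]→ₗ[ℝ] ℝ) →ₗ[ℝ] ExtDual E where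
  toFun := evalForm
  map_add' η ζ := ((evalForm_hasDegree _).ext ((evalForm_hasDegree η).add (evalForm_hasDegree ζ))
    fun v => by simp [evalForm_apply_ιMulti])
  map_smul' c η := ((evalForm_hasDegree _).ext ((evalForm_hasDegree η).smul c)
    fun v => by simp [evalForm_apply_ιMulti])

@[simp] theorem evalFormL_apply {k : ℕ} (η : E [⋀^Fin k]→ₗ[ℝ] ℝ) :
    evalFormL k η = evalForm η := rfl

theorem evalForm_injective {k : ℕ} :
    Function.Injective (evalForm : (E [⋀^Fin k]→ₗ[ℝ] ℝ) → ExtDual E) := by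
  intro η ζ h
  ext v
  rw [← evalForm_apply_ιMulti, h, evalForm_apply_ιMulti]

/-- The component of degree `k` of a functional on the exterior algebra. -/
def degreePart (k : ℕ) : ExtDual E →ₗ[ℝ] E [⋀^Fin k]→ₗ[ℝ] ℝ where
  toFun f := f.compAlternatingMap (ExteriorAlgebra.ιMulti ℝ k)
  map_add' f g := by ext; simp
  map_smul' c f := by ext; simp

theorem evalForm_degreePart {k : ℕ} {f : ExtDual E} (hf : HasDegree k f) :
    evalForm (degreePart k f) = f :=
  (evalForm_hasDegree _).ext hf fun v => by rw [evalForm_apply_ιMulti]; rfl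

theorem contract_hasDegree {p a k : ℕ} (h : p + a = k) {f : ExtDual E} (hf : HasDegree k f)
    {U : ExteriorAlgebra ℝ E} (hU : U ∈ ⋀[ℝ]^p E) :
    HasDegree a (f.comp (LinearMap.mulLeft ℝ U)) := fun j hj V hV => by
  simp only [LinearMap.comp_apply, LinearMap.mulLeft_apply]
  exact hf (p + j) (by omega) _ (mul_mem_exteriorPower rfl hU hV)

/-- Homogeneity of `U` with matching degree is essential: `contract` retains only the component of
degree `a` of the functional on the right. -/
theorem evalForm_contract {p a k : ℕ} (h : p + a = k) (η : E [⋀^Fin k]→ₗ[ℝ] ℝ)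
    {U : ExteriorAlgebra ℝ E} (hU : U ∈ ⋀[ℝ]^p E) :
    evalForm (contract a U η) = (evalForm η).comp (LinearMap.mulLeft ℝ U) :=
  evalForm_degreePart (contract_hasDegree h (evalForm_hasDegree η) hU)

theorem covectorWedge_apply {k : ℕ} (φ : Fin k → E →ₗ[ℝ] ℝ) (v : Fin k → E) :
    covectorWedge φ v = (Matrix.of fun i j => φ j (v i)).det := rfl

/-- Laplace expansion of the determinant along its first column is the expansion of the contraction
by `φ 0`. -/
theorem evalForm_covectorWedge_succ {k : ℕ} (φ : Fin (k + 1) → E →ₗ[ℝ] ℝ) :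
    evalForm (covectorWedge φ) = exterior (φ 0) (evalForm (covectorWedge (Fin.tail φ))) := by
  refine (evalForm_hasDegree _).ext ((evalForm_hasDegree _).exterior _) fun v => ?_
  rw [evalForm_apply_ιMulti, exterior_apply, covContract_ιMulti_succ, map_sum]
  simp only [map_smul, evalForm_apply_ιMulti, smul_eq_mul]
  rw [covectorWedge_apply, Matrix.det_succ_column_zero]
  rfl

theorem evalForm_covectorWedge_zero (φ : Fin 0 → E →ₗ[ℝ] ℝ) :
    evalForm (covectorWedge φ) = unitForm := by
  refine (evalForm_hasDegree _).ext unitForm_hasDegree fun v => ?_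
  rw [evalForm_apply_ιMulti]
  simp [covectorWedge_apply, unitForm]

theorem evalForm_covectorWedge {k : ℕ} (φ : Fin k → E →ₗ[ℝ] ℝ) :
    evalForm (covectorWedge φ) = exteriorList (List.ofFn φ) unitForm := by
  induction k with
  | zero => simp [evalForm_covectorWedge_zero]
  | succ k ih =>
    rw [evalForm_covectorWedge_succ, ih, List.ofFn_succ, exteriorList_cons]
    rfl

theorem alternatingMap_sum_apply {ι : Type*} (s : Finset ι) {k : ℕ} (g : ι → E [⋀^Fin k]→ₗ[ℝ] ℝ)
    (w : Fin k → E) : (∑ i ∈ s, g i) w = ∑ i ∈ s, g i w := by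
  classical
  induction s using Finset.induction_on with
  | empty => simp
  | insert i s hi ih => rw [Finset.sum_insert hi, Finset.sum_insert hi, AlternatingMap.add_apply, ih]

/-- The pointwise form of d = Σ e^i ∧ ∂_i: expanding the singled-out argument in the basis turns the
alternating sum over slots into multiplication by coordinate covectors. -/
theorem evalForm_alternatizeUncurryFin {ι : Type*} [Fintype ι] (b : Module.Basis ι ℝ E) {k : ℕ}
    (f : E →ₗ[ℝ] E [⋀^Fin k]→ₗ[ℝ] ℝ) :
    evalForm (AlternatingMap.alternatizeUncurryFin f) =
      ∑ i, exterior (b.coord i) (evalForm (f (b i))) := by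
  refine (evalForm_hasDegree _).ext
    (HasDegree.sum _ fun i _ => (evalForm_hasDegree _).exterior _) fun v => ?_
  rw [evalForm_apply_ιMulti, AlternatingMap.alternatizeUncurryFin_apply, LinearMap.sum_apply]
  simp only [exterior_apply, covContract_ιMulti_succ, map_sum, map_smul, evalForm_apply_ιMulti]
  rw [Finset.sum_comm]
  refine Finset.sum_congr rfl fun j _ => ?_
  conv_lhs => rw [← b.sum_repr (v j)]
  simp only [map_sum, map_smul, alternatingMap_sum_apply, Finset.smul_sum, Module.Basis.coord_apply, smul_eq_mul,
    mul_assoc]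
  refine Finset.sum_congr rfl fun i _ => ?_
  simp [zsmul_eq_mul]

/-! ### Exterior products with decomposable forms -/

/-- Euler's identity: the number operator counts the degree as soon as contractions with `f` see a
vector only through its values under the `φ i`. Splitting off the first argument `v 0`, one term
returns `f` by this hypothesis, and the rest is the identity for the contraction of `f` with `v 0`.
It serves both for full bases and for the dx^μ alone. -/
theorem sum_exterior_interior {ι : Type*} [Fintype ι] (u : ι → E) (φ : ι → E →ₗ[ℝ] ℝ) {k : ℕ}
    {f : ExtDual E} (hk : HasDegree k f)
    (hf : ∀ v, interior v f = ∑ i, φ i v • interior (u i) f) :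
    ∑ i, exterior (φ i) (interior (u i) f) = (k : ℝ) • f := by
  have key : ∀ (j : ℕ) (v : Fin j → E) (f : ExtDual E),
      (∀ v, interior v f = ∑ i, φ i v • interior (u i) f) →
      ∑ i, f (ExteriorAlgebra.ι ℝ (u i) * covContract (φ i) (ExteriorAlgebra.ιMulti ℝ j v)) =
        (j : ℝ) * f (ExteriorAlgebra.ιMulti ℝ j v) := by
    intro j
    induction j with
    | zero => intro v f _; simp [covContract_one]
    | succ j ih =>
      intro v f hf
      rw [ExteriorAlgebra.ιMulti_succ_apply]
      simp only [covContract_ι_mul, mul_sub, map_sub, Finset.sum_sub_distrib]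
      have h1 : ∑ i, f (ExteriorAlgebra.ι ℝ (u i) *
          (φ i (v 0) • ExteriorAlgebra.ιMulti ℝ j (Matrix.vecTail v))) =
          f (ExteriorAlgebra.ι ℝ (v 0) * ExteriorAlgebra.ιMulti ℝ j (Matrix.vecTail v)) := by
        have := congrArg (fun g : ExtDual E => g (ExteriorAlgebra.ιMulti ℝ j (Matrix.vecTail v)))
          (hf (v 0))
        simp only [interior_apply, LinearMap.sum_apply, LinearMap.smul_apply] at this
        rw [this]
        refine Finset.sum_congr rfl fun i _ => ?_
        rw [mul_smul_comm, map_smul]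
      have h2 := ih (Matrix.vecTail v) (interior (v 0) f) fun w => by
        rw [interior_comm, hf w, map_sum, ← Finset.sum_neg_distrib]
        refine Finset.sum_congr rfl fun i _ => ?_
        rw [map_smul, interior_comm, smul_neg, neg_neg]
      simp only [interior_apply] at h2
      have h3 : ∀ i, f (ExteriorAlgebra.ι ℝ (u i) * (ExteriorAlgebra.ι ℝ (v 0) *
          covContract (φ i) (ExteriorAlgebra.ιMulti ℝ j (Matrix.vecTail v)))) =
          -f (ExteriorAlgebra.ι ℝ (v 0) * (ExteriorAlgebra.ι ℝ (u i) *
          covContract (φ i) (ExteriorAlgebra.ιMulti ℝ j (Matrix.vecTail v)))) := by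
        intro i
        have := congrArg (fun g : ExtDual E => g (covContract (φ i)
          (ExteriorAlgebra.ιMulti ℝ j (Matrix.vecTail v)))) (interior_comm (v 0) (u i) f)
        simpa using this
      simp only [h1, h3, Finset.sum_neg_distrib, h2]
      push_cast
      ring
  have hd : HasDegree k (∑ i, exterior (φ i) (interior (u i) f)) := by
    refine HasDegree.sum _ fun i _ => ?_
    cases k with
    | zero =>
      rw [hk.interior_eq_zero, map_zero]
      intro j hj U hU
      rfl
    | succ k => exact (hk.interior _).exterior _
  refine hd.ext (hk.smul _) fun v => ?_
  simpa [LinearMap.sum_apply] using key k v f hf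

theorem interior_eq_sum_basis {ι : Type*} [Fintype ι] (b : Module.Basis ι ℝ E) (f : ExtDual E)
    (v : E) : interior v f = ∑ i, b.coord i v • interior (b i) f := by
  conv_lhs => rw [← b.sum_repr v]
  rw [map_sum, LinearMap.sum_apply]
  simp

/-- By Euler's identity (k+1) f is the sum of the products of the coordinates with contractions of
`f`, to which induction on the degree applies. -/
theorem HasDegree.mem_span {ι : Type*} [Fintype ι] (b : Module.Basis ι ℝ E) {k : ℕ}
    {f : ExtDual E} (hf : HasDegree k f) :
    f ∈ Submodule.span ℝ (Set.range fun s : Fin k → ι =>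
      YangMills.exteriorList (List.ofFn fun i => b.coord (s i)) unitForm) := by
  induction k generalizing f with
  | zero =>
    rw [hf.eq_smul_unitForm]
    exact Submodule.smul_mem _ _ (Submodule.subset_span ⟨Fin.elim0, by simp⟩)
  | succ k ih =>
    have h := sum_exterior_interior b (fun i => b.coord i) hf (interior_eq_sum_basis b f)
    have h2 : f = ((k + 1 : ℕ) : ℝ)⁻¹ •
        ∑ i, YangMills.exterior (b.coord i) (YangMills.interior (b i) f) := by
      rw [h, inv_smul_smul₀ (by positivity)]
    rw [h2]
    refine Submodule.smul_mem _ _ (Submodule.sum_mem _ fun i _ => ?_)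
    have h3 := Submodule.mem_map_of_mem (f := YangMills.exterior (b.coord i))
      (ih (hf.interior (b i)))
    rw [Submodule.map_span, ← Set.range_comp] at h3
    refine Submodule.span_mono ?_ h3
    rintro _ ⟨s, rfl⟩
    exact ⟨Fin.cons i s, by simp [List.ofFn_succ]⟩

theorem covectorWedge_eq_alternatization {k : ℕ} (φ : Fin k → E →ₗ[ℝ] ℝ) :
    covectorWedge φ = MultilinearMap.alternatization
      ((MultilinearMap.mkPiAlgebra ℝ (Fin k) ℝ).compLinearMap φ) := by
  ext v
  rw [MultilinearMap.alternatization_apply, covectorWedge_apply, Matrix.det_apply]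
  refine Finset.sum_congr rfl fun σ _ => ?_
  simp

/-- The product by shuffles commutes with alternatization, so both sides alternate the same product
of linear functions; only the relabelling by `finSumFinEquiv` remains. -/
theorem wedgeAlt_covectorWedge {a b : ℕ} (φ : Fin a → E →ₗ[ℝ] ℝ) (ψ : Fin b → E →ₗ[ℝ] ℝ) :
    wedgeAlt (covectorWedge φ) (covectorWedge ψ) = covectorWedge (Fin.append φ ψ) := by
  rw [covectorWedge_eq_alternatization, covectorWedge_eq_alternatization, wedgeAlt,
    ← MultilinearMap.domCoprod_alternization]
  ext v
  simp only [AlternatingMap.domDomCongr_apply, LinearMap.compAlternatingMap_apply,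
    MultilinearMap.alternatization_apply, map_sum]
  rw [covectorWedge_apply, Matrix.det_apply, ← Equiv.sum_comp (finSumFinEquiv (m := a) (n := b)).permCongr]
  refine Finset.sum_congr rfl fun σ _ => ?_
  rw [Equiv.Perm.sign_permCongr, Units.smul_def, Units.smul_def, map_zsmul]
  congr 1
  rw [Fin.prod_univ_add]
  simp [MultilinearMap.domDomCongr_apply, MultilinearMap.domCoprod_apply]

/-- `wedgeAlt` as a bilinear map. -/
def wedgeL (a b : ℕ) : (E [⋀^Fin a]→ₗ[ℝ] ℝ) →ₗ[ℝ] (E [⋀^Fin b]→ₗ[ℝ] ℝ) →ₗ[ℝ]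
    E [⋀^Fin (a + b)]→ₗ[ℝ] ℝ :=
  LinearMap.mk₂ ℝ wedgeAlt
    (fun α α' β => by
      ext v; simp [wedgeAlt, ← AlternatingMap.domCoprod'_apply, TensorProduct.add_tmul])
    (fun c α β => by
      ext v; simp [wedgeAlt, ← AlternatingMap.domCoprod'_apply, ← TensorProduct.smul_tmul'])
    (fun α β β' => by
      ext v; simp [wedgeAlt, ← AlternatingMap.domCoprod'_apply, TensorProduct.tmul_add])
    (fun c α β => by
      ext v; simp [wedgeAlt, ← AlternatingMap.domCoprod'_apply])

@[simp] theorem wedgeL_apply {a b : ℕ} (α : E [⋀^Fin a]→ₗ[ℝ] ℝ) (β : E [⋀^Fin b]→ₗ[ℝ] ℝ) :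
    wedgeL a b α β = wedgeAlt α β := rfl

theorem mem_span_covectorWedge {ι : Type*} [Fintype ι] (b : Module.Basis ι ℝ E) {k : ℕ}
    (η : E [⋀^Fin k]→ₗ[ℝ] ℝ) :
    η ∈ Submodule.span ℝ (Set.range fun s : Fin k → ι => covectorWedge fun i => b.coord (s i)) := by
  have h := (evalForm_hasDegree η).mem_span b
  simp only [← evalForm_covectorWedge] at h
  have h2 := Submodule.mem_map_of_mem (f := degreePart (E := E) k) h
  rw [Submodule.map_span, ← Set.range_comp] at h2
  have h3 : ∀ ζ : E [⋀^Fin k]→ₗ[ℝ] ℝ, degreePart k (evalForm ζ) = ζ := fun ζ =>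
    evalForm_injective (evalForm_degreePart (evalForm_hasDegree ζ))
  simpa [Function.comp_def, h3] using h2

/-- By linearity `η` may be taken to be a product of `a` coordinates; moving the `k` covectors `ψ`
in front of them costs the sign. -/
theorem evalForm_wedgeAlt [FiniteDimensional ℝ E] {a k : ℕ} (η : E [⋀^Fin a]→ₗ[ℝ] ℝ)
    (ψ : Fin k → E →ₗ[ℝ] ℝ) :
    evalForm (wedgeAlt η (covectorWedge ψ)) =
      (-1 : ℝ) ^ (a * k) • exteriorList (List.ofFn ψ) (evalForm η) := by
  have h := mem_span_covectorWedge (Module.finBasis ℝ E) η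
  suffices ((evalFormL (a + k)).comp ((wedgeL a k).flip (covectorWedge ψ))) η =
      ((-1 : ℝ) ^ (a * k) • (exteriorList (List.ofFn ψ)).comp (evalFormL a)) η by simpa using this
  refine LinearMap.eqOn_span ?_ h
  rintro _ ⟨s, rfl⟩
  simp only [LinearMap.comp_apply, LinearMap.flip_apply, wedgeL_apply, evalFormL_apply,
    LinearMap.smul_apply]
  rw [wedgeAlt_covectorWedge, evalForm_covectorWedge, evalForm_covectorWedge,
    List.ofFn_fin_append, exteriorList_append, exteriorList_comm, List.length_ofFn,
    List.length_ofFn]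

end Operators

/-! ## Pullbacks -/

section Pullback

variable {E E' : Type*} [NormedAddCommGroup E] [NormedSpace ℝ E]
  [NormedAddCommGroup E'] [NormedSpace ℝ E']

/-- The pullback of functionals on the exterior algebra along a linear map. -/
def pullForm (L : E →ₗ[ℝ] E') : ExtDual E' →ₗ[ℝ] ExtDual E where
  toFun f := f.comp (ExteriorAlgebra.map L).toLinearMap
  map_add' f g := by ext; simp
  map_smul' c f := by ext; simp

theorem pullForm_apply (L : E →ₗ[ℝ] E') (f : ExtDual E') (U : ExteriorAlgebra ℝ E) :
    pullForm L f U = f (ExteriorAlgebra.map L U) := rfl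

theorem covContract_map (L : E →ₗ[ℝ] E') (φ : E' →ₗ[ℝ] ℝ) (U : ExteriorAlgebra ℝ E) :
    covContract φ (ExteriorAlgebra.map L U) = ExteriorAlgebra.map L (covContract (φ.comp L) U) := by
  suffices (covContract φ).comp (ExteriorAlgebra.map L).toLinearMap =
      (ExteriorAlgebra.map L).toLinearMap.comp (covContract (φ.comp L)) from
    LinearMap.congr_fun this U
  refine ExteriorAlgebra.lhom_ext fun j => AlternatingMap.ext fun v => ?_
  simp only [LinearMap.compAlternatingMap_apply, LinearMap.comp_apply, AlgHom.toLinearMap_apply,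
    ExteriorAlgebra.map_apply_ιMulti]
  cases j with
  | zero => simp [covContract_one]
  | succ j =>
    rw [covContract_ιMulti_succ, covContract_ιMulti_succ, map_sum]
    refine Finset.sum_congr rfl fun i _ => ?_
    rw [map_smul, ExteriorAlgebra.map_apply_ιMulti]
    rfl

theorem pullForm_exterior (L : E →ₗ[ℝ] E') (φ : E' →ₗ[ℝ] ℝ) (f : ExtDual E') :
    pullForm L (exterior φ f) = exterior (φ.comp L) (pullForm L f) :=
  LinearMap.ext fun U => by simp [pullForm_apply, covContract_map]

theorem interior_pullForm (L : E →ₗ[ℝ] E') (v : E) (f : ExtDual E') :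
    interior v (pullForm L f) = pullForm L (interior (L v) f) :=
  LinearMap.ext fun U => by simp [pullForm_apply]

theorem pullForm_unitForm (L : E →ₗ[ℝ] E') : pullForm L unitForm = unitForm := by
  refine HasDegree.ext (k := 0) (fun j hj U hU => ?_) unitForm_hasDegree fun v => ?_
  · refine unitForm_hasDegree j hj _ ?_
    refine exteriorPower_induction (C := fun U => ExteriorAlgebra.map L U ∈ ⋀[ℝ]^j E')
      (fun v => ?_) (by simp) (fun x y hx hy => by rw [map_add]; exact add_mem hx hy)
      (fun c x hx => by rw [map_smul]; exact Submodule.smul_mem _ c hx) hU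
    rw [ExteriorAlgebra.map_apply_ιMulti]
    exact ιMulti_mem _
  · rw [pullForm_apply, ExteriorAlgebra.map_apply_ιMulti, ExteriorAlgebra.ιMulti_zero_apply,
      ExteriorAlgebra.ιMulti_zero_apply, unitForm, unitForm, AlgHom.toLinearMap_apply,
      AlgHom.toLinearMap_apply, map_one, map_one]

theorem map_mem_exteriorPower (L : E →ₗ[ℝ] E') {j : ℕ} {U : ExteriorAlgebra ℝ E}
    (hU : U ∈ ⋀[ℝ]^j E) : ExteriorAlgebra.map L U ∈ ⋀[ℝ]^j E' := by
  refine exteriorPower_induction (C := fun U => ExteriorAlgebra.map L U ∈ ⋀[ℝ]^j E')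
    (fun v => ?_) (by simp) (fun x y hx hy => by rw [map_add]; exact add_mem hx hy)
    (fun c x hx => by rw [map_smul]; exact Submodule.smul_mem _ c hx) hU
  rw [ExteriorAlgebra.map_apply_ιMulti]
  exact ιMulti_mem _

theorem pullForm_hasDegree (L : E →ₗ[ℝ] E') {k : ℕ} {f : ExtDual E'} (hf : HasDegree k f) :
    HasDegree k (pullForm L f) :=
  fun j hj _ hU => hf j hj _ (map_mem_exteriorPower L hU)

theorem pullForm_exteriorList (L : E →ₗ[ℝ] E') (l : List (E' →ₗ[ℝ] ℝ)) (f : ExtDual E') :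
    pullForm L (exteriorList l f) = exteriorList (l.map fun φ => φ.comp L) (pullForm L f) := by
  induction l with
  | nil => rfl
  | cons φ l ih => rw [exteriorList_cons, pullForm_exterior, ih, List.map_cons, exteriorList_cons]

theorem evalForm_compLinearMap (L : E →ₗ[ℝ] E') {k : ℕ} (η : E' [⋀^Fin k]→ₗ[ℝ] ℝ) :
    evalForm (η.compLinearMap L) = pullForm L (evalForm η) :=
  (evalForm_hasDegree _).ext (pullForm_hasDegree L (evalForm_hasDegree η)) fun v => by
    rw [pullForm_apply, ExteriorAlgebra.map_apply_ιMulti, evalForm_apply_ιMulti,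
      evalForm_apply_ιMulti]
    rfl

theorem exterior_exteriorList_of_mem {φ : E →ₗ[ℝ] ℝ} {l : List (E →ₗ[ℝ] ℝ)} (h : φ ∈ l)
    (f : ExtDual E) : exterior φ (exteriorList l f) = 0 := by
  induction l with
  | nil => simp at h
  | cons ψ l ih =>
    rw [exteriorList_cons]
    rcases List.mem_cons.mp h with rfl | h
    · exact exterior_self _ _
    · rw [exterior_comm, ih h, map_zero, neg_zero]

/-- Contracting with `v` and then multiplying by `φ` is a derivation, which sends each factor to its
value on `v` times `φ`. For dⁿx and ∂_ν a single factor is replaced, which is how `wedgeDnx` is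
defined. -/
theorem exterior_interior_covectorWedge {k : ℕ} (φ : E →ₗ[ℝ] ℝ) (v : E)
    (ψ : Fin k → E →ₗ[ℝ] ℝ) :
    exterior φ (interior v (evalForm (covectorWedge ψ))) =
      ∑ j, ψ j v • evalForm (covectorWedge (Function.update ψ j φ)) := by
  induction k with
  | zero =>
    rw [evalForm_covectorWedge_zero, interior_unitForm, map_zero]
    simp
  | succ k ih =>
    rw [evalForm_covectorWedge_succ, interior_exterior, map_sub, map_smul, exterior_comm, ih,
      Fin.sum_univ_succ, sub_neg_eq_add, map_sum]
    congr 1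
    · rw [evalForm_covectorWedge_succ, Fin.tail_update_zero, Function.update_self]
    · refine Finset.sum_congr rfl fun j _ => ?_
      rw [map_smul, evalForm_covectorWedge_succ, Fin.tail_update_succ,
        Function.update_of_ne (Fin.succ_ne_zero j).symm]
      rfl

end Pullback

/-- The projection of `R` onto its image in `V` has a linear section over a field, and its second
component extends to all of `V`. Values off the image carry no information. -/
theorem exists_linear_selection {V W : Type*} [AddCommGroup V] [Module ℝ V] [AddCommGroup W]
    [Module ℝ W] (R : Submodule ℝ (V × W)) :
    ∃ t : V →ₗ[ℝ] W, ∀ f x, (f, x) ∈ R → (f, t f) ∈ R := by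
  let p : R →ₗ[ℝ] V := (LinearMap.fst ℝ V W).comp R.subtype
  obtain ⟨s, hs⟩ := p.rangeRestrict.exists_rightInverse_of_surjective p.range_rangeRestrict
  obtain ⟨t, ht⟩ := ((LinearMap.snd ℝ V W).comp (R.subtype.comp s)).exists_extend
  refine ⟨t, fun f x hf => ?_⟩
  have hfp : f ∈ LinearMap.range p := ⟨⟨(f, x), hf⟩, rfl⟩
  have h1 : t f = (s ⟨f, hfp⟩).1.2 := LinearMap.congr_fun ht ⟨f, hfp⟩
  have h2 : (s ⟨f, hfp⟩).1.1 = f := congrArg Subtype.val (LinearMap.congr_fun hs ⟨f, hfp⟩)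
  have h3 := (s ⟨f, hfp⟩).2
  rwa [show (s ⟨f, hfp⟩).1 = (f, t f) from Prod.ext h2 h1.symm] at h3

/-! ## Linear polysymplectic models -/

/-- A polysymplectic form (`omega ν` being its components) on a vector space that is split by
`n` covectors `dx μ` and dual vectors `base μ`. -/
structure PolyModel (n : ℕ) (E : Type*) [NormedAddCommGroup E] [NormedSpace ℝ E] where
  dx : Fin n → E →ₗ[ℝ] ℝ
  base : Fin n → E
  omega : Fin n → E →ₗ[ℝ] E →ₗ[ℝ] ℝ
  dx_base : ∀ μ ν, dx μ (base ν) = if μ = ν then 1 else 0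
  omega_skew : ∀ ν X v, omega ν X v = -omega ν v X
  omega_base : ∀ ν X μ, omega ν X (base μ) = 0

namespace PolyModel

variable {n : ℕ} {E : Type*} [NormedAddCommGroup E] [NormedSpace ℝ E] (M : PolyModel n E)

/-- The vectors that are annihilated by the covectors `dx μ`. -/
def vertical : Submodule ℝ E where
  carrier := {v | ∀ μ, M.dx μ v = 0}
  add_mem' hv hw μ := by rw [map_add, hv μ, hw μ, add_zero]
  zero_mem' μ := map_zero _
  smul_mem' c v hv μ := by rw [map_smul, hv μ, smul_zero]

theorem sub_mem_vertical (v : E) : v - ∑ μ, M.dx μ v • M.base μ ∈ M.vertical := by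
  intro μ
  rw [map_sub, map_sum]
  simp [M.dx_base]

/-- The volume form `dx¹ ∧ ⋯ ∧ dxⁿ`. -/
def vol : ExtDual E := exteriorList (List.ofFn M.dx) unitForm

/-- The form `d^{n-1}x_ν`. -/
def volN (ν : Fin n) : ExtDual E := interior (M.base ν) M.vol

/-- The exterior multiplication by `dx^{μ₁} ∧ ⋯ ∧ dx^{μₖ}`. -/
def dxList (l : List (Fin n)) : Module.End ℝ (ExtDual E) := exteriorList (l.map M.dx)

@[simp] theorem dxList_nil (f : ExtDual E) : M.dxList [] f = f := rfl

@[simp] theorem dxList_cons (μ : Fin n) (l : List (Fin n)) (f : ExtDual E) :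
    M.dxList (μ :: l) f = exterior (M.dx μ) (M.dxList l f) := by
  simp [dxList]

theorem dxList_append (l l' : List (Fin n)) (f : ExtDual E) :
    M.dxList (l ++ l') f = M.dxList l (M.dxList l' f) := by
  rw [dxList, List.map_append, exteriorList_append]
  rfl

theorem dxList_exterior (l : List (Fin n)) (φ : E →ₗ[ℝ] ℝ) (f : ExtDual E) :
    M.dxList l (exterior φ f) = (-1 : ℝ) ^ l.length • exterior φ (M.dxList l f) := by
  rw [dxList, exteriorList_exterior, List.length_map]

theorem interior_dxList {v : E} (hv : v ∈ M.vertical) (l : List (Fin n)) (f : ExtDual E) :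
    interior v (M.dxList l f) = (-1 : ℝ) ^ l.length • M.dxList l (interior v f) := by
  rw [dxList, interior_exteriorList, List.length_map]
  intro φ hφ
  obtain ⟨μ, -, rfl⟩ := List.mem_map.mp hφ
  exact hv μ

theorem interior_exterior_vertical {v : E} (hv : v ∈ M.vertical) (μ : Fin n) (f : ExtDual E) :
    interior v (exterior (M.dx μ) f) = -exterior (M.dx μ) (interior v f) := by
  rw [interior_exterior, hv μ, zero_smul, zero_sub]

theorem interior_exterior_base (ν μ : Fin n) (f : ExtDual E) :
    interior (M.base ν) (exterior (M.dx μ) f) =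
      (if μ = ν then f else 0) - exterior (M.dx μ) (interior (M.base ν) f) := by
  rw [interior_exterior, M.dx_base]
  split_ifs <;> simp

/-- A functional is horizontal if its contractions with vertical vectors vanish. -/
def IsHor (f : ExtDual E) : Prop := ∀ v ∈ M.vertical, interior v f = 0

variable {M}

theorem IsHor.interior_eq {f : ExtDual E} (hf : M.IsHor f) (v : E) :
    interior v f = ∑ μ, M.dx μ v • interior (M.base μ) f := by
  have h := hf _ (M.sub_mem_vertical v)
  rw [map_sub, map_sum, LinearMap.sub_apply, LinearMap.sum_apply] at h
  simp only [map_smul, LinearMap.smul_apply] at h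
  refine LinearMap.ext fun U => ?_
  have h2 := LinearMap.congr_fun h U
  rw [LinearMap.sub_apply, LinearMap.zero_apply] at h2
  linarith

theorem IsHor.interior {f : ExtDual E} (hf : M.IsHor f) (v : E) :
    M.IsHor (interior v f) := fun w hw => by
  rw [interior_comm, hf w hw, map_zero, neg_zero]

theorem IsHor.exterior {f : ExtDual E} (hf : M.IsHor f) (μ : Fin n) :
    M.IsHor (exterior (M.dx μ) f) := fun w hw => by
  rw [M.interior_exterior_vertical hw, hf w hw, map_zero, neg_zero]

theorem IsHor.dxList {f : ExtDual E} (hf : M.IsHor f) (l : List (Fin n)) :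
    M.IsHor (M.dxList l f) := fun w hw => by
  rw [M.interior_dxList hw, hf w hw, map_zero, smul_zero]

theorem IsHor.add {f g : ExtDual E} (hf : M.IsHor f) (hg : M.IsHor g) : M.IsHor (f + g) :=
  fun w hw => by rw [map_add, hf w hw, hg w hw, add_zero]

theorem IsHor.smul {f : ExtDual E} (hf : M.IsHor f) (c : ℝ) : M.IsHor (c • f) :=
  fun w hw => by rw [map_smul, hf w hw, smul_zero]

theorem IsHor.sum {ι : Type*} (s : Finset ι) {f : ι → ExtDual E} (hf : ∀ i ∈ s, M.IsHor (f i)) :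
    M.IsHor (∑ i ∈ s, f i) := fun w hw => by
  rw [map_sum]
  exact Finset.sum_eq_zero fun i hi => hf i hi w hw

theorem isHor_unitForm : M.IsHor unitForm := fun w _ => interior_unitForm w

variable (M)

theorem vol_eq_dxList : M.vol = M.dxList (List.finRange n) unitForm := by
  rw [vol, dxList, List.ofFn_eq_map]

theorem isHor_vol : M.IsHor M.vol := by
  rw [vol_eq_dxList]
  exact isHor_unitForm.dxList _

theorem isHor_volN (ν : Fin n) : M.IsHor (M.volN ν) := M.isHor_vol.interior _

theorem exterior_dx_vol (μ : Fin n) : exterior (M.dx μ) M.vol = 0 :=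
  exterior_exteriorList_of_mem (List.mem_ofFn.mpr ⟨μ, rfl⟩) _

/-- The contraction of dx^μ ∧ dⁿx = 0 with ∂_ν. -/
theorem exterior_dx_volN (μ ν : Fin n) :
    exterior (M.dx μ) (M.volN ν) = if μ = ν then M.vol else 0 := by
  have h := M.interior_exterior_base ν μ M.vol
  rw [exterior_dx_vol, map_zero] at h
  exact (sub_eq_zero.mp h.symm).symm

theorem exterior_dx_sum_volN (μ : Fin n) (a : Fin n → ℝ) :
    exterior (M.dx μ) (∑ ν, a ν • M.volN ν) = a μ • M.vol := by
  rw [map_sum, Finset.sum_eq_single μ (fun ν _ hν => by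
    rw [map_smul, exterior_dx_volN, if_neg hν.symm, smul_zero]) (by simp), map_smul,
    exterior_dx_volN, if_pos rfl]

theorem vol_hasDegree : HasDegree n M.vol := by
  have h := unitForm_hasDegree.exteriorList (List.ofFn M.dx)
  rwa [zero_add, List.length_ofFn] at h

theorem vol_apply : M.vol (ExteriorAlgebra.ιMulti ℝ n M.base) = 1 := by
  rw [vol, ← evalForm_covectorWedge, evalForm_apply_ιMulti, covectorWedge_apply]
  have : (Matrix.of fun i j => M.dx j (M.base i)) = 1 := by
    ext i j
    simp [M.dx_base, Matrix.one_apply, eq_comm]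
  rw [this, Matrix.det_one]

/-- The coefficient of `d^{n-1}x_μ`. -/
def coeffN (μ : Fin n) : ExtDual E →ₗ[ℝ] ℝ :=
  (LinearMap.applyₗ (ExteriorAlgebra.ιMulti ℝ n M.base)).comp (exterior (M.dx μ))

theorem coeffN_sum (μ : Fin n) (a : Fin n → ℝ) :
    M.coeffN μ (∑ ν, a ν • M.volN ν) = a μ := by
  change exterior (M.dx μ) (∑ ν, a ν • M.volN ν) (ExteriorAlgebra.ιMulti ℝ n M.base) = a μ
  rw [exterior_dx_sum_volN, LinearMap.smul_apply, vol_apply, smul_eq_mul, mul_one]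

/-- The horizontal degree operator. -/
def hdeg : Module.End ℝ (ExtDual E) :=
  ∑ μ, (exterior (M.dx μ)).comp (interior (M.base μ))

theorem hdeg_apply (f : ExtDual E) :
    M.hdeg f = ∑ μ, exterior (M.dx μ) (interior (M.base μ) f) := by
  rw [hdeg, LinearMap.sum_apply]
  rfl

/-- Each of the `n` anticommutation relations contributes one copy of `f`. This identity recovers a
form from its products with the dx^μ. -/
theorem sum_interior_exterior (f : ExtDual E) :
    ∑ μ, interior (M.base μ) (exterior (M.dx μ) f) = (n : ℝ) • f - M.hdeg f := by
  simp only [interior_exterior_base, if_true, Finset.sum_sub_distrib, hdeg_apply]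
  simp only [Finset.sum_const, Finset.card_univ, Fintype.card_fin]
  rw [Nat.cast_smul_eq_nsmul]

theorem hdeg_interior (ν : Fin n) (f : ExtDual E) :
    M.hdeg (interior (M.base ν) f) = interior (M.base ν) (M.hdeg f) - interior (M.base ν) f := by
  rw [hdeg_apply, hdeg_apply, map_sum]
  have h : ∀ μ, exterior (M.dx μ) (interior (M.base μ) (interior (M.base ν) f)) =
      interior (M.base ν) (exterior (M.dx μ) (interior (M.base μ) f)) -
        (if μ = ν then interior (M.base μ) f else 0) := by
    intro μ
    rw [interior_comm, map_neg, interior_exterior_base]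
    abel
  simp [h, Finset.sum_sub_distrib]

/-- A vertical vector anticommutes with both factors of each summand, and the two signs cancel. -/
theorem hdeg_interior_vertical {v : E} (hv : v ∈ M.vertical) (f : ExtDual E) :
    interior v (M.hdeg f) = M.hdeg (interior v f) := by
  rw [hdeg_apply, hdeg_apply, map_sum]
  refine Finset.sum_congr rfl fun μ _ => ?_
  rw [M.interior_exterior_vertical hv, interior_comm, map_neg, neg_neg]

variable {M}

theorem IsHor.hdeg_eq {f : ExtDual E} (hf : M.IsHor f) {k : ℕ} (hk : HasDegree k f) :
    M.hdeg f = (k : ℝ) • f := by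
  rw [hdeg_apply]
  exact sum_exterior_interior M.base M.dx hk hf.interior_eq

theorem IsHor.mem_span {k : ℕ} {f : ExtDual E} (hf : M.IsHor f) (hk : HasDegree k f) :
    f ∈ Submodule.span ℝ (Set.range fun s : Fin k → Fin n =>
      M.dxList (List.ofFn s) unitForm) := by
  induction k generalizing f with
  | zero =>
    rw [hk.eq_smul_unitForm]
    exact Submodule.smul_mem _ _ (Submodule.subset_span ⟨Fin.elim0, by simp⟩)
  | succ k ih =>
    have h := hf.hdeg_eq hk
    rw [hdeg_apply] at h
    have h2 : f = ((k + 1 : ℕ) : ℝ)⁻¹ •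
        ∑ i, YangMills.exterior (M.dx i) (YangMills.interior (M.base i) f) := by
      rw [h, inv_smul_smul₀ (by positivity)]
    rw [h2]
    refine Submodule.smul_mem _ _ (Submodule.sum_mem _ fun i _ => ?_)
    have h3 := Submodule.mem_map_of_mem (f := YangMills.exterior (M.dx i))
      (ih (hf.interior (M.base i)) (hk.interior (M.base i)))
    rw [Submodule.map_span, ← Set.range_comp] at h3
    refine Submodule.span_mono ?_ h3
    rintro _ ⟨s, rfl⟩
    exact ⟨Fin.cons i s, by simp [List.ofFn_succ]⟩

/-- A product of `n` of the covectors dx^μ is ±dⁿx if the indices form a permutation and 0 if one of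
them repeats. -/
theorem IsHor.eq_smul_vol {f : ExtDual E} (hf : M.IsHor f) (hn : HasDegree n f) :
    ∃ c : ℝ, f = c • M.vol := by
  suffices h : f ∈ Submodule.span ℝ {M.vol} by
    obtain ⟨c, hc⟩ := Submodule.mem_span_singleton.mp h
    exact ⟨c, hc.symm⟩
  refine Submodule.span_le.mpr ?_ (hf.mem_span hn)
  rintro _ ⟨s, rfl⟩
  rw [SetLike.mem_coe, Submodule.mem_span_singleton]
  beta_reduce
  rw [PolyModel.dxList, List.map_ofFn, ← evalForm_covectorWedge, vol, ← evalForm_covectorWedge]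
  by_cases hs : Function.Injective s
  · have hb : Function.Bijective s := Finite.injective_iff_bijective.mp hs
    obtain ⟨σ, rfl⟩ : ∃ σ : Equiv.Perm (Fin n), s = σ := ⟨Equiv.ofBijective s hb, rfl⟩
    refine ⟨((Equiv.Perm.sign σ : ℤ) : ℝ), ?_⟩
    rw [← evalFormL_apply, ← evalFormL_apply, ← map_smul]
    congr 1
    ext v
    rw [AlternatingMap.smul_apply, covectorWedge_apply, covectorWedge_apply]
    exact (Matrix.det_permute' σ (Matrix.of fun i j => M.dx j (v i))).symm
  · refine ⟨0, ?_⟩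
    simp only [Function.Injective, not_forall] at hs
    obtain ⟨i, j, hij, hne⟩ := hs
    rw [zero_smul, ← evalFormL_apply, eq_comm]
    convert map_zero (evalFormL n)
    ext v
    rw [covectorWedge_apply, AlternatingMap.zero_apply]
    exact Matrix.det_zero_of_column_eq hne fun k => by simp [hij]

/-! ### The Dirac structure -/

variable (M)

/-- The vertical part of the `n`-form with given image under the sharp map. -/
def flat : E →ₗ[ℝ] ExtDual E := ∑ ν, (exterior.flip (M.volN ν)).comp (M.omega ν)

theorem flat_apply (X : E) : M.flat X = ∑ ν, exterior (M.omega ν X) (M.volN ν) := by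
  rw [flat, LinearMap.sum_apply]
  rfl

theorem interior_flat (X : E) {v : E} (hv : v ∈ M.vertical) :
    interior v (M.flat X) = ∑ ν, M.omega ν X v • M.volN ν := by
  rw [flat_apply, map_sum]
  refine Finset.sum_congr rfl fun ν _ => ?_
  rw [interior_exterior, M.isHor_volN ν v hv, map_zero, sub_zero]

/-- The graph of the sharp map in degree `n`. -/
def IsSharp (f : ExtDual E) (X : E) : Prop :=
  X ∈ M.vertical ∧ ∃ c : ℝ, f = c • M.vol + M.flat X

variable {M}

theorem IsSharp.add {f g : ExtDual E} {X Y : E} (hf : M.IsSharp f X)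
    (hg : M.IsSharp g Y) : M.IsSharp (f + g) (X + Y) := by
  obtain ⟨hX, c, rfl⟩ := hf
  obtain ⟨hY, d, rfl⟩ := hg
  exact ⟨add_mem hX hY, c + d, by rw [map_add]; module⟩

theorem IsSharp.smul {f : ExtDual E} {X : E} (hf : M.IsSharp f X) (r : ℝ) :
    M.IsSharp (r • f) (r • X) := by
  obtain ⟨hX, c, rfl⟩ := hf
  exact ⟨Submodule.smul_mem _ r hX, r * c, by rw [map_smul]; module⟩

theorem isSharp_zero : M.IsSharp 0 0 := ⟨zero_mem _, 0, by simp⟩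

theorem isSharp_vol : M.IsSharp M.vol 0 := ⟨zero_mem _, 1, by simp⟩

theorem IsSharp.interior_eq {f : ExtDual E} {X : E} (hf : M.IsSharp f X) {v : E}
    (hv : v ∈ M.vertical) : interior v f = ∑ ν, M.omega ν X v • M.volN ν := by
  obtain ⟨-, c, rfl⟩ := hf
  rw [map_add, map_smul, M.isHor_vol v hv, smul_zero, zero_add, interior_flat M X hv]

/-- Antisymmetry of every ω^ν. The well-definedness of the maps ♯_a is a consequence of this
relation. -/
theorem IsSharp.interior_swap {f g : ExtDual E} {X Y : E} (hf : M.IsSharp f X)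
    (hg : M.IsSharp g Y) : interior Y f = -interior X g := by
  rw [hf.interior_eq hg.1, hg.interior_eq hf.1, ← Finset.sum_neg_distrib]
  refine Finset.sum_congr rfl fun ν _ => ?_
  rw [M.omega_skew, neg_smul]

theorem IsSharp.interior_interior {f : ExtDual E} {X : E} (hf : M.IsSharp f X) {v w : E}
    (hv : v ∈ M.vertical) (hw : w ∈ M.vertical) : interior v (interior w f) = 0 := by
  rw [hf.interior_eq hw]
  exact IsHor.sum _ (fun ν _ => (M.isHor_volN ν).smul _) v hv

theorem IsSharp.hasDegree (hn : 1 ≤ n) {f : ExtDual E} {X : E}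
    (hf : M.IsSharp f X) : HasDegree n f := by
  obtain ⟨-, c, rfl⟩ := hf
  refine (M.vol_hasDegree.smul c).add ?_
  rw [flat_apply]
  refine HasDegree.sum _ fun ν _ => ?_
  obtain ⟨k, rfl⟩ := Nat.exists_eq_add_of_le' hn
  exact (M.vol_hasDegree.interior _).exterior _

/-- Only the vertical part of `φ ν` matters: it differs from ω^ν(Z, ·) by a combination of the dx^μ,
and multiplying d^{n-1}x_ν by these gives multiples of dⁿx. -/
theorem isSharp_sum_exterior {φ : Fin n → E →ₗ[ℝ] ℝ} {Z : E} (hZ : Z ∈ M.vertical)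
    (h : ∀ ν, ∀ v ∈ M.vertical, φ ν v = M.omega ν Z v) :
    M.IsSharp (∑ ν, exterior (φ ν) (M.volN ν)) Z := by
  -- As ω^ν(Z, ∂_μ) = 0, the horizontal part of `φ ν` has components `φ ν (M.base μ)`; only μ = ν
  -- survives multiplication by d^{n-1}x_ν.
  refine ⟨hZ, ∑ ν, φ ν (M.base ν), ?_⟩
  have h1 : ∀ ν, φ ν = M.omega ν Z + ∑ μ, φ ν (M.base μ) • M.dx μ := by
    intro ν
    refine LinearMap.ext fun v => ?_
    have h2 := h ν _ (M.sub_mem_vertical v)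
    have h3 : M.omega ν Z (∑ μ, M.dx μ v • M.base μ) = 0 := by
      simp [map_sum, M.omega_base]
    rw [map_sub, map_sub, h3, sub_zero] at h2
    rw [LinearMap.add_apply, ← h2, LinearMap.sum_apply, map_sum]
    simp [mul_comm]
  rw [flat_apply, Finset.sum_smul, ← Finset.sum_add_distrib]
  refine Finset.sum_congr rfl fun ν _ => ?_
  conv_lhs => rw [h1 ν, map_add, map_sum, LinearMap.add_apply, LinearMap.sum_apply]
  rw [Finset.sum_eq_single ν (fun μ _ hμ => by
    rw [map_smul, LinearMap.smul_apply, exterior_dx_volN, if_neg hμ, smul_zero]) (by simp),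
    map_smul, LinearMap.smul_apply, exterior_dx_volN, if_pos rfl, add_comm]

variable (M)

/-- A linear map that selects a vector for each `n`-form in the domain of the sharp map. -/
structure Selector where
  toLin : ExtDual E →ₗ[ℝ] E
  mem : ∀ f, toLin f ∈ M.vertical
  isSharp : ∀ f X, M.IsSharp f X → M.IsSharp f (toLin f)

/-- The vector is unique only up to the common kernel of the ω^ν on vertical vectors. A linear
choice is needed because it commutes with differentiation of families of forms. -/
theorem nonempty_selector : Nonempty M.Selector := by
  -- Taking values in the subspace of vertical vectors keeps the extended selection vertical even
  -- outside the domain of the sharp map.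
  let R : Submodule ℝ (ExtDual E × M.vertical) :=
    { carrier := {w | M.IsSharp w.1 w.2}
      add_mem' := fun hx hy => hx.add hy
      zero_mem' := isSharp_zero
      smul_mem' := fun c _ hx => hx.smul c }
  obtain ⟨t, ht⟩ := exists_linear_selection R
  exact ⟨M.vertical.subtype.comp t, fun f => (t f).2, fun f X hf => ht f ⟨X, hf.1⟩ hf⟩

/-- The graph of the sharp map in degree `a`, as a relation between functionals and
multivectors. -/
def sharpRel (a : ℕ) : Submodule ℝ (ExtDual E × ExteriorAlgebra ℝ E) :=
  Submodule.span ℝ {s | ∃ f X, M.IsSharp f X ∧ ∃ U ∈ ⋀[ℝ]^(n - a) E,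
    s = (f.comp (LinearMap.mulLeft ℝ U), ExteriorAlgebra.ι ℝ X * U)}

variable {M}

theorem mem_sharpRel_top {f : ExtDual E} {X : E} (hf : M.IsSharp f X) :
    (f, ExteriorAlgebra.ι ℝ X) ∈ M.sharpRel n := by
  refine Submodule.subset_span ⟨f, X, hf, 1, ?_, ?_⟩
  · rw [Nat.sub_self, ExteriorAlgebra.exteriorPower, pow_zero]
    exact Submodule.one_le.mp le_rfl
  · rw [mul_one]
    congr 1
    ext; simp

/-- On generators, contracting once more with `v` replaces U by U ∧ v, in the form as well as in the
multivector X ∧ U. -/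
theorem interior_mem_sharpRel {a : ℕ} (ha : a + 1 ≤ n) {f : ExtDual E} {V : ExteriorAlgebra ℝ E}
    (h : (f, V) ∈ M.sharpRel (a + 1)) (v : E) :
    (interior v f, V * ExteriorAlgebra.ι ℝ v) ∈ M.sharpRel a := by
  let Φ : ExtDual E × ExteriorAlgebra ℝ E →ₗ[ℝ] ExtDual E × ExteriorAlgebra ℝ E :=
    (interior v).prodMap (LinearMap.mulRight ℝ (ExteriorAlgebra.ι ℝ v))
  have h2 := Submodule.mem_map_of_mem (f := Φ) h
  rw [sharpRel, Submodule.map_span] at h2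
  refine Submodule.span_mono ?_ h2
  rintro _ ⟨_, ⟨f, X, hf, U, hU, rfl⟩, rfl⟩
  refine ⟨f, X, hf, U * ExteriorAlgebra.ι ℝ v, ?_, ?_⟩
  · refine mul_mem_exteriorPower (i := n - (a + 1)) (j := 1) (by omega) hU ?_
    rw [ExteriorAlgebra.exteriorPower, pow_one]
    exact ⟨v, rfl⟩
  · refine Prod.ext (LinearMap.ext fun W => ?_) ?_
    · simp [Φ, mul_assoc]
    · simp [Φ, mul_assoc]

/-- Downward induction on the degree. In degree `n` the form is a multiple of dⁿx; below, (n-a) f =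
Σ_μ i_{∂_μ}(dx^μ ∧ f), and each dx^μ ∧ f is horizontal of the next degree. -/
theorem IsHor.mem_sharpRel {k a : ℕ} (hk : a + k = n) {f : ExtDual E} (hf : M.IsHor f)
    (hd : HasDegree a f) : (f, 0) ∈ M.sharpRel a := by
  induction k generalizing a f with
  | zero =>
    obtain rfl : a = n := by omega
    obtain ⟨c, rfl⟩ := hf.eq_smul_vol hd
    have h := Submodule.smul_mem _ c (mem_sharpRel_top (isSharp_vol (M := M)))
    simpa using h
  | succ k ih =>
    have h := M.sum_interior_exterior f
    rw [hf.hdeg_eq hd, ← sub_smul] at h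
    have hc : (n : ℝ) - a ≠ 0 := by
      have : (n : ℝ) = a + (k + 1) := by exact_mod_cast hk.symm
      rw [this, add_sub_cancel_left]
      positivity
    have h2 : (f, (0 : ExteriorAlgebra ℝ E)) = ((n : ℝ) - a)⁻¹ •
        ∑ μ, (YangMills.interior (M.base μ) (YangMills.exterior (M.dx μ) f),
          (0 : ExteriorAlgebra ℝ E) * ExteriorAlgebra.ι ℝ (M.base μ)) := by
      refine Prod.ext ?_ ?_
      · rw [Prod.smul_fst, Prod.fst_sum, h, inv_smul_smul₀ hc]
      · simp [Prod.snd_sum]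
    rw [h2]
    refine Submodule.smul_mem _ _ (Submodule.sum_mem _ fun μ _ => ?_)
    exact interior_mem_sharpRel (by omega) (ih (by omega) (hf.exterior μ) (hd.exterior _)) _

namespace Selector

variable (P : M.Selector)

/-- The multivectors that represent the sharp map on special Hamiltonian forms, up to a factor. -/
def multivector : ℕ → ExtDual E →ₗ[ℝ] ExteriorAlgebra ℝ E
  | 0 => (ExteriorAlgebra.ι ℝ).comp P.toLin
  | k + 1 => ∑ μ, (LinearMap.mulRight ℝ (ExteriorAlgebra.ι ℝ (M.base μ))).comp
      ((multivector k).comp (exterior (M.dx μ)))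

theorem multivector_zero (f : ExtDual E) :
    P.multivector 0 f = ExteriorAlgebra.ι ℝ (P.toLin f) := rfl

theorem multivector_succ (k : ℕ) (f : ExtDual E) :
    P.multivector (k + 1) f =
      ∑ μ, P.multivector k (exterior (M.dx μ) f) * ExteriorAlgebra.ι ℝ (M.base μ) := by
  rw [multivector, LinearMap.sum_apply]
  rfl

end Selector

variable (M)

/-- The pointwise condition on the differential of a special Hamiltonian form: all its products
with `k` of the covectors `dx μ` belong to the domain of the sharp map. -/
structure IsSpecial (k : ℕ) (f : ExtDual E) : Prop where
  interior_interior : ∀ v ∈ M.vertical, ∀ w ∈ M.vertical, interior v (interior w f) = 0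
  isSharp : ∀ l : List (Fin n), l.length = k → ∃ X, M.IsSharp (M.dxList l f) X

variable {M}

theorem IsSpecial.exterior {k : ℕ} {f : ExtDual E} (hf : M.IsSpecial (k + 1) f) (μ : Fin n) :
    M.IsSpecial k (exterior (M.dx μ) f) where
  interior_interior v hv w hw := by
    rw [M.interior_exterior_vertical hw, map_neg, M.interior_exterior_vertical hv,
      hf.interior_interior v hv w hw, map_zero, neg_zero, neg_zero]
  isSharp l hl := by
    obtain ⟨X, hX⟩ := hf.isSharp (l ++ [μ]) (by simp [hl])
    exact ⟨X, by rwa [dxList_append] at hX⟩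

theorem IsSpecial.isHor_interior {k : ℕ} {f : ExtDual E} (hf : M.IsSpecial k f) {v : E}
    (hv : v ∈ M.vertical) : M.IsHor (interior v f) :=
  fun w hw => hf.interior_interior w hw v hv

/-- Write (n-a) f as Σ_μ i_{∂_μ}(dx^μ ∧ f) plus `M.hdeg f - a • f`. The last term is horizontal,
because a vertical contraction of `f` is horizontal of degree `a` and `M.hdeg` acts on it as the
scalar `a`; so 0 represents its image. In the sum each dx^μ ∧ f is special with one covector less to
multiply by. The factors 1/(n-a) accumulate to the inverse factorial. -/
theorem IsSpecial.mem_sharpRel (P : M.Selector) {k a : ℕ} (hk : a + 1 + k = n) {f : ExtDual E}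
    (hf : M.IsSpecial k f) (hd : HasDegree (a + 1) f) :
    (f, ((k + 1).factorial : ℝ)⁻¹ • P.multivector k f) ∈ M.sharpRel (a + 1) := by
  induction k generalizing a f with
  | zero =>
    obtain rfl : n = a + 1 := by omega
    obtain ⟨X, hX⟩ := hf.isSharp [] rfl
    have h := mem_sharpRel_top (P.isSharp _ _ hX)
    simpa [P.multivector_zero] using h
  | succ k ih =>
    have h := M.sum_interior_exterior f
    have hg : M.IsHor (M.hdeg f - (a : ℝ) • f) := fun v hv => by
      rw [map_sub, M.hdeg_interior_vertical hv, (hf.isHor_interior hv).hdeg_eq (hd.interior v),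
        map_smul, sub_self]
    have hgd : HasDegree (a + 1) (M.hdeg f - (a : ℝ) • f) := by
      refine HasDegree.sub ?_ (hd.smul _)
      rw [hdeg_apply]
      exact HasDegree.sum _ fun μ _ => (hd.interior _).exterior _
    have hn : (n : ℝ) = a + (k + 2) := by
      have : a + (k + 2) = n := by omega
      exact_mod_cast this.symm
    have hfeq : f = ((k : ℝ) + 2)⁻¹ • (∑ μ, interior (M.base μ) (YangMills.exterior (M.dx μ) f) +
        (M.hdeg f - (a : ℝ) • f)) := by
      rw [eq_inv_smul_iff₀ (by positivity), h, hn]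
      module
    have hV : (((k + 1 + 1).factorial : ℝ))⁻¹ • P.multivector (k + 1) f =
        ((k : ℝ) + 2)⁻¹ • (∑ μ, (((k + 1).factorial : ℝ)⁻¹ •
          P.multivector k (YangMills.exterior (M.dx μ) f)) * ExteriorAlgebra.ι ℝ (M.base μ) + 0) := by
      rw [P.multivector_succ, add_zero, Nat.factorial_succ (k + 1)]
      simp only [smul_mul_assoc, ← Finset.smul_sum, smul_smul]
      congr 1
      push_cast
      rw [mul_inv]
      ring
    have hpair : (f, (((k + 1 + 1).factorial : ℝ))⁻¹ • P.multivector (k + 1) f) =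
        ((k : ℝ) + 2)⁻¹ • (∑ μ, (interior (M.base μ) (YangMills.exterior (M.dx μ) f),
          (((k + 1).factorial : ℝ)⁻¹ •
          P.multivector k (YangMills.exterior (M.dx μ) f)) * ExteriorAlgebra.ι ℝ (M.base μ)) +
        (M.hdeg f - (a : ℝ) • f, 0)) := by
      refine Prod.ext ?_ ?_
      · rw [Prod.smul_fst, Prod.fst_add, Prod.fst_sum]
        exact hfeq
      · rw [Prod.smul_snd, Prod.snd_add, Prod.snd_sum]
        exact hV
    rw [hpair]
    refine Submodule.smul_mem _ _ (Submodule.add_mem _ (Submodule.sum_mem _ fun μ _ => ?_) ?_)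
    · exact interior_mem_sharpRel (by omega)
        (ih (by omega) (hf.exterior μ) (hd.exterior _)) _
    · exact hg.mem_sharpRel (k := k + 1) (by omega) hgd

end PolyModel

/-! ### Graded commutativity and the pairing -/

section Graded

variable {E : Type*} [NormedAddCommGroup E] [NormedSpace ℝ E]

theorem ι_mul_eq_smul_mul_ι {p : ℕ} (v : E) {U : ExteriorAlgebra ℝ E} (hU : U ∈ ⋀[ℝ]^p E) :
    ExteriorAlgebra.ι ℝ v * U = (-1 : ℝ) ^ p • (U * ExteriorAlgebra.ι ℝ v) := by
  refine exteriorPower_induction (C := fun U => ExteriorAlgebra.ι ℝ v * U =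
    (-1 : ℝ) ^ p • (U * ExteriorAlgebra.ι ℝ v)) (fun u => ?_) (by simp)
    (fun x y hx hy => by rw [mul_add, hx, hy, add_mul, smul_add])
    (fun c x hx => by rw [mul_smul_comm, hx, smul_mul_assoc, smul_comm]) hU
  clear hU
  induction p with
  | zero => simp
  | succ p ih =>
    have h := ExteriorAlgebra.ι_add_mul_swap (R := ℝ) v (u 0)
    rw [ExteriorAlgebra.ιMulti_succ_apply, ← mul_assoc, eq_neg_of_add_eq_zero_left h, neg_mul,
      mul_assoc, ih, mul_smul_comm, ← mul_assoc, pow_succ]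
    module

theorem mul_eq_smul_mul {p q : ℕ} {U V : ExteriorAlgebra ℝ E} (hU : U ∈ ⋀[ℝ]^p E)
    (hV : V ∈ ⋀[ℝ]^q E) : U * V = (-1 : ℝ) ^ (p * q) • (V * U) := by
  refine exteriorPower_induction (C := fun U => U * V = (-1 : ℝ) ^ (p * q) • (V * U))
    (fun u => ?_) (by simp)
    (fun x y hx hy => by rw [add_mul, hx, hy, mul_add, smul_add])
    (fun c x hx => by rw [smul_mul_assoc, hx, mul_smul_comm, smul_comm]) hU
  clear hU
  induction p with
  | zero => simp
  | succ p ih =>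
    rw [ExteriorAlgebra.ιMulti_succ_apply, mul_assoc, ih, mul_smul_comm, ← mul_assoc,
      ι_mul_eq_smul_mul_ι _ hV, smul_mul_assoc, smul_smul, mul_assoc]
    congr 1
    ring

end Graded

namespace PolyModel

variable {n : ℕ} {E : Type*} [NormedAddCommGroup E] [NormedSpace ℝ E] {M : PolyModel n E}

/-- Graded commutativity brings both sides to values at W ∧ U of the contractions of `g` with X and
of `f` with Y, which `IsSharp.interior_swap` relates. The sign depends on degrees only, so the
formula will extend to the span. -/
theorem IsSharp.pairing_generator {f g : ExtDual E} {X Y : E} (hf : M.IsSharp f X)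
    (hg : M.IsSharp g Y) {a : ℕ} {U W : ExteriorAlgebra ℝ E}
    (hU : U ∈ ⋀[ℝ]^(n - (a + 1)) E) (hW : W ∈ ⋀[ℝ]^a E) :
    g (W * (ExteriorAlgebra.ι ℝ X * U)) =
      (-((-1 : ℝ) ^ a * (-1 : ℝ) ^ ((a + 1) * (n - (a + 1))))) *
        f.comp (LinearMap.mulLeft ℝ U) (ExteriorAlgebra.ι ℝ Y * W) := by
  have h1 : W * (ExteriorAlgebra.ι ℝ X * U) =
      (-1 : ℝ) ^ a • (ExteriorAlgebra.ι ℝ X * (W * U)) := by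
    rw [← mul_assoc, ← mul_assoc, ι_mul_eq_smul_mul_ι X hW, smul_mul_assoc, smul_smul, ← mul_pow]
    simp
  have h2 := LinearMap.congr_fun (hf.interior_swap hg) (W * U)
  rw [LinearMap.neg_apply, interior_apply, interior_apply] at h2
  have h3 := mul_eq_smul_mul (ι_mul_mem Y hW) hU
  have h4 : g (ExteriorAlgebra.ι ℝ X * (W * U)) = -f (ExteriorAlgebra.ι ℝ Y * (W * U)) := by
    rw [h2, neg_neg]
  rw [h1, map_smul, LinearMap.comp_apply, LinearMap.mulLeft_apply, smul_eq_mul, h4,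
    ← mul_assoc (ExteriorAlgebra.ι ℝ Y), h3, map_smul, smul_eq_mul]
  ring

/-! ### Contraction with the multivectors of special Hamiltonian forms -/

variable (M)

/-- The operator `Σ_λ i_{∂_λ} ∘ 𝒦 ∘ (dx^λ ∧ ·)`. -/
def conjSum (K : Module.End ℝ (ExtDual E)) : Module.End ℝ (ExtDual E) :=
  ∑ μ, (interior (M.base μ)).comp (K.comp (exterior (M.dx μ)))

theorem conjSum_apply (K : Module.End ℝ (ExtDual E)) (f : ExtDual E) :
    M.conjSum K f = ∑ μ, interior (M.base μ) (K (exterior (M.dx μ) f)) := by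
  rw [conjSum, LinearMap.sum_apply]
  rfl

theorem iterate_conjSum_succ (K : Module.End ℝ (ExtDual E)) (k : ℕ) (f : ExtDual E) :
    M.conjSum^[k + 1] K f =
      ∑ μ, interior (M.base μ) (M.conjSum^[k] K (exterior (M.dx μ) f)) := by
  rw [Function.iterate_succ_apply', conjSum_apply]

/-- One multiplication by dx^μ undoes one application of `conjSum`: the result is (1+n-ρ) K(dx^μ ∧
·), by antisymmetry of K in the last covector and the count of horizontal degree. Both hypotheses
pass to `M.conjSum K`, with ρ - 1 in place of ρ, which is why K is quantified inside. The bound on ρ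
keeps all factors nonzero. -/
theorem exists_dxList_iterate_conjSum (k : ℕ) (ρ : ℝ) (hρ : ρ ≤ n) :
    ∃ C : ℝ, C ≠ 0 ∧ ∀ (K : Module.End ℝ (ExtDual E)) (h : ExtDual E),
      (∀ l : List (Fin n), l.length = k → M.hdeg (K (M.dxList l h)) = ρ • K (M.dxList l h)) →
      (∀ l : List (Fin n), l.length + 1 = k → ∀ μ ν,
        exterior (M.dx μ) (K (M.dxList (ν :: l) h)) =
          -exterior (M.dx ν) (K (M.dxList (μ :: l) h))) →
      ∀ l : List (Fin n), l.length = k →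
        M.dxList l (M.conjSum^[k] K h) = C • K (M.dxList l h) := by
  induction k generalizing ρ with
  | zero =>
    refine ⟨1, one_ne_zero, fun K h _ _ l hl => ?_⟩
    rw [List.length_eq_zero_iff.mp hl]
    simp
  | succ k ih =>
    obtain ⟨C, hC, hC'⟩ := ih (ρ - 1) (by linarith)
    refine ⟨C * (1 + n - ρ), mul_ne_zero hC (by linarith), fun K h h1 h2 l hl => ?_⟩
    have key : ∀ l : List (Fin n), l.length = k → ∀ μ,
        exterior (M.dx μ) (M.conjSum K (M.dxList l h)) =
          (1 + n - ρ) • K (M.dxList (μ :: l) h) := by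
      intro l hl μ
      rw [conjSum_apply, map_sum]
      -- Moving dx^μ past i_{∂_κ} leaves a delta term; in the other term antisymmetry exchanges μ
      -- and κ, so that Σ_κ i_{∂_κ}(dx^κ ∧ ·) appears and `sum_interior_exterior` applies.
      have h3 : ∀ κ, exterior (M.dx μ) (interior (M.base κ)
          (K (exterior (M.dx κ) (M.dxList l h)))) =
          (if μ = κ then K (M.dxList (κ :: l) h) else 0) +
            interior (M.base κ) (exterior (M.dx κ) (K (M.dxList (μ :: l) h))) := by
        intro κ
        have h4 := M.interior_exterior_base κ μ (K (M.dxList (κ :: l) h))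
        rw [h2 l (by omega) μ κ, map_neg] at h4
        rw [← M.dxList_cons]
        rw [neg_eq_iff_eq_neg] at h4
        rw [h4]
        abel
      simp only [h3, Finset.sum_add_distrib, Finset.sum_ite_eq, Finset.mem_univ, if_true]
      rw [sum_interior_exterior, h1 (μ :: l) (by simp [hl])]
      module
    match l, hl with
    | μ :: l, hl =>
      have hl' : l.length = k := by simpa using hl
      have h5 := hC' (M.conjSum K) h ?_ ?_ l hl'
      · rw [M.dxList_cons, Function.iterate_succ_apply, h5, map_smul, key l hl', smul_smul]
      · intro l hl
        rw [conjSum_apply, map_sum, Finset.smul_sum]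
        refine Finset.sum_congr rfl fun κ _ => ?_
        rw [hdeg_interior, ← M.dxList_cons, h1 (κ :: l) (by simp [hl]), map_smul]
        module
      · intro l hl κ ν
        rw [key (ν :: l) hl, key (κ :: l) hl, M.dxList_cons, M.dxList_cons, M.dxList_cons,
          M.dxList_cons, exterior_comm, map_neg, smul_neg]

variable {M}

/-- If all dx^μ ∧ f vanish, then (n-a) f = 0, and n - a > 0 below the top degree. Induction supplies
this vanishing. -/
theorem IsHor.eq_zero_of_dxList {k a : ℕ} (hk : a + k = n) {f : ExtDual E} (hf : M.IsHor f)
    (hd : HasDegree a f) (h : ∀ l : List (Fin n), l.length = k → M.dxList l f = 0) : f = 0 := by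
  induction k generalizing a f with
  | zero => exact h [] rfl
  | succ k ih =>
    have h1 : ∀ μ, YangMills.exterior (M.dx μ) f = 0 := fun μ =>
      ih (a := a + 1) (by omega) (hf.exterior μ) (hd.exterior _) fun l hl => by
        have := h (l ++ [μ]) (by simp [hl])
        rwa [dxList_append] at this
    have h2 := M.sum_interior_exterior f
    rw [hf.hdeg_eq hd, ← sub_smul] at h2
    simp only [h1, map_zero, Finset.sum_const_zero] at h2
    have hc : (n : ℝ) - a ≠ 0 := by
      have : (n : ℝ) = a + (k + 1) := by exact_mod_cast hk.symm
      rw [this, add_sub_cancel_left]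
      positivity
    exact (smul_eq_zero.mp h2.symm).resolve_left hc

namespace Selector

variable (P : M.Selector)

/-- The contraction of `f` with the multivector that represents the sharp map on `h`. -/
def bracket (k : ℕ) (f h : ExtDual E) : ExtDual E :=
  f.comp (LinearMap.mulLeft ℝ (P.multivector k h))

/-- The contraction of `f` with the vector selected for `h`. -/
def contraction (f : ExtDual E) : Module.End ℝ (ExtDual E) :=
  (interior.flip f).comp P.toLin

theorem contraction_apply (f h : ExtDual E) : P.contraction f h = interior (P.toLin h) f := rfl

/-- Contraction with W ∧ ∂_μ is contraction with W followed by i_{∂_μ}, so the recursion for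
`multivector` becomes that for `conjSum`. -/
theorem bracket_eq (k : ℕ) (f h : ExtDual E) :
    P.bracket k f h = M.conjSum^[k] (P.contraction f) h := by
  induction k generalizing h with
  | zero => rfl
  | succ k ih =>
    rw [iterate_conjSum_succ]
    refine LinearMap.ext fun U => ?_
    rw [bracket, P.multivector_succ, LinearMap.sum_apply]
    simp only [interior_apply, ← ih, bracket, LinearMap.comp_apply, LinearMap.mulLeft_apply,
      Finset.sum_mul, map_sum, mul_assoc]

theorem multivector_mem (k : ℕ) (h : ExtDual E) : P.multivector k h ∈ ⋀[ℝ]^(k + 1) E := by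
  have h1 : ∀ v : E, ExteriorAlgebra.ι ℝ v ∈ ⋀[ℝ]^1 E := fun v => by
    rw [ExteriorAlgebra.exteriorPower, pow_one]
    exact ⟨v, rfl⟩
  induction k generalizing h with
  | zero => exact h1 _
  | succ k ih =>
    rw [P.multivector_succ]
    exact Submodule.sum_mem _ fun μ _ => mul_mem_exteriorPower rfl (ih _) (h1 _)

/-- Each term of the multivector contains one selected vertical vector. Contracting `f` with it
already gives a horizontal form, and further contractions preserve this. -/
theorem isHor_bracket {j : ℕ} {f : ExtDual E} (hf : M.IsSpecial j f) (k : ℕ) (h : ExtDual E) :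
    M.IsHor (P.bracket k f h) := by
  rw [bracket_eq]
  induction k generalizing h with
  | zero => exact hf.isHor_interior (P.mem h)
  | succ k ih =>
    rw [iterate_conjSum_succ]
    exact IsHor.sum _ fun μ _ => (ih _).interior _

theorem isSharp_dxList {k : ℕ} {f : ExtDual E} (hf : M.IsSpecial k f) {l : List (Fin n)}
    (hl : l.length = k) : M.IsSharp (M.dxList l f) (P.toLin (M.dxList l f)) := by
  obtain ⟨X, hX⟩ := hf.isSharp l hl
  exact P.isSharp _ X hX

theorem dxList_interior {k : ℕ} {f : ExtDual E} (hf : M.IsSpecial k f) {l : List (Fin n)}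
    (hl : l.length = k) {v : E} (hv : v ∈ M.vertical) :
    M.dxList l (interior v f) =
      (-1 : ℝ) ^ k • ∑ ν, M.omega ν (P.toLin (M.dxList l f)) v • M.volN ν := by
  rw [← (P.isSharp_dxList hf hl).interior_eq hv, M.interior_dxList hv, smul_smul, hl, ← mul_pow]
  simp

/-- Up to sign, the left side is the coefficient of dⁿx in dx^μ ∧ dx^ν ∧ i_X(dx^l ∧ h), which is
antisymmetric in μ and ν. -/
theorem omega_swap {k : ℕ} {h : ExtDual E} (hh : M.IsSpecial k h) {l : List (Fin n)}
    (hl : l.length + 1 = k) {X : E} (hX : X ∈ M.vertical) (μ ν : Fin n) :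
    M.omega μ (P.toLin (M.dxList (ν :: l) h)) X = -M.omega ν (P.toLin (M.dxList (μ :: l) h)) X := by
  have h1 : ∀ κ, interior X (M.dxList (κ :: l) h) =
      -exterior (M.dx κ) (interior X (M.dxList l h)) := fun κ => by
    rw [M.dxList_cons, M.interior_exterior_vertical hX]
  have h2 : ∀ κ τ, M.omega τ (P.toLin (M.dxList (κ :: l) h)) X =
      M.coeffN τ (interior X (M.dxList (κ :: l) h)) := fun κ τ => by
    rw [(P.isSharp_dxList hh (l := κ :: l) (by simpa using hl)).interior_eq hX, coeffN_sum]
  have h3 : ∀ x, M.coeffN μ (exterior (M.dx ν) x) = -M.coeffN ν (exterior (M.dx μ) x) := fun x => by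
    change (exterior (M.dx μ) (exterior (M.dx ν) x)) _ =
      -(exterior (M.dx ν) (exterior (M.dx μ) x)) _
    rw [exterior_comm]
    rfl
  rw [h2, h2, h1, h1, map_neg, map_neg, h3]

/-- The sum of the two sides is horizontal, hence is detected by products with `j` more covectors
dx. These products are ω^μ(X, Y_ν) dⁿx and ω^ν(X, Y_μ) dⁿx, and `omega_swap` cancels them. -/
theorem exterior_contraction_swap {j k r : ℕ} (hr : r + 1 + j = n) {f h : ExtDual E}
    (hf : M.IsSpecial j f)
    (hd : HasDegree (r + 1) f) (hh : M.IsSpecial k h) {l : List (Fin n)}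
    (hl : l.length + 1 = k) (μ ν : Fin n) :
    exterior (M.dx μ) (P.contraction f (M.dxList (ν :: l) h)) =
      -exterior (M.dx ν) (P.contraction f (M.dxList (μ :: l) h)) := by
  rw [← add_eq_zero_iff_eq_neg]
  refine IsHor.eq_zero_of_dxList (M := M) (a := r + 1) (k := j) hr ?_ ?_ fun l' hl' => ?_
  · exact ((hf.isHor_interior (P.mem _)).exterior μ).add
      ((hf.isHor_interior (P.mem _)).exterior ν)
  · exact ((hd.interior _).exterior _).add ((hd.interior _).exterior _)
  · have h1 : ∀ κ τ, M.dxList l' (exterior (M.dx κ) (P.contraction f (M.dxList (τ :: l) h))) =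
        M.omega κ (P.toLin (M.dxList l' f)) (P.toLin (M.dxList (τ :: l) h)) • M.vol := by
      intro κ τ
      rw [M.dxList_exterior, P.contraction_apply, P.dxList_interior hf hl' (P.mem _), map_smul,
        M.exterior_dx_sum_volN, smul_smul, hl', ← mul_pow]
      simp
    rw [map_add, h1, h1, M.omega_skew, P.omega_swap hh hl (P.mem _), M.omega_skew ν]
    module

/-- Multiplication by dx^{l'} reduces the multivector to the single vector chosen for dx^{l'} ∧ h;
multiplication by dx^l then evaluates its contraction with `f` through ω. The constant is
independent of `f` and `h`, so that the identity can be differentiated. -/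
theorem exists_dxList_bracket (j k r : ℕ) (hr : r + 1 + j = n) :
    ∃ C : ℝ, ∀ f h : ExtDual E, M.IsSpecial j f → HasDegree (r + 1) f → M.IsSpecial k h →
      ∀ l l' : List (Fin n), l.length = j → l'.length = k →
        M.dxList (l ++ l') (P.bracket k f h) = ∑ ν, (C *
          M.omega ν (P.toLin (M.dxList l f)) (P.toLin (M.dxList l' h))) • M.volN ν := by
  obtain ⟨C, -, hC⟩ := M.exists_dxList_iterate_conjSum k r (by
    have : r ≤ n := by omega
    exact_mod_cast this)
  refine ⟨C * (-1) ^ j, fun f h hf hd hh l l' hl hl' => ?_⟩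
  rw [dxList_append, P.bracket_eq, hC (P.contraction f) h ?_ ?_ l' hl', map_smul,
    P.contraction_apply, P.dxList_interior hf hl (P.mem _), smul_smul, Finset.smul_sum]
  · simp only [smul_smul]
  · exact fun l _ => (hf.isHor_interior (P.mem _)).hdeg_eq (hd.interior _)
  · exact fun l hl μ ν => P.exterior_contraction_swap hr hf hd hh hl μ ν

end Selector

/-! ### First order jets of closed special forms -/

theorem sum_exterior_coord {ι : Type*} [Fintype ι] (b : Module.Basis ι ℝ E)
    (φ : Fin n → E →ₗ[ℝ] ℝ) (x : Fin n → ExtDual E) :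
    ∑ i, exterior (b.coord i) (∑ ν, φ ν (b i) • x ν) = ∑ ν, exterior (φ ν) (x ν) := by
  simp only [map_sum, map_smul]
  rw [Finset.sum_comm]
  refine Finset.sum_congr rfl fun ν _ => ?_
  have h : φ ν = ∑ i, φ ν (b i) • b.coord i := by
    refine b.ext fun j => ?_
    classical
    rw [LinearMap.sum_apply]
    simp [Finsupp.single_apply]
  conv_rhs => rw [h, map_sum, LinearMap.sum_apply]
  simp

/-- Contract the closedness relation with `w` and then with `v`: the terms in which both vectors hit
`D` vanish by `h0`, and the two mixed terms remain. -/
theorem interior_symm_of_closed {ι : Type*} [Fintype ι] (b : Module.Basis ι ℝ E)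
    (D : E →ₗ[ℝ] ExtDual E) (hD : ∑ i, exterior (b.coord i) (D (b i)) = 0)
    (h0 : ∀ u, ∀ v ∈ M.vertical, ∀ w ∈ M.vertical, interior v (interior w (D u)) = 0)
    {v w : E} (hv : v ∈ M.vertical) (hw : w ∈ M.vertical) :
    interior w (D v) = interior v (D w) := by
  have hs : ∀ u (T : E →ₗ[ℝ] ExtDual E), ∑ i, b.coord i u • T (b i) = T u := fun u T => by
    conv_rhs => rw [← b.sum_repr u, map_sum]
    simp
  have h1 : interior v (interior w (∑ i, exterior (b.coord i) (D (b i)))) = 0 := by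
    rw [hD, map_zero, map_zero]
  rw [map_sum] at h1
  simp only [interior_exterior w, Finset.sum_sub_distrib] at h1
  rw [hs w D, map_sub, map_sum] at h1
  simp only [interior_exterior v, h0 _ v hv w hw, map_zero, sub_zero] at h1
  have h2 := hs v ((interior w).comp D)
  simp only [LinearMap.comp_apply] at h2
  rw [h2] at h1
  exact (sub_eq_zero.mp h1).symm

/-- A special functional together with the derivative of a field of closed special functionals. -/
structure SpecialJet (P : M.Selector) (k : ℕ) (f : ExtDual E) (D : E →ₗ[ℝ] ExtDual E) : Prop where
  special : M.IsSpecial k f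
  symm : ∀ v ∈ M.vertical, ∀ w ∈ M.vertical, interior w (D v) = interior v (D w)
  coeff : ∀ l : List (Fin n), l.length = k → ∀ ν u, ∀ w ∈ M.vertical,
    M.coeffN ν (M.dxList l (interior w (D u))) =
      (-1) ^ k * M.omega ν (P.toLin (M.dxList l (D u))) w

/-- The analogue of the symmetry of a Hessian: both sides are, up to the same sign, coefficients of
dx^l ∧ i_w(D v) = dx^l ∧ i_v(D w). -/
theorem SpecialJet.omega_symm {P : M.Selector} {k : ℕ} {f : ExtDual E} {D : E →ₗ[ℝ] ExtDual E}
    (h : SpecialJet P k f D) {l : List (Fin n)} (hl : l.length = k) (ν : Fin n) {v w : E}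
    (hv : v ∈ M.vertical) (hw : w ∈ M.vertical) :
    M.omega ν (P.toLin (M.dxList l (D v))) w = M.omega ν (P.toLin (M.dxList l (D w))) v := by
  have h1 := h.coeff l hl ν v w hw
  rw [h.symm v hv w hw, h.coeff l hl ν w v hv] at h1
  exact (mul_left_cancel₀ (pow_ne_zero _ (by norm_num)) h1).symm

/-- The left side is the Leibniz rule for ω^ν(X_l, Y_{l'}). The symmetry of each jet frees `v` in
both terms, and the resulting vector does not depend on ν. -/
theorem SpecialJet.omega_deriv {P : M.Selector} {j k : ℕ} {f h : ExtDual E}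
    {D D' : E →ₗ[ℝ] ExtDual E} (hf : SpecialJet P j f D) (hh : SpecialJet P k h D')
    {l l' : List (Fin n)} (hl : l.length = j) (hl' : l'.length = k) (ν : Fin n) {v : E}
    (hv : v ∈ M.vertical) :
    M.omega ν (P.toLin (M.dxList l (D v))) (P.toLin (M.dxList l' h)) +
        M.omega ν (P.toLin (M.dxList l f)) (P.toLin (M.dxList l' (D' v))) =
      M.omega ν (P.toLin (M.dxList l (D (P.toLin (M.dxList l' h)))) -
        P.toLin (M.dxList l' (D' (P.toLin (M.dxList l f))))) v := by
  rw [hf.omega_symm hl ν hv (P.mem _), M.omega_skew ν (P.toLin (M.dxList l f)),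
    hh.omega_symm hl' ν hv (P.mem _), map_sub, LinearMap.sub_apply]
  ring

end PolyModel

/-! ### Naturality -/

namespace PolyModel

variable {n : ℕ} {E E' : Type*} [NormedAddCommGroup E] [NormedSpace ℝ E]
  [NormedAddCommGroup E'] [NormedSpace ℝ E'] {M : PolyModel n E} {M' : PolyModel n E'}

theorem pullForm_vol {L : E →ₗ[ℝ] E'} {J : Matrix (Fin n) (Fin n) ℝ}
    (hL : ∀ μ v, M'.dx μ (L v) = ∑ α, J μ α * M.dx α v) :
    pullForm L M'.vol = J.det • M.vol := by
  rw [vol, vol, pullForm_exteriorList, pullForm_unitForm, List.map_ofFn,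
    ← evalForm_covectorWedge, ← evalForm_covectorWedge, ← evalFormL_apply, ← evalFormL_apply,
    ← map_smul]
  congr 1
  ext v
  rw [AlternatingMap.smul_apply, covectorWedge_apply, covectorWedge_apply, smul_eq_mul, mul_comm,
    ← Matrix.det_transpose J, ← Matrix.det_mul]
  congr 1
  ext i μ
  simp [Matrix.mul_apply, hL, mul_comm]

/-- The determinant gained by d^{n-1}x'_ν cancels the density factor of ω, and the inverse Jacobian
`w` cancels `J`. Comparison on vertical vectors is enough by `isSharp_sum_exterior`. -/
theorem IsSharp.pullForm {L : E →ₗ[ℝ] E'} {J w : Matrix (Fin n) (Fin n) ℝ}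
    (hJ : J * w = 1)
    (hL : ∀ μ v, M'.dx μ (L v) = ∑ α, J μ α * M.dx α v)
    (hω : ∀ ν, ∀ X ∈ M.vertical, ∀ v ∈ M.vertical,
      M'.omega ν (L X) (L v) = J.det⁻¹ * ∑ β, J ν β * M.omega β X v)
    {X : E} (hX : X ∈ M.vertical) {f : ExtDual E'} (hf : M'.IsSharp f (L X)) :
    M.IsSharp (YangMills.pullForm L f) X := by
  obtain ⟨-, c, rfl⟩ := hf
  have hdet : J.det ≠ 0 := by
    intro h
    have := congrArg Matrix.det hJ
    rw [Matrix.det_mul, h, zero_mul, Matrix.det_one] at this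
    exact zero_ne_one this
  have hwJ : w * J = 1 := mul_eq_one_comm.mp hJ
  rw [map_add, map_smul, pullForm_vol hL, flat_apply, map_sum]
  have h1 : ∀ ν, YangMills.pullForm L (M'.volN ν) =
      ∑ α, (J.det * w α ν) • M.volN α := by
    intro ν
    -- `L` need not send the vectors ∂_α to combinations of the ∂'_ν, but the vertical discrepancy
    -- is invisible to the horizontal volume form.
    have h2 : L (∑ α, w α ν • M.base α) - M'.base ν ∈ M'.vertical := by
      intro μ
      have h3 := congrFun (congrFun hJ μ) ν
      rw [Matrix.mul_apply, Matrix.one_apply] at h3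
      have h6 : ∀ α, M.dx α (∑ β, w β ν • M.base β) = w α ν := fun α => by
        rw [map_sum]
        simp [M.dx_base]
      rw [map_sub, hL, M'.dx_base, sub_eq_zero]
      simp only [h6]
      exact h3
    have h4 := M'.isHor_vol _ h2
    rw [map_sub, LinearMap.sub_apply, sub_eq_zero] at h4
    rw [volN, ← h4, ← interior_pullForm, pullForm_vol hL, map_smul, map_sum, LinearMap.sum_apply,
      Finset.smul_sum]
    refine Finset.sum_congr rfl fun α _ => ?_
    rw [map_smul, LinearMap.smul_apply, smul_smul]
    rfl
  have h5 : ∑ ν, YangMills.pullForm L (YangMills.exterior (M'.omega ν (L X)) (M'.volN ν)) =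
      ∑ α, YangMills.exterior
        (∑ ν, (J.det * w α ν) • (M'.omega ν (L X)).comp L) (M.volN α) := by
    simp only [pullForm_exterior, h1, map_sum, map_smul, LinearMap.sum_apply,
      LinearMap.smul_apply]
    exact Finset.sum_comm
  rw [h5]
  have h6 : M.IsSharp ((c * J.det) • M.vol) 0 := by
    have := (isSharp_vol (M := M)).smul (c * J.det)
    rwa [smul_zero] at this
  rw [smul_smul]
  have h7 := h6.add (isSharp_sum_exterior (M := M) hX
    (φ := fun α => ∑ ν, (J.det * w α ν) • (M'.omega ν (L X)).comp L) fun α v hv => by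
      rw [LinearMap.sum_apply]
      simp only [LinearMap.smul_apply, LinearMap.comp_apply, hω _ X hX v hv, smul_eq_mul]
      have h8 : ∀ ν, J.det * w α ν * (J.det⁻¹ * ∑ β, J ν β * M.omega β X v) =
          ∑ β, w α ν * J ν β * M.omega β X v := fun ν => by
        rw [Finset.mul_sum, Finset.mul_sum]
        refine Finset.sum_congr rfl fun β _ => ?_
        field_simp
      simp only [h8]
      rw [Finset.sum_comm]
      simp only [← Finset.sum_mul, ← Matrix.mul_apply, hwJ, Matrix.one_apply, ite_mul, one_mul,
        zero_mul, Finset.sum_ite_eq, Finset.mem_univ, if_true])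
  rwa [zero_add] at h7

end PolyModel

/-! ## Graded Dirac structures -/

section DiracStructure

variable {n : ℕ} {E : Type*} [NormedAddCommGroup E] [NormedSpace ℝ E]

/-- The `a`-forms of the graded Dirac structure generated by the graph `D`. -/
def diracForms (D : Submodule ℝ ((E [⋀^Fin n]→ₗ[ℝ] ℝ) × E)) (a : ℕ) :
    Submodule ℝ (E [⋀^Fin a]→ₗ[ℝ] ℝ) :=
  Submodule.span ℝ {σ | ∃ w ∈ D, ∃ U ∈ ⋀[ℝ]^(n - a) E, σ = contract a U w.1}

/-- The annihilator in degree `p` of the graded Dirac structure generated by the graph `D`. -/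
def diracAnn (D : Submodule ℝ ((E [⋀^Fin n]→ₗ[ℝ] ℝ) × E)) (p : ℕ) :
    Set (ExteriorAlgebra ℝ E) :=
  {U | U ∈ ⋀[ℝ]^p E ∧ ∀ σ ∈ diracForms D p, contract 0 U σ = 0}

/-- The graph of the sharp map in degree `a` generated by the graph `D`. -/
def diracGraph (D : Submodule ℝ ((E [⋀^Fin n]→ₗ[ℝ] ℝ) × E)) (a : ℕ) :
    Submodule ℝ ((E [⋀^Fin a]→ₗ[ℝ] ℝ) × ExteriorAlgebra ℝ E) :=
  Submodule.span ℝ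
    ({s | ∃ w ∈ D, ∃ U ∈ ⋀[ℝ]^(n - a) E,
        s = (contract a U w.1, ExteriorAlgebra.ι ℝ w.2 * U)} ∪
      {s | s.1 = 0 ∧ s.2 ∈ diracAnn D (n + 1 - a)})

variable {M : PolyModel n E} {D : Submodule ℝ ((E [⋀^Fin n]→ₗ[ℝ] ℝ) × E)}

theorem evalForm_add {k : ℕ} (η ζ : E [⋀^Fin k]→ₗ[ℝ] ℝ) :
    evalForm (η + ζ) = evalForm η + evalForm ζ := map_add (evalFormL k) η ζ

theorem evalForm_smul {k : ℕ} (c : ℝ) (η : E [⋀^Fin k]→ₗ[ℝ] ℝ) :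
    evalForm (c • η) = c • evalForm η := map_smul (evalFormL k) c η

theorem evalForm_zero {k : ℕ} : evalForm (0 : E [⋀^Fin k]→ₗ[ℝ] ℝ) = 0 := map_zero (evalFormL k)

theorem mem_diracForms_iff (hn : 1 ≤ n) (hD : ∀ w, w ∈ D ↔ M.IsSharp (evalForm w.1) w.2) {a : ℕ}
    (ha : a ≤ n) (σ : E [⋀^Fin a]→ₗ[ℝ] ℝ) :
    σ ∈ diracForms D a ↔ ∃ V, (evalForm σ, V) ∈ M.sharpRel a := by
  have ha' : n - a + a = n := Nat.sub_add_cancel ha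
  constructor
  · intro h
    refine Submodule.span_induction (p := fun σ _ => ∃ V, (evalForm σ, V) ∈ M.sharpRel a)
      ?_ ?_ ?_ ?_ h
    · rintro _ ⟨w, hw, U, hU, rfl⟩
      rw [evalForm_contract ha' _ hU]
      exact ⟨_, Submodule.subset_span ⟨_, _, (hD w).mp hw, U, hU, rfl⟩⟩
    · exact ⟨0, by rw [evalForm_zero]; exact zero_mem _⟩
    · rintro x y _ _ ⟨V, hV⟩ ⟨W, hW⟩
      exact ⟨V + W, by rw [evalForm_add]; exact add_mem hV hW⟩
    · rintro c x _ ⟨V, hV⟩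
      exact ⟨c • V, by rw [evalForm_smul]; exact Submodule.smul_mem _ c hV⟩
  · rintro ⟨V, hV⟩
    suffices h : ∀ s ∈ M.sharpRel a, ∃ σ ∈ diracForms D a, evalForm σ = s.1 by
      obtain ⟨τ, hτ, h2⟩ := h _ hV
      rwa [← evalForm_injective h2]
    intro s hs
    refine Submodule.span_induction (p := fun s _ => ∃ σ ∈ diracForms D a, evalForm σ = s.1)
      ?_ ?_ ?_ ?_ hs
    · rintro _ ⟨f, X, hf, U, hU, rfl⟩
      have h1 := evalForm_degreePart (hf.hasDegree hn)
      refine ⟨contract a U (degreePart n f), Submodule.subset_span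
        ⟨(degreePart n f, X), (hD _).mpr (by rwa [h1]), U, hU, rfl⟩, ?_⟩
      rw [evalForm_contract ha' _ hU, h1]
    · exact ⟨0, zero_mem _, evalForm_zero⟩
    · rintro x y _ _ ⟨σ, hσ, h1⟩ ⟨τ, hτ, h2⟩
      exact ⟨σ + τ, add_mem hσ hτ, by rw [evalForm_add, h1, h2]; rfl⟩
    · rintro c x _ ⟨σ, hσ, h1⟩
      exact ⟨c • σ, Submodule.smul_mem _ c hσ, by rw [evalForm_smul, h1]; rfl⟩

theorem mem_diracGraph (hn : 1 ≤ n) (hD : ∀ w, w ∈ D ↔ M.IsSharp (evalForm w.1) w.2) {a : ℕ}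
    (ha : a ≤ n) {σ : E [⋀^Fin a]→ₗ[ℝ] ℝ} {V : ExteriorAlgebra ℝ E}
    (hV : (evalForm σ, V) ∈ M.sharpRel a) : (σ, V) ∈ diracGraph D a := by
  have ha' : n - a + a = n := Nat.sub_add_cancel ha
  suffices h : ∀ s ∈ M.sharpRel a, ∃ σ, (σ, s.2) ∈ diracGraph D a ∧ evalForm σ = s.1 by
    obtain ⟨τ, hτ, h2⟩ := h _ hV
    rwa [← evalForm_injective h2]
  intro s hs
  refine Submodule.span_induction
    (p := fun s _ => ∃ σ, (σ, s.2) ∈ diracGraph D a ∧ evalForm σ = s.1) ?_ ?_ ?_ ?_ hs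
  · rintro _ ⟨f, X, hf, U, hU, rfl⟩
    have h1 := evalForm_degreePart (hf.hasDegree hn)
    refine ⟨contract a U (degreePart n f), Submodule.subset_span (Or.inl
      ⟨(degreePart n f, X), (hD _).mpr (by rwa [h1]), U, hU, rfl⟩), ?_⟩
    rw [evalForm_contract ha' _ hU, h1]
  · exact ⟨0, zero_mem _, evalForm_zero⟩
  · rintro x y _ _ ⟨σ, hσ, h1⟩ ⟨τ, hτ, h2⟩
    exact ⟨σ + τ, add_mem hσ hτ, by rw [evalForm_add, h1, h2]; rfl⟩
  · rintro c x _ ⟨σ, hσ, h1⟩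
    exact ⟨c • σ, Submodule.smul_mem _ c hσ, by rw [evalForm_smul, h1]; rfl⟩

theorem eq_zero_of_mem_diracAnn (hn : 1 ≤ n) (hD : ∀ w, w ∈ D ↔ M.IsSharp (evalForm w.1) w.2)
    {p q : ℕ} (hpq : q + p = n) {U : ExteriorAlgebra ℝ E} (hU : U ∈ diracAnn D p) {f : ExtDual E}
    {X : E} (hf : M.IsSharp f X) {W : ExteriorAlgebra ℝ E} (hW : W ∈ ⋀[ℝ]^q E) :
    f (W * U) = 0 := by
  have h1 := evalForm_degreePart (hf.hasDegree hn)
  have hq : q = n - p := by omega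
  have h2 := hU.2 (contract p W (degreePart n f)) (Submodule.subset_span
    ⟨(degreePart n f, X), (hD _).mpr (by rwa [h1]), W, hq ▸ hW, rfl⟩)
  have h3 := congrArg evalForm h2
  rw [evalForm_contract (Nat.add_zero p) _ hU.1, evalForm_contract hpq _ hW, h1, evalForm_zero] at h3
  simpa using LinearMap.congr_fun h3 1

theorem mem_diracAnn (hD : ∀ w, w ∈ D ↔ M.IsSharp (evalForm w.1) w.2)
    {p q : ℕ} (hpq : q + p = n) {U : ExteriorAlgebra ℝ E} (hU : U ∈ ⋀[ℝ]^p E)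
    (h : ∀ f X, M.IsSharp f X → ∀ W ∈ ⋀[ℝ]^q E, f (W * U) = 0) : U ∈ diracAnn D p := by
  have hq : q = n - p := by omega
  refine ⟨hU, fun σ hσ => ?_⟩
  suffices h2 : evalForm σ U = 0 by
    ext v
    have : v = ![] := Subsingleton.elim _ _
    change evalForm σ (U * ExteriorAlgebra.ιMulti ℝ 0 v) = 0
    rw [ExteriorAlgebra.ιMulti_zero_apply, mul_one, h2]
  refine Submodule.span_induction (p := fun σ _ => evalForm σ U = 0) ?_ ?_ ?_ ?_ hσ
  · rintro _ ⟨w, hw, W, hW, rfl⟩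
    rw [evalForm_contract (Nat.sub_add_cancel (by omega)) _ hW]
    exact h _ _ ((hD w).mp hw) W (hq ▸ hW)
  · rw [evalForm_zero]; rfl
  · intro x y _ _ hx hy
    rw [evalForm_add, LinearMap.add_apply, hx, hy, add_zero]
  · intro c x _ hx
    rw [evalForm_smul, LinearMap.smul_apply, hx, smul_zero]

theorem diracGraph_snd_mem {a : ℕ} (han : a ≤ n)
    {s : (E [⋀^Fin a]→ₗ[ℝ] ℝ) × ExteriorAlgebra ℝ E} (hs : s ∈ diracGraph D a) :
    s.2 ∈ ⋀[ℝ]^(n + 1 - a) E := by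
  refine Submodule.span_induction (p := fun s _ => s.2 ∈ ⋀[ℝ]^(n + 1 - a) E) ?_ ?_ ?_ ?_ hs
  · rintro _ (⟨w, hw, U, hU, rfl⟩ | h)
    · rw [show n + 1 - a = n - a + 1 by omega]
      exact ι_mul_mem _ hU
    · exact h.2.1
  · exact zero_mem _
  · exact fun x y _ _ hx hy => add_mem hx hy
  · exact fun c x _ hx => Submodule.smul_mem _ c hx

/-- On generators this is `IsSharp.pairing_generator`; on the annihilator summand both sides vanish.
The point is that the pairings of Sⁿ with the multivector are determined by the form alone. -/
theorem diracGraph_pairing (hn : 1 ≤ n) (hD : ∀ w, w ∈ D ↔ M.IsSharp (evalForm w.1) w.2)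
    {a : ℕ} (ha : a + 1 ≤ n) {g : ExtDual E} {Y : E} (hg : M.IsSharp g Y)
    {s : (E [⋀^Fin (a + 1)]→ₗ[ℝ] ℝ) × ExteriorAlgebra ℝ E} (hs : s ∈ diracGraph D (a + 1))
    {W : ExteriorAlgebra ℝ E} (hW : W ∈ ⋀[ℝ]^a E) :
    g (W * s.2) = (-((-1 : ℝ) ^ a * (-1 : ℝ) ^ ((a + 1) * (n - (a + 1))))) *
      evalForm s.1 (ExteriorAlgebra.ι ℝ Y * W) := by
  refine Submodule.span_induction (p := fun s _ => g (W * s.2) =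
    (-((-1 : ℝ) ^ a * (-1 : ℝ) ^ ((a + 1) * (n - (a + 1))))) *
      evalForm s.1 (ExteriorAlgebra.ι ℝ Y * W)) ?_ ?_ ?_ ?_ hs
  · rintro _ (⟨w, hw, U, hU, rfl⟩ | h)
    · rw [evalForm_contract (Nat.sub_add_cancel ha) _ hU]
      exact ((hD w).mp hw).pairing_generator hg hU hW
    · rw [eq_zero_of_mem_diracAnn hn hD (by omega) h.2 hg hW, h.1, evalForm_zero]
      simp
  · simp [evalForm_zero]
  · intro x y _ _ hx hy
    rw [Prod.snd_add, Prod.fst_add, mul_add, map_add, hx, hy, evalForm_add, LinearMap.add_apply]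
    ring
  · intro c x _ hx
    rw [Prod.smul_snd, Prod.smul_fst, mul_smul_comm, map_smul, hx, evalForm_smul,
      LinearMap.smul_apply, smul_eq_mul, smul_eq_mul]
    ring

/-- The difference of the two pairs has zero form, so by `diracGraph_pairing` its multivector pairs
to zero with the generators of the Dirac structure. -/
theorem diracGraph_unique (hn : 1 ≤ n) (hD : ∀ w, w ∈ D ↔ M.IsSharp (evalForm w.1) w.2)
    {a : ℕ} (ha : 1 ≤ a) (han : a ≤ n) {σ : E [⋀^Fin a]→ₗ[ℝ] ℝ} {V V' : ExteriorAlgebra ℝ E}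
    (h : (σ, V) ∈ diracGraph D a) (h' : (σ, V') ∈ diracGraph D a) :
    V - V' ∈ diracAnn D (n + 1 - a) := by
  have h1 := sub_mem h h'
  rw [Prod.mk_sub_mk, sub_self] at h1
  obtain ⟨a, rfl⟩ := Nat.exists_eq_add_of_le' ha
  refine mem_diracAnn (q := a) hD (by omega) (diracGraph_snd_mem han h1) fun f X hf W hW => ?_
  rw [diracGraph_pairing hn hD han hf h1 hW, evalForm_zero]
  simp

theorem mem_diracForms_iff_exists (hn : 1 ≤ n)
    (hD : ∀ w, w ∈ D ↔ M.IsSharp (evalForm w.1) w.2) {a : ℕ} (ha : a ≤ n)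
    (σ : E [⋀^Fin a]→ₗ[ℝ] ℝ) : σ ∈ diracForms D a ↔ ∃ V, (σ, V) ∈ diracGraph D a := by
  constructor
  · intro h
    obtain ⟨V, hV⟩ := (mem_diracForms_iff hn hD ha σ).mp h
    exact ⟨V, mem_diracGraph hn hD ha hV⟩
  · rintro ⟨V, hV⟩
    suffices h : ∀ s ∈ diracGraph D a, s.1 ∈ diracForms D a from h _ hV
    intro s hs
    refine Submodule.span_induction (p := fun s _ => s.1 ∈ diracForms D a) ?_ ?_ ?_ ?_ hs
    · rintro _ (⟨w, hw, U, hU, rfl⟩ | h)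
      · exact Submodule.subset_span ⟨w, hw, U, hU, rfl⟩
      · rw [h.1]; exact zero_mem _
    · exact zero_mem _
    · exact fun x y _ _ hx hy => add_mem hx hy
    · exact fun c x _ hx => Submodule.smul_mem _ c hx

/-- For `τ` = ι_U f, evaluating on (V - V') ∧ T gives, up to sign, f(U ∧ T ∧ (V - V')). By the
degree count U ∧ T is an s-vector, and V - V' annihilates the (n-s)-form obtained by contracting f
with it. -/
theorem contract_eq_of_diracGraph (hn : 1 ≤ n) (hD : ∀ w, w ∈ D ↔ M.IsSharp (evalForm w.1) w.2)
    {r s d : ℕ} (hr : r + 1 ≤ n) (hs : s + 1 ≤ n) (hd : r + s = d + (n - 1))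
    {σ : E [⋀^Fin (s + 1)]→ₗ[ℝ] ℝ} {V V' : ExteriorAlgebra ℝ E}
    (h : (σ, V) ∈ diracGraph D (s + 1)) (h' : (σ, V') ∈ diracGraph D (s + 1))
    {τ : E [⋀^Fin (r + 1)]→ₗ[ℝ] ℝ} (hτ : τ ∈ diracForms D (r + 1)) :
    contract d V τ = contract d V' τ := by
  have hV := diracGraph_snd_mem hs h
  have hV' := diracGraph_snd_mem hs h'
  have hA := diracGraph_unique hn hD (by omega) hs h h'
  rw [show n + 1 - (s + 1) = n - s by omega] at hA hV hV'
  have key : ∀ T ∈ ⋀[ℝ]^d E, evalForm τ ((V - V') * T) = 0 := by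
    intro T hT
    refine Submodule.span_induction (p := fun τ _ => evalForm τ ((V - V') * T) = 0) ?_ ?_ ?_ ?_ hτ
    · rintro _ ⟨w, hw, U, hU, rfl⟩
      rw [evalForm_contract (Nat.sub_add_cancel hr) _ hU, LinearMap.comp_apply,
        LinearMap.mulLeft_apply, mul_eq_smul_mul (sub_mem hV hV') hT, mul_smul_comm, map_smul,
        ← mul_assoc, eq_zero_of_mem_diracAnn (q := s) hn hD (by omega) hA ((hD w).mp hw)
          (mul_mem_exteriorPower (by omega) hU hT), smul_zero]
    · rw [evalForm_zero]; rfl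
    · intro x y _ _ hx hy
      rw [evalForm_add, LinearMap.add_apply, hx, hy, add_zero]
    · intro c x _ hx
      rw [evalForm_smul, LinearMap.smul_apply, hx, smul_zero]
  ext v
  have h1 := key _ (ιMulti_mem v)
  rw [sub_mul, map_sub, sub_eq_zero] at h1
  exact h1

end DiracStructure

/-! ### Submodels -/

namespace PolyModel

variable {n : ℕ} {E E' : Type*} [NormedAddCommGroup E] [NormedSpace ℝ E]
  [NormedAddCommGroup E'] [NormedSpace ℝ E']

/-- The model induced on a subspace that contains the vectors `base μ`. -/
def induced (M' : PolyModel n E') (L : E →ₗ[ℝ] E') (base : Fin n → E)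
    (hbase : ∀ μ, L (base μ) = M'.base μ) : PolyModel n E where
  dx μ := (M'.dx μ).comp L
  base := base
  omega ν := (M'.omega ν).compl₁₂ L L
  dx_base μ ν := by rw [LinearMap.comp_apply, hbase, M'.dx_base]
  omega_skew ν X v := M'.omega_skew ν (L X) (L v)
  omega_base ν X μ := by rw [LinearMap.compl₁₂_apply, hbase, M'.omega_base]

variable {M' : PolyModel n E'} {L : E →ₗ[ℝ] E'} {base : Fin n → E}
  {hbase : ∀ μ, L (base μ) = M'.base μ}

theorem pullForm_vol_induced :
    YangMills.pullForm L M'.vol = (M'.induced L base hbase).vol := by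
  rw [vol, vol, pullForm_exteriorList, pullForm_unitForm, List.map_ofFn]
  rfl

theorem pullForm_flat_induced (X : E) :
    YangMills.pullForm L (M'.flat (L X)) = (M'.induced L base hbase).flat X := by
  rw [flat_apply, flat_apply, map_sum]
  refine Finset.sum_congr rfl fun ν _ => ?_
  rw [pullForm_exterior, volN, ← hbase, ← interior_pullForm, pullForm_vol_induced (hbase := hbase)]
  rfl

/-- The graph of the sharp map, as a submodule. -/
def sharpSubmodule (M : PolyModel n E) : Submodule ℝ ((E [⋀^Fin n]→ₗ[ℝ] ℝ) × E) where
  carrier := {w | M.IsSharp (evalForm w.1) w.2}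
  add_mem' {x y} hx hy := by
    change M.IsSharp (evalForm (x.1 + y.1)) (x.2 + y.2)
    rw [evalForm_add]
    exact IsSharp.add hx hy
  zero_mem' := by
    change M.IsSharp (evalForm 0) 0
    rw [evalForm_zero]
    exact isSharp_zero
  smul_mem' r x hx := by
    change M.IsSharp (evalForm (r • x.1)) (r • x.2)
    rw [evalForm_smul]
    exact IsSharp.smul hx r

/-- Restriction sends c dⁿx + flat(L X) to the same expression in `M`; conversely this expression on
`E'` is a lift. Hence the generating set is already a subspace. -/
theorem mem_span_restrict_iff {M : PolyModel n E} (hn : 1 ≤ n)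
    (hvert : ∀ X, X ∈ M.vertical ↔ L X ∈ M'.vertical)
    (hvol : YangMills.pullForm L M'.vol = M.vol)
    (hflat : ∀ X, YangMills.pullForm L (M'.flat (L X)) = M.flat X) {R : Submodule ℝ ((E' [⋀^Fin n]→ₗ[ℝ] ℝ) × E')}
    (hR : ∀ w, w ∈ R ↔ M'.IsSharp (evalForm w.1) w.2) (w : (E [⋀^Fin n]→ₗ[ℝ] ℝ) × E) :
    w ∈ Submodule.span ℝ {w : (E [⋀^Fin n]→ₗ[ℝ] ℝ) × E |
        ∃ α, (α, L w.2) ∈ R ∧ w.1 = α.compLinearMap L} ↔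
      M.IsSharp (evalForm w.1) w.2 := by
  constructor
  · intro hw
    refine Submodule.span_le (p := M.sharpSubmodule).mpr ?_ hw
    rintro ⟨σ, X⟩ ⟨α, hα, hσ⟩
    obtain ⟨h0, c, hc⟩ := (hR _).mp hα
    refine ⟨(hvert _).mpr h0, c, ?_⟩
    simp only at hσ hc ⊢
    rw [hσ, evalForm_compLinearMap, hc, map_add, map_smul, hvol, hflat]
  · rintro ⟨hX, c, hc⟩
    have hs : M'.IsSharp (c • M'.vol + M'.flat (L w.2)) (L w.2) := ⟨(hvert _).mp hX, c, rfl⟩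
    have h1 := evalForm_degreePart (hs.hasDegree hn)
    refine Submodule.subset_span
      ⟨degreePart n (c • M'.vol + M'.flat (L w.2)), (hR _).mpr (by rwa [h1]), ?_⟩
    apply evalForm_injective
    rw [evalForm_compLinearMap, h1, map_add, map_smul, hvol,
      hflat, hc]

theorem mem_span_induced_iff (hn : 1 ≤ n) {R : Submodule ℝ ((E' [⋀^Fin n]→ₗ[ℝ] ℝ) × E')}
    (hR : ∀ w, w ∈ R ↔ M'.IsSharp (evalForm w.1) w.2) (w : (E [⋀^Fin n]→ₗ[ℝ] ℝ) × E) :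
    w ∈ Submodule.span ℝ {w : (E [⋀^Fin n]→ₗ[ℝ] ℝ) × E |
        ∃ α, (α, L w.2) ∈ R ∧ w.1 = α.compLinearMap L} ↔
      (M'.induced L base hbase).IsSharp (evalForm w.1) w.2 :=
  mem_span_restrict_iff hn (fun _ => Iff.rfl) pullForm_vol_induced pullForm_flat_induced hR w

end PolyModel

/-! ## The Dirac structure in terms of the polysymplectic form -/

section Poly

variable {n m : ℕ}

/-- The components of the polysymplectic form `dA^i_μ ∧ dp^{μν}_i` on `M`. -/
def omegaM (ν : Fin n) : Phase n m →ₗ[ℝ] Phase n m →ₗ[ℝ] ℝ :=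
  LinearMap.mk₂ ℝ (fun X v => ∑ i, ∑ μ, (X.2.1 i μ * v.2.2 i μ ν - v.2.1 i μ * X.2.2 i μ ν))
    (fun X Y v => by
      simp only [← Finset.sum_add_distrib]
      refine Finset.sum_congr rfl fun i _ => Finset.sum_congr rfl fun μ _ => ?_
      simp only [Prod.snd_add, Prod.fst_add, Pi.add_apply]; ring)
    (fun c X v => by
      simp only [Finset.smul_sum]
      refine Finset.sum_congr rfl fun i _ => Finset.sum_congr rfl fun μ _ => ?_
      simp only [Prod.smul_snd, Prod.smul_fst, Pi.smul_apply, smul_eq_mul]; ring)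
    (fun X v w => by
      simp only [← Finset.sum_add_distrib]
      refine Finset.sum_congr rfl fun i _ => Finset.sum_congr rfl fun μ _ => ?_
      simp only [Prod.snd_add, Prod.fst_add, Pi.add_apply]; ring)
    (fun c X v => by
      simp only [Finset.smul_sum]
      refine Finset.sum_congr rfl fun i _ => Finset.sum_congr rfl fun μ _ => ?_
      simp only [Prod.smul_snd, Prod.smul_fst, Pi.smul_apply, smul_eq_mul]; ring)

theorem omegaM_apply (ν : Fin n) (X v : Phase n m) :
    omegaM ν X v = ∑ i, ∑ μ, (X.2.1 i μ * v.2.2 i μ ν - v.2.1 i μ * X.2.2 i μ ν) := rfl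

/-- The vector `∂/∂x^ν` on `M`. -/
def vecX (ν : Fin n) : Phase n m := (EuclideanSpace.single ν 1, 0, 0)

theorem dx_vecX (μ ν : Fin n) : dx n m μ (vecX ν) = if μ = ν then 1 else 0 := by
  change (EuclideanSpace.single ν (1 : ℝ) : EuclideanSpace ℝ (Fin n)) μ = _
  simp

theorem evalForm_wedgeDnx (φ : Phase n m →ₗ[ℝ] ℝ) (ν : Fin n) :
    evalForm (wedgeDnx n m φ ν) = exterior φ (interior (vecX ν) (evalForm (dnx n m))) := by
  rw [dnx, exterior_interior_covectorWedge]
  simp [dx_vecX, wedgeDnx]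

/-- The polysymplectic model of `M`. -/
def phaseModel (n m : ℕ) : PolyModel n (Phase n m) where
  dx := dx n m
  base := vecX
  omega := omegaM
  dx_base := dx_vecX
  omega_skew ν X v := by
    simp only [omegaM_apply, ← Finset.sum_neg_distrib]
    refine Finset.sum_congr rfl fun i _ => Finset.sum_congr rfl fun μ _ => ?_
    ring
  omega_base ν X μ := by simp [omegaM_apply, vecX]

theorem phaseModel_vol : (phaseModel n m).vol = evalForm (dnx n m) :=
  (evalForm_covectorWedge _).symm

theorem phaseModel_flat_apply (X : Phase n m) : (phaseModel n m).flat X =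
    ∑ ν, exterior (omegaM ν X) (interior (vecX ν) (evalForm (dnx n m))) := by
  rw [PolyModel.flat_apply, ← phaseModel_vol]
  rfl

theorem mem_phaseModel_vertical {X : Phase n m} : X ∈ (phaseModel n m).vertical ↔ X.1 = 0 :=
  ⟨fun h => by ext μ; exact h μ, fun h μ => by
    change X.1 μ = 0
    rw [h]; rfl⟩

theorem omegaM_vecP (κ : Fin n) (i : Fin m) (μ ν : Fin n) :
    omegaM κ (-vecP n m i μ ν) = if κ = ν then dA n m i μ else 0 := by
  refine LinearMap.ext fun v => ?_
  simp only [omegaM_apply, vecP]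
  rw [Finset.sum_eq_single i (fun j _ hj => by simp [hj]) (by simp),
    Finset.sum_eq_single μ (fun α _ hα => by simp [hα]) (by simp)]
  split_ifs with h <;> simp [dA, h]

theorem omegaM_vecA (κ : Fin n) (i : Fin m) (μ : Fin n) :
    omegaM κ (vecA n m i μ) = dp n m i μ κ := by
  refine LinearMap.ext fun v => ?_
  simp only [omegaM_apply, vecA]
  rw [Finset.sum_eq_single i (fun j _ hj => by simp [hj]) (by simp),
    Finset.sum_eq_single μ (fun α _ hα => by simp [hα]) (by simp)]
  simp [dp]

theorem sharpGraphM_le {w : (Phase n m [⋀^Fin n]→ₗ[ℝ] ℝ) × Phase n m}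
    (hw : w ∈ sharpGraphM n m) :
    w.2.1 = 0 ∧ ∃ c : ℝ, evalForm w.1 = c • evalForm (dnx n m) + (phaseModel n m).flat w.2 := by
  refine Submodule.span_induction (p := fun w _ => w.2.1 = 0 ∧
    ∃ c : ℝ, evalForm w.1 = c • evalForm (dnx n m) + (phaseModel n m).flat w.2) ?_ ?_ ?_ ?_ hw
  · rintro w ((h | ⟨i, μ, ν, rfl⟩) | ⟨i, μ, rfl⟩)
    · rw [Set.mem_singleton_iff] at h
      subst h
      exact ⟨rfl, 1, by simp⟩
    · refine ⟨by simp [vecP], 0, ?_⟩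
      simp only [evalForm_wedgeDnx, phaseModel_flat_apply, omegaM_vecP]
      rw [Finset.sum_eq_single ν (fun κ _ hκ => by simp [hκ]) (by simp)]
      simp
    · refine ⟨rfl, 0, ?_⟩
      simp only [phaseModel_flat_apply, omegaM_vecA, ← evalFormL_apply, map_sum]
      simp only [evalFormL_apply, evalForm_wedgeDnx]
      simp
  · exact ⟨rfl, 0, by simp [← evalFormL_apply]⟩
  · rintro x y _ _ ⟨hx, c, hc⟩ ⟨hy, d, hd⟩
    refine ⟨by simp [hx, hy], c + d, ?_⟩
    rw [Prod.fst_add, Prod.snd_add, map_add, ← evalFormL_apply, map_add, evalFormL_apply,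
      evalFormL_apply, hc, hd]
    module
  · rintro r x _ ⟨hx, c, hc⟩
    refine ⟨by simp [hx], r * c, ?_⟩
    rw [Prod.smul_fst, Prod.smul_snd, map_smul, ← evalFormL_apply, map_smul, evalFormL_apply, hc]
    module

/-- The vectors ∂/∂A and ∂/∂p span the vertical space, and each is, up to sign, the image of a
generator. -/
theorem exists_mem_sharpGraphM {X : Phase n m} (hX : X.1 = 0) :
    ∃ α, (α, X) ∈ sharpGraphM n m := by
  have hA : ∀ i μ, vecA n m i μ ∈ (sharpGraphM n m).map (LinearMap.snd ℝ _ _) := fun i μ =>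
    ⟨_, Submodule.subset_span (Or.inr ⟨i, μ, rfl⟩), rfl⟩
  have hP : ∀ i μ ν, vecP n m i μ ν ∈ (sharpGraphM n m).map (LinearMap.snd ℝ _ _) :=
    fun i μ ν => by
      rw [← neg_mem_iff]
      exact ⟨_, Submodule.subset_span (Or.inl (Or.inr ⟨i, μ, ν, rfl⟩)), rfl⟩
  have h : X = ∑ i, ∑ μ, X.2.1 i μ • vecA n m i μ +
      ∑ i, ∑ μ, ∑ ν, X.2.2 i μ ν • vecP n m i μ ν := by
    refine Prod.ext ?_ (Prod.ext ?_ ?_)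
    · simp [hX, vecA, vecP, Prod.fst_sum]
    · ext i μ
      simp only [vecA, vecP, Prod.snd_add, Prod.fst_add, Prod.snd_sum, Prod.fst_sum,
        Prod.smul_snd, Prod.smul_fst, Pi.add_apply, Finset.sum_apply, Pi.smul_apply, smul_zero,
        Pi.zero_apply, Finset.sum_const_zero, add_zero]
      rw [Finset.sum_eq_single i (fun j _ hj => by simp [hj.symm]) (by simp),
        Finset.sum_eq_single μ (fun j _ hj => by simp [hj.symm]) (by simp)]
      simp
    · ext i μ ν
      simp only [vecA, vecP, Prod.snd_add, Prod.snd_sum,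
        Prod.smul_snd, Pi.add_apply, Finset.sum_apply, Pi.smul_apply, smul_zero,
        Pi.zero_apply, Finset.sum_const_zero, zero_add]
      rw [Finset.sum_eq_single i (fun j _ hj => by simp [hj.symm]) (by simp),
        Finset.sum_eq_single μ (fun j _ hj => by simp [hj.symm]) (by simp),
        Finset.sum_eq_single ν (fun j _ hj => by simp [hj.symm]) (by simp)]
      simp
  have hmem : X ∈ (sharpGraphM n m).map (LinearMap.snd ℝ _ _) := by
    rw [h]
    exact add_mem
      (sum_mem fun i _ => sum_mem fun μ _ => Submodule.smul_mem _ _ (hA i μ))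
      (sum_mem fun i _ => sum_mem fun μ _ => sum_mem fun ν _ => Submodule.smul_mem _ _ (hP i μ ν))
  obtain ⟨⟨α, Y⟩, hα, rfl⟩ := hmem
  exact ⟨α, hα⟩

/-- Two such forms with the same vector differ by a multiple of dⁿx, which lies in the graph with
vector 0. -/
theorem mem_sharpGraphM {α : Phase n m [⋀^Fin n]→ₗ[ℝ] ℝ} {X : Phase n m} (hX : X.1 = 0) {c : ℝ}
    (h : evalForm α = c • evalForm (dnx n m) + (phaseModel n m).flat X) : (α, X) ∈ sharpGraphM n m := by
  obtain ⟨α', hα'⟩ := exists_mem_sharpGraphM hX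
  obtain ⟨-, c', hc'⟩ := sharpGraphM_le hα'
  have h1 : α = α' + (c - c') • dnx n m := by
    apply evalForm_injective
    rw [← evalFormL_apply (α' + _), map_add, map_smul, evalFormL_apply, evalFormL_apply, h, hc']
    module
  have h2 : (α, X) = (α', X) + (c - c') • (dnx n m, (0 : Phase n m)) := by
    rw [h1]; simp
  rw [h2]
  exact add_mem hα' (Submodule.smul_mem _ _ (Submodule.subset_span (Or.inl (Or.inl rfl))))

theorem mem_sharpGraphM_iff (w : (Phase n m [⋀^Fin n]→ₗ[ℝ] ℝ) × Phase n m) :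
    w ∈ sharpGraphM n m ↔ (phaseModel n m).IsSharp (evalForm w.1) w.2 := by
  constructor
  · intro hw
    obtain ⟨h0, c, hc⟩ := sharpGraphM_le hw
    exact ⟨mem_phaseModel_vertical.mpr h0, c, by rw [phaseModel_vol]; exact hc⟩
  · rintro ⟨h0, c, hc⟩
    rw [phaseModel_vol] at hc
    exact mem_sharpGraphM (mem_phaseModel_vertical.mp h0) hc

/-- The vector `∂/∂x^μ` on `N`. -/
def baseVec (n m : ℕ) (μ : Fin n) : Constr n m := (EuclideanSpace.single μ 1, 0)

/-- The polysymplectic model of `N`. -/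
def model (n m : ℕ) : PolyModel n (Constr n m) :=
  (phaseModel n m).induced (incl n m).toLinearMap (baseVec n m) fun _ => rfl

theorem model_omega (ν : Fin n) (X v : Constr n m) : (model n m).omega ν X v =
    ∑ i, ∑ μ, (X.2.1 i μ * v.2.2.1 i μ ν - v.2.1 i μ * X.2.2.1 i μ ν) := rfl

theorem mem_model_vertical {X : Constr n m} : X ∈ (model n m).vertical ↔ X.1 = 0 :=
  ⟨fun h => by ext μ; exact h μ, fun h μ => by
    change X.1 μ = 0
    rw [h]; rfl⟩

/-- The model of N is induced from that of M along the inclusion. This is the bridge from the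
concrete Dirac structure to the abstract linear algebra. -/
theorem mem_sharpGraphN_iff (hn : 1 ≤ n) (w : (Constr n m [⋀^Fin n]→ₗ[ℝ] ℝ) × Constr n m) :
    w ∈ sharpGraphN n m ↔ (model n m).IsSharp (evalForm w.1) w.2 :=
  PolyModel.mem_span_induced_iff hn mem_sharpGraphM_iff w

end Poly

/-! ## Forms on finite dimensional spaces -/

section Forms

variable {E : Type*} [NormedAddCommGroup E] [NormedSpace ℝ E]

/-- The functional on the exterior algebra given by a continuous alternating form. -/
def ev (k : ℕ) : (E [⋀^Fin k]→L[ℝ] ℝ) →ₗ[ℝ] ExtDual E :=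
  (evalFormL k).comp (ContinuousAlternatingMap.toAlternatingMapLinear (R := ℝ))

theorem ev_apply {k : ℕ} (η : E [⋀^Fin k]→L[ℝ] ℝ) : ev k η = evalForm η.toAlternatingMap := rfl

theorem ev_hasDegree {k : ℕ} (η : E [⋀^Fin k]→L[ℝ] ℝ) : HasDegree k (ev k η) :=
  evalForm_hasDegree _

theorem ev_injective {k : ℕ} : Function.Injective (ev k : (E [⋀^Fin k]→L[ℝ] ℝ) → ExtDual E) :=
  evalForm_injective.comp ContinuousAlternatingMap.toAlternatingMap_injective

theorem ev_extDeriv {ι : Type*} [Fintype ι] (b : Module.Basis ι ℝ E) {k : ℕ}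
    (η : E → E [⋀^Fin k]→L[ℝ] ℝ) (z : E) :
    ev (k + 1) (extDeriv η z) = ∑ i, exterior (b.coord i) (ev k (fderiv ℝ η z (b i))) := by
  rw [ev_apply, extDeriv, ContinuousAlternatingMap.toAlternatingMap_alternatizeUncurryFin]
  exact evalForm_alternatizeUncurryFin b _

/-- The exterior product as a bilinear map on continuous forms. -/
def wedgeC (a k : ℕ) : (E [⋀^Fin a]→L[ℝ] ℝ) →ₗ[ℝ] (E [⋀^Fin k]→L[ℝ] ℝ) →ₗ[ℝ]
    E [⋀^Fin (a + k)]→L[ℝ] ℝ :=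
  LinearMap.mk₂ ℝ wedge
    (fun α α' _ => ContinuousAlternatingMap.toAlternatingMap_injective
      (LinearMap.congr_fun (map_add (wedgeL a k) α.toAlternatingMap α'.toAlternatingMap) _))
    (fun c α _ => ContinuousAlternatingMap.toAlternatingMap_injective
      (LinearMap.congr_fun (map_smul (wedgeL a k) c α.toAlternatingMap) _))
    (fun α β β' => ContinuousAlternatingMap.toAlternatingMap_injective
      (map_add (wedgeL a k α.toAlternatingMap) β.toAlternatingMap β'.toAlternatingMap))
    (fun c α β => ContinuousAlternatingMap.toAlternatingMap_injective
      (map_smul (wedgeL a k α.toAlternatingMap) c β.toAlternatingMap))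

theorem wedgeC_apply {a k : ℕ} (α : E [⋀^Fin a]→L[ℝ] ℝ) (β : E [⋀^Fin k]→L[ℝ] ℝ) :
    wedgeC a k α β = wedge α β := rfl

variable [FiniteDimensional ℝ E]

theorem exists_toAlternatingMap_eq {k : ℕ} (η : E [⋀^Fin k]→ₗ[ℝ] ℝ) :
    ∃ ζ : E [⋀^Fin k]→L[ℝ] ℝ, ζ.toAlternatingMap = η := by
  suffices h : η ∈ LinearMap.range (ContinuousAlternatingMap.toAlternatingMapLinear
      (R := ℝ) (A := ℝ) (M := E) (N := ℝ) (ι := Fin k)) from h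
  refine Submodule.span_le.mpr ?_ (mem_span_covectorWedge (Module.finBasis ℝ E) η)
  rintro _ ⟨s, rfl⟩
  refine ⟨{ covectorWedge fun i => (Module.finBasis ℝ E).coord (s i) with cont := ?_ }, rfl⟩
  change Continuous fun v : Fin k → E =>
    (Matrix.of fun i j => (Module.finBasis ℝ E).coord (s j) (v i)).det
  refine Continuous.matrix_det (continuous_matrix fun i j => ?_)
  exact (LinearMap.continuous_of_finiteDimensional ((Module.finBasis ℝ E).coord (s j))).comp
    (continuous_apply i)

/-- In finite dimension all alternating forms are continuous. -/
def continuousFormEquiv (k : ℕ) : (E [⋀^Fin k]→L[ℝ] ℝ) ≃ₗ[ℝ] (E [⋀^Fin k]→ₗ[ℝ] ℝ) :=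
  LinearEquiv.ofBijective (ContinuousAlternatingMap.toAlternatingMapLinear (R := ℝ))
    ⟨ContinuousAlternatingMap.toAlternatingMap_injective, exists_toAlternatingMap_eq⟩

theorem finiteDimensional_alternatingMap (k : ℕ) :
    FiniteDimensional ℝ (E [⋀^Fin k]→ₗ[ℝ] ℝ) := by
  refine Module.Finite.of_fg_top ?_
  rw [show (⊤ : Submodule ℝ (E [⋀^Fin k]→ₗ[ℝ] ℝ)) =
    Submodule.span ℝ (Set.range fun s : Fin k → Fin (Module.finrank ℝ E) =>
      covectorWedge fun i => (Module.finBasis ℝ E).coord (s i)) from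
    (eq_top_iff.mpr fun η _ => mem_span_covectorWedge _ η).symm]
  exact Submodule.fg_span (Set.finite_range _)

instance finiteDimensional_continuousAlternatingMap (k : ℕ) :
    FiniteDimensional ℝ (E [⋀^Fin k]→L[ℝ] ℝ) :=
  haveI := finiteDimensional_alternatingMap (E := E) k
  (continuousFormEquiv (E := E) k).symm.finiteDimensional

/-- The form of degree `k` given by a functional on the exterior algebra. -/
def toForm (k : ℕ) : ExtDual E →ₗ[ℝ] E [⋀^Fin k]→L[ℝ] ℝ :=
  (continuousFormEquiv k).symm.toLinearMap.comp (degreePart k)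

theorem toForm_toAlternatingMap {k : ℕ} (f : ExtDual E) :
    (toForm k f).toAlternatingMap = degreePart k f :=
  (continuousFormEquiv k).apply_symm_apply (degreePart k f)

theorem ev_toForm {k : ℕ} {f : ExtDual E} (hf : HasDegree k f) : ev k (toForm k f) = f := by
  rw [ev_apply, toForm_toAlternatingMap, evalForm_degreePart hf]

theorem ev_wedge {a k : ℕ} (α : E [⋀^Fin a]→L[ℝ] ℝ) {β : E [⋀^Fin k]→L[ℝ] ℝ}
    {ψ : Fin k → E →ₗ[ℝ] ℝ} (hβ : ev k β = exteriorList (List.ofFn ψ) unitForm) :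
    ev (a + k) (wedge α β) = (-1 : ℝ) ^ (a * k) • exteriorList (List.ofFn ψ) (ev a α) := by
  rw [← evalForm_covectorWedge] at hβ
  have h : β.toAlternatingMap = covectorWedge ψ := evalForm_injective hβ
  rw [ev_apply, ev_apply, ← evalForm_wedgeAlt, ← h]
  rfl

end Forms

/-! ### Differentiating linear and bilinear identities -/

section Calculus

variable {E F F' H : Type*} [NormedAddCommGroup E] [NormedSpace ℝ E]
  [NormedAddCommGroup F] [NormedSpace ℝ F] [FiniteDimensional ℝ F]
  [NormedAddCommGroup F'] [NormedSpace ℝ F'] [FiniteDimensional ℝ F']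
  [NormedAddCommGroup H] [NormedSpace ℝ H]

/-- A linear constraint on the values passes to the derivative; finite dimension of `F` makes `T`
continuous. -/
theorem fderiv_eq_zero_of_linear {η : E → F} {z : E} (hη : DifferentiableAt ℝ η z)
    (T : F →ₗ[ℝ] H) (h : ∀ᶠ y in nhds z, T (η y) = 0) (u : E) : T (fderiv ℝ η z u) = 0 := by
  have h1 : HasFDerivAt (fun y => T (η y)) (T.toContinuousLinearMap.comp (fderiv ℝ η z)) z :=
    T.toContinuousLinearMap.hasFDerivAt.comp z hη.hasFDerivAt
  have h2 : HasFDerivAt (fun y => T (η y)) (0 : E →L[ℝ] H) z :=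
    (hasFDerivAt_const 0 z).congr_of_eventuallyEq h
  exact congrArg (fun L : E →L[ℝ] H => L u) (h1.unique h2)

theorem hasFDerivAt_bilinear {η : E → F} {ζ : E → F'} {z : E} (hη : DifferentiableAt ℝ η z)
    (hζ : DifferentiableAt ℝ ζ z) (B : F →ₗ[ℝ] F' →ₗ[ℝ] H) (u : E) :
    fderiv ℝ (fun y => B (η y) (ζ y)) z u =
      B (fderiv ℝ η z u) (ζ z) + B (η z) (fderiv ℝ ζ z u) := by
  have h1 : HasFDerivAt (fun y => B.toContinuousBilinearMap (η y) (ζ y)) _ z :=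
    (B.toContinuousBilinearMap.hasFDerivAt.comp z hη.hasFDerivAt).clm_apply hζ.hasFDerivAt
  change fderiv ℝ (fun y => B.toContinuousBilinearMap (η y) (ζ y)) z u = _
  rw [h1.fderiv]
  simp [add_comm]

theorem contDiffOn_bilinear {η : E → F} {ζ : E → F'} {s : Set E} {r : ℕ∞ω}
    (hη : ContDiffOn ℝ r η s) (hζ : ContDiffOn ℝ r ζ s) (B : F →ₗ[ℝ] F' →ₗ[ℝ] H) :
    ContDiffOn ℝ r (fun y => B (η y) (ζ y)) s :=
  ((B.toContinuousBilinearMap.contDiff.comp_contDiffOn hη).clm_apply hζ)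

theorem fderiv_bilinear_eq_zero {η : E → F} {ζ : E → F'} {z : E} (hη : DifferentiableAt ℝ η z)
    (hζ : DifferentiableAt ℝ ζ z) (B : F →ₗ[ℝ] F' →ₗ[ℝ] H)
    (h : ∀ᶠ y in nhds z, B (η y) (ζ y) = 0) (u : E) :
    B (fderiv ℝ η z u) (ζ z) + B (η z) (fderiv ℝ ζ z u) = 0 := by
  rw [← hasFDerivAt_bilinear hη hζ B u]
  have h2 : HasFDerivAt (fun y => B (η y) (ζ y)) (0 : E →L[ℝ] H) z :=
    (hasFDerivAt_const 0 z).congr_of_eventuallyEq h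
  rw [h2.fderiv]
  rfl

theorem contDiffOn_extDeriv {k : ℕ} {η : E → E [⋀^Fin k]→L[ℝ] ℝ} {s : Set E} (hs : IsOpen s)
    (hη : ContDiffOn ℝ ∞ η s) : ContDiffOn ℝ ∞ (extDeriv η) s :=
  (ContinuousAlternatingMap.alternatizeUncurryFinCLM ℝ E ℝ).contDiff.comp_contDiffOn
    (hη.fderiv_of_isOpen hs (by simp))

theorem extDeriv_extDeriv_eq_zero {k : ℕ} {η : E → E [⋀^Fin k]→L[ℝ] ℝ} {s : Set E}
    (hs : IsOpen s) (hη : ContDiffOn ℝ ∞ η s) {z : E} (hz : z ∈ s) :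
    extDeriv (extDeriv η) z = 0 :=
  extDeriv_extDeriv_apply (hη.contDiffAt (hs.mem_nhds hz)) (by simpa using ENat.LEInfty.out)

end Calculus

namespace PolyModel

variable {n : ℕ} {E : Type*} [NormedAddCommGroup E] [NormedSpace ℝ E] {M : PolyModel n E}

/-! ### Forms of the graded Dirac structure -/

section DiracForms

variable {D : Submodule ℝ ((E [⋀^Fin n]→ₗ[ℝ] ℝ) × E)}

/-- Graded commutativity moves both vertical vectors past U, which reduces the claim to n-forms. -/
theorem interior_interior_of_mem_sharpRel {a : ℕ} {s : ExtDual E × ExteriorAlgebra ℝ E}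
    (hs : s ∈ M.sharpRel a) {v w : E} (hv : v ∈ M.vertical) (hw : w ∈ M.vertical) :
    interior v (interior w s.1) = 0 := by
  refine Submodule.span_induction (p := fun s _ => interior v (interior w s.1) = 0) ?_ ?_ ?_ ?_ hs
  · rintro _ ⟨f, X, hf, U, hU, rfl⟩
    refine LinearMap.ext fun T => ?_
    have h1 := LinearMap.congr_fun (hf.interior_interior hv hw) (U * T)
    have hUw := mul_eq_smul_mul (q := 1) hU (V := ExteriorAlgebra.ι ℝ w) (by
      rw [ExteriorAlgebra.exteriorPower, pow_one]; exact ⟨w, rfl⟩)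
    have hUv := mul_eq_smul_mul (q := 1) hU (V := ExteriorAlgebra.ι ℝ v) (by
      rw [ExteriorAlgebra.exteriorPower, pow_one]; exact ⟨v, rfl⟩)
    simp only [interior_apply, LinearMap.comp_apply, LinearMap.mulLeft_apply,
      LinearMap.zero_apply] at h1 ⊢
    rw [← mul_assoc, hUw, smul_mul_assoc, mul_assoc, ← mul_assoc U, hUv, smul_mul_assoc,
      mul_smul_comm, map_smul, map_smul, mul_assoc, h1, smul_zero, smul_zero]
  · rw [Prod.fst_zero, map_zero, map_zero]
  · intro x y _ _ hx hy
    rw [Prod.fst_add, map_add, map_add, hx, hy, add_zero]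
  · intro c x _ hx
    rw [Prod.smul_fst, map_smul, map_smul, hx, smul_zero]

theorem exists_isSharp_of_mem_sharpRel {s : ExtDual E × ExteriorAlgebra ℝ E}
    (hs : s ∈ M.sharpRel n) : ∃ X, M.IsSharp s.1 X := by
  refine Submodule.span_induction (p := fun s _ => ∃ X, M.IsSharp s.1 X) ?_ ?_ ?_ ?_ hs
  · rintro _ ⟨f, X, hf, U, hU, rfl⟩
    rw [Nat.sub_self, ExteriorAlgebra.exteriorPower, pow_zero, Submodule.mem_one] at hU
    obtain ⟨c, rfl⟩ := hU
    refine ⟨c • X, ?_⟩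
    convert hf.smul c using 1
    refine LinearMap.ext fun T => ?_
    simp [Algebra.algebraMap_eq_smul_one]
  · exact ⟨0, isSharp_zero⟩
  · rintro x y _ _ ⟨X, hX⟩ ⟨Y, hY⟩
    exact ⟨_, hX.add hY⟩
  · rintro c x _ ⟨X, hX⟩
    exact ⟨_, hX.smul c⟩

theorem mem_diracForms_top_iff (hn : 1 ≤ n) (hD : ∀ w, w ∈ D ↔ M.IsSharp (evalForm w.1) w.2)
    (σ : E [⋀^Fin n]→ₗ[ℝ] ℝ) :
    σ ∈ diracForms D n ↔ ∃ X, M.IsSharp (evalForm σ) X := by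
  rw [mem_diracForms_iff hn hD le_rfl]
  exact ⟨fun ⟨V, hV⟩ => exists_isSharp_of_mem_sharpRel hV, fun ⟨X, hX⟩ => ⟨_, mem_sharpRel_top hX⟩⟩

end DiracForms

variable [FiniteDimensional ℝ E]

/-! ### Exterior products with horizontal forms -/

theorem ev_extDeriv_wedge {ι : Type*} [Fintype ι] (b : Module.Basis ι ℝ E) {a K : ℕ}
    {η : E → E [⋀^Fin a]→L[ℝ] ℝ}
    {e : E → E [⋀^Fin K]→L[ℝ] ℝ} {z : E} (hη : DifferentiableAt ℝ η z)
    (he : DifferentiableAt ℝ e z) :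
    ev (a + K + 1) (extDeriv (fun y => wedge (η y) (e y)) z) =
      ∑ i, exterior (b.coord i) (ev (a + K) (wedgeC a K (fderiv ℝ η z (b i)) (e z))) +
      ∑ i, exterior (b.coord i) (ev (a + K) (wedgeC a K (η z) (fderiv ℝ e z (b i)))) := by
  rw [ev_extDeriv b, ← Finset.sum_add_distrib]
  refine Finset.sum_congr rfl fun i _ => ?_
  have h := hasFDerivAt_bilinear hη he (wedgeC a K) (b i)
  simp only [wedgeC_apply] at h
  rw [h, map_add, map_add]
  rfl

theorem sum_exterior_wedge {ι : Type*} [Fintype ι] (b : Module.Basis ι ℝ E) {a K : ℕ}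
    (η : E → E [⋀^Fin a]→L[ℝ] ℝ) (z : E) {β : E [⋀^Fin K]→L[ℝ] ℝ}
    {ψ : Fin K → E →ₗ[ℝ] ℝ} (hβ : ev K β = exteriorList (List.ofFn ψ) unitForm) :
    ∑ i, exterior (b.coord i) (ev (a + K) (wedgeC a K (fderiv ℝ η z (b i)) β)) =
      ((-1 : ℝ) ^ (a * K) * (-1 : ℝ) ^ K) •
        exteriorList (List.ofFn ψ) (ev (a + 1) (extDeriv η z)) := by
  rw [ev_extDeriv b, map_sum, Finset.smul_sum]
  refine Finset.sum_congr rfl fun i _ => ?_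
  rw [wedgeC_apply, ev_wedge _ hβ, exteriorList_exterior, map_smul, List.length_ofFn, smul_smul,
    mul_assoc, ← mul_pow]
  simp

theorem ev_extDeriv_wedge_const {a K : ℕ} {η : E → E [⋀^Fin a]→L[ℝ] ℝ}
    {e : E → E [⋀^Fin K]→L[ℝ] ℝ} {z : E} (hη : DifferentiableAt ℝ η z)
    {β : E [⋀^Fin K]→L[ℝ] ℝ} (he : ∀ᶠ y in nhds z, e y = β) {ψ : Fin K → E →ₗ[ℝ] ℝ}
    (hβ : ev K β = exteriorList (List.ofFn ψ) unitForm) :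
    ev (a + K + 1) (extDeriv (fun y => wedge (η y) (e y)) z) =
      ((-1 : ℝ) ^ (a * K) * (-1 : ℝ) ^ K) •
        exteriorList (List.ofFn ψ) (ev (a + 1) (extDeriv η z)) := by
  have h1 : HasFDerivAt e (0 : E →L[ℝ] _) z := (hasFDerivAt_const β z).congr_of_eventuallyEq he
  rw [ev_extDeriv_wedge (Module.finBasis ℝ E) hη h1.differentiableAt, h1.fderiv, he.self_of_nhds,
    sum_exterior_wedge _ η z hβ]
  simp

/-- The second factor is a combination of products of the dx^μ, and multiplication by these
preserves horizontality. -/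
theorem IsHor.ev_wedge {a K : ℕ} {α : E [⋀^Fin a]→L[ℝ] ℝ} (hα : M.IsHor (ev a α))
    {β : E [⋀^Fin K]→L[ℝ] ℝ} (hβ : M.IsHor (ev K β)) : M.IsHor (ev (a + K) (wedgeC a K α β)) := by
  have h := hβ.mem_span (ev_hasDegree β)
  rw [← ev_injective.eq_iff.mp (ev_toForm (ev_hasDegree β))]
  refine Submodule.span_induction
    (p := fun g _ => M.IsHor (ev (a + K) (wedgeC a K α (toForm K g)))) ?_ ?_ ?_ ?_ h
  · rintro _ ⟨s, rfl⟩
    have hd : HasDegree K (M.dxList (List.ofFn s) unitForm) := by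
      have := unitForm_hasDegree.exteriorList ((List.ofFn s).map M.dx)
      rwa [zero_add, List.length_map, List.length_ofFn] at this
    rw [wedgeC_apply, YangMills.ev_wedge (ψ := fun i => M.dx (s i)) α
      (by rw [ev_toForm hd, PolyModel.dxList, List.map_ofFn]; rfl)]
    have h2 := hα.dxList (List.ofFn s)
    rw [PolyModel.dxList, List.map_ofFn] at h2
    exact h2.smul _
  · rw [map_zero, map_zero, map_zero]
    exact fun v _ => map_zero _
  · intro x y _ _ hx hy
    rw [map_add, map_add, map_add]
    exact hx.add hy
  · intro c x _ hx
    rw [map_smul, map_smul, map_smul]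
    exact hx.smul c

theorem isHor_fderiv {K : ℕ} {e : E → E [⋀^Fin K]→L[ℝ] ℝ} {z : E}
    (he : DifferentiableAt ℝ e z) (h : ∀ᶠ y in nhds z, M.IsHor (ev K (e y))) (u : E) :
    M.IsHor (ev K (fderiv ℝ e z u)) := fun v hv => by
  refine LinearMap.ext fun U => ?_
  exact fderiv_eq_zero_of_linear he
    ((LinearMap.applyₗ U).comp ((interior v).comp (ev K)))
    (h.mono fun y hy => by
      change interior v (ev K (e y)) U = 0
      rw [hy v hv]; rfl) u

/-- In the product rule the terms with dη are combinations of the products in `hs`. The terms that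
differentiate `e` involve only the directions ∂_μ, so they form a horizontal n-form, a multiple of
dⁿx. -/
theorem exists_isSharp_wedge {d K : ℕ} (hn : d + K + 1 = n) {η : E → E [⋀^Fin d]→L[ℝ] ℝ}
    {e : E → E [⋀^Fin K]→L[ℝ] ℝ} {z : E} (hη : DifferentiableAt ℝ η z)
    (hηh : M.IsHor (ev d (η z)))
    (hs : ∀ l : List (Fin n), l.length = K →
      ∃ X, M.IsSharp (M.dxList l (ev (d + 1) (extDeriv η z))) X)
    (he : DifferentiableAt ℝ e z) (heh : ∀ᶠ y in nhds z, M.IsHor (ev K (e y)))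
    (hev : ∀ v ∈ M.vertical, fderiv ℝ e z v = 0) :
    ∃ X, M.IsSharp (ev (d + K + 1) (extDeriv (fun y => wedge (η y) (e y)) z)) X := by
  let b := Module.finBasis ℝ E
  rw [ev_extDeriv_wedge b hη he]
  have h1 : ∃ X, M.IsSharp
      (∑ i, exterior (b.coord i) (ev (d + K) (wedgeC d K (fderiv ℝ η z (b i)) (e z)))) X := by
    have h := (heh.self_of_nhds).mem_span (ev_hasDegree _)
    rw [← ev_injective.eq_iff.mp (ev_toForm (ev_hasDegree (e z)))]
    refine Submodule.span_induction (p := fun g _ => ∃ X, M.IsSharp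
      (∑ i, exterior (b.coord i)
        (ev (d + K) (wedgeC d K (fderiv ℝ η z (b i)) (toForm K g)))) X) ?_ ?_ ?_ ?_ h
    · rintro _ ⟨s, rfl⟩
      have hd : HasDegree K (M.dxList (List.ofFn s) unitForm) := by
        have := unitForm_hasDegree.exteriorList ((List.ofFn s).map M.dx)
        rwa [zero_add, List.length_map, List.length_ofFn] at this
      rw [sum_exterior_wedge (ψ := fun i => M.dx (s i)) b η z
        (by rw [ev_toForm hd, dxList, List.map_ofFn]; rfl)]
      obtain ⟨X, hX⟩ := hs (List.ofFn s) (List.length_ofFn)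
      rw [dxList, List.map_ofFn] at hX
      exact ⟨_, hX.smul _⟩
    · simp only [map_zero, Finset.sum_const_zero]
      exact ⟨0, isSharp_zero⟩
    · rintro x y _ _ ⟨X, hX⟩ ⟨Y, hY⟩
      simp only [map_add, Finset.sum_add_distrib]
      exact ⟨_, hX.add hY⟩
    · rintro c x _ ⟨X, hX⟩
      simp only [map_smul, ← Finset.smul_sum]
      exact ⟨_, hX.smul c⟩
  have h2 : ∑ i, exterior (b.coord i) (ev (d + K) (wedgeC d K (η z) (fderiv ℝ e z (b i)))) =
      ∑ μ, exterior (M.dx μ) (ev (d + K) (wedgeC d K (η z) (fderiv ℝ e z (M.base μ)))) := by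
    have h3 : ∀ v, ev (d + K) (wedgeC d K (η z) (fderiv ℝ e z v)) =
        ∑ μ, M.dx μ v • ev (d + K) (wedgeC d K (η z) (fderiv ℝ e z (M.base μ))) := fun v => by
      have h4 := hev _ (M.sub_mem_vertical v)
      rw [map_sub, sub_eq_zero] at h4
      rw [h4, map_sum, map_sum, map_sum]
      simp only [map_smul]
    simp only [h3 (b _)]
    exact sum_exterior_coord b M.dx _
  obtain ⟨X, hX⟩ := h1
  have h5 : M.IsHor
      (∑ μ, exterior (M.dx μ) (ev (d + K) (wedgeC d K (η z) (fderiv ℝ e z (M.base μ))))) :=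
    IsHor.sum _ fun μ _ => (hηh.ev_wedge (isHor_fderiv he heh _)).exterior μ
  have h6 := HasDegree.sum Finset.univ (f := fun μ => exterior (M.dx μ)
    (ev (d + K) (wedgeC d K (η z) (fderiv ℝ e z (M.base μ)))))
    fun μ _ => (ev_hasDegree _).exterior _
  rw [hn] at h6
  obtain ⟨c, hc⟩ := h5.eq_smul_vol h6
  rw [h2, hc]
  exact ⟨_, hX.add (isSharp_vol.smul c)⟩

/-! ### The local bracket of special forms -/

/-- The conditions are linear in dη with constant coefficients, the selector included, and hold
throughout `s`; hence they can be differentiated. The symmetry comes from d² = 0. -/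
theorem specialJet {P : M.Selector} {r k : ℕ} {η : E → E [⋀^Fin r]→L[ℝ] ℝ}
    {s : Set E} (hs : IsOpen s) (hη : ContDiffOn ℝ ∞ η s)
    (h : ∀ z ∈ s, M.IsSpecial k (ev (r + 1) (extDeriv η z))) {z : E} (hz : z ∈ s) :
    SpecialJet P k (ev (r + 1) (extDeriv η z))
      ((ev (r + 1)).comp (fderiv ℝ (extDeriv η) z).toLinearMap) where
  special := h z hz
  symm v hv w hw := by
    have hd := ((contDiffOn_extDeriv hs hη).contDiffAt (hs.mem_nhds hz)).differentiableAt (by simp)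
    refine interior_symm_of_closed (M := M) (Module.finBasis ℝ E) _ ?_ ?_ hv hw
    · have h1 := ev_extDeriv (Module.finBasis ℝ E) (extDeriv η) z
      rw [extDeriv_extDeriv_eq_zero hs hη hz, map_zero] at h1
      exact h1.symm
    · intro u v hv w hw
      refine LinearMap.ext fun U => ?_
      refine fderiv_eq_zero_of_linear hd
        ((LinearMap.applyₗ U).comp ((interior v).comp ((interior w).comp (ev (r + 1))))) ?_ u
      filter_upwards [hs.mem_nhds hz] with y hy
      change interior v (interior w (ev (r + 1) (extDeriv η y))) U = 0
      rw [(h y hy).interior_interior v hv w hw]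
      rfl
  coeff l hl ν u w hw := by
    have hd := ((contDiffOn_extDeriv hs hη).contDiffAt (hs.mem_nhds hz)).differentiableAt (by simp)
    rw [← sub_eq_zero]
    refine fderiv_eq_zero_of_linear hd
      ((M.coeffN ν).comp ((M.dxList l).comp ((interior w).comp (ev (r + 1)))) -
        (-1 : ℝ) ^ k • ((M.omega ν).flip w).comp (P.toLin.comp ((M.dxList l).comp (ev (r + 1)))))
      ?_ u
    filter_upwards [hs.mem_nhds hz] with y hy
    change M.coeffN ν (M.dxList l (interior w (ev (r + 1) (extDeriv η y)))) -
      (-1 : ℝ) ^ k * M.omega ν (P.toLin (M.dxList l (ev (r + 1) (extDeriv η y)))) w = 0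
    rw [P.dxList_interior (h y hy) hl hw, map_smul, coeffN_sum, smul_eq_mul, sub_self]

namespace Selector

variable (P : M.Selector)

/-- `bracket` as a bilinear map. -/
def bracketL (k : ℕ) : ExtDual E →ₗ[ℝ] ExtDual E →ₗ[ℝ] ExtDual E :=
  LinearMap.mk₂ ℝ (P.bracket k)
    (fun f g h => rfl) (fun c f h => rfl)
    (fun f g h => LinearMap.ext fun U => by simp [bracket, add_mul])
    (fun c f h => LinearMap.ext fun U => by simp [bracket])

/-- The bracket as a bilinear map on the differentials. -/
def bracketForm (k r s d : ℕ) (c : ℝ) : (E [⋀^Fin r]→L[ℝ] ℝ) →ₗ[ℝ] (E [⋀^Fin s]→L[ℝ] ℝ) →ₗ[ℝ]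
    E [⋀^Fin d]→L[ℝ] ℝ :=
  c • ((P.bracketL k).compl₁₂ (ev r) (ev s)).compr₂ (toForm d)

theorem ev_bracketForm {k r d : ℕ} (h : k + 1 + d = r) (s : ℕ) (c : ℝ) (x : E [⋀^Fin r]→L[ℝ] ℝ)
    (y : E [⋀^Fin s]→L[ℝ] ℝ) :
    ev d (P.bracketForm k r s d c x y) = c • P.bracket k (ev r x) (ev s y) := by
  change ev d (c • toForm d (P.bracket k (ev r x) (ev s y))) = _
  rw [map_smul, ev_toForm]
  exact contract_hasDegree h (ev_hasDegree x) (P.multivector_mem k _)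

theorem bracketForm_toAlternatingMap {k r d : ℕ} (s : ℕ) (c : ℝ)
    (x : E [⋀^Fin r]→L[ℝ] ℝ) (y : E [⋀^Fin s]→L[ℝ] ℝ) :
    (P.bracketForm k r s d c x y).toAlternatingMap =
      c • contract d (P.multivector k (ev s y)) x.toAlternatingMap := by
  change c • (toForm d (P.bracket k (ev r x) (ev s y))).toAlternatingMap = _
  rw [toForm_toAlternatingMap]
  rfl

variable {r s d j k : ℕ} {α : E → E [⋀^Fin r]→L[ℝ] ℝ} {β : E → E [⋀^Fin s]→L[ℝ] ℝ} {S : Set E}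

theorem isHor_bracketForm (h : k + 1 + d = r + 1)
    {x : E [⋀^Fin (r + 1)]→L[ℝ] ℝ} (hx : M.IsSpecial j (ev (r + 1) x)) (c : ℝ)
    (y : E [⋀^Fin s]→L[ℝ] ℝ) : M.IsHor (ev d (P.bracketForm k (r + 1) s d c x y)) := by
  rw [P.ev_bracketForm h]
  exact (P.isHor_bracket hx k _).smul c

theorem contDiffOn_bracketForm (hS : IsOpen S) (hα : ContDiffOn ℝ ∞ α S)
    (hβ : ContDiffOn ℝ ∞ β S) (c : ℝ) :
    ContDiffOn ℝ ∞
      (fun y => P.bracketForm k (r + 1) (s + 1) d c (extDeriv α y) (extDeriv β y)) S :=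
  contDiffOn_bilinear (contDiffOn_extDeriv hS hα) (contDiffOn_extDeriv hS hβ) _

/-- Differentiating `exists_dxList_bracket` gives ±Σ_ν φ_ν ∧ d^{n-1}x_ν, where φ_ν is the
differential of a multiple of ω^ν(X_l, Y_{l'}). By `SpecialJet.omega_deriv` it agrees on vertical
vectors with ω^ν(Z, ·) for a common Z, and `isSharp_sum_exterior` concludes. -/
theorem exists_isSharp_extDeriv_bracketForm (hj : r + 1 + j = n) (h : k + 1 + d = r + 1)
    (hS : IsOpen S) (hα : ContDiffOn ℝ ∞ α S) (hβ : ContDiffOn ℝ ∞ β S)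
    (hαs : ∀ z ∈ S, M.IsSpecial j (ev (r + 1) (extDeriv α z)))
    (hβs : ∀ z ∈ S, M.IsSpecial k (ev (s + 1) (extDeriv β z))) (c : ℝ) {z : E} (hz : z ∈ S)
    {L : List (Fin n)} (hL : L.length = j + k) :
    ∃ X, M.IsSharp (M.dxList L (ev (d + 1) (extDeriv (fun y =>
      P.bracketForm k (r + 1) (s + 1) d c (extDeriv α y) (extDeriv β y)) z))) X := by
  have hdα := ((contDiffOn_extDeriv hS hα).contDiffAt (hS.mem_nhds hz)).differentiableAt (by simp)
  have hdβ := ((contDiffOn_extDeriv hS hβ).contDiffAt (hS.mem_nhds hz)).differentiableAt (by simp)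
  have hJα := specialJet (P := P) hS hα hαs hz
  have hJβ := specialJet (P := P) hS hβ hβs hz
  -- The first `j` indices are spent on dα and the last `k` on dβ.
  obtain ⟨l, l', rfl, hl, hl'⟩ : ∃ l l', L = l ++ l' ∧ l.length = j ∧ l'.length = k :=
    ⟨L.take j, L.drop j, (List.take_append_drop j L).symm, by simp [hL], by simp [hL]⟩
  obtain ⟨C, hC⟩ := P.exists_dxList_bracket j k r hj
  set Dα := (ev (r + 1)).comp (fderiv ℝ (extDeriv α) z).toLinearMap with hDα
  set Dβ := (ev (s + 1)).comp (fderiv ℝ (extDeriv β) z).toLinearMap with hDβ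
  set f := ev (r + 1) (extDeriv α z) with hf
  set g := ev (s + 1) (extDeriv β z) with hg
  let φ : Fin n → E →ₗ[ℝ] ℝ := fun ν => (c * C) •
    (((M.omega ν).flip (P.toLin (M.dxList l' g))).comp (P.toLin.comp ((M.dxList l).comp Dα)) +
      (M.omega ν (P.toLin (M.dxList l f))).comp (P.toLin.comp ((M.dxList l').comp Dβ)))
  have hφ : ∀ u, M.dxList (l ++ l') (ev d (fderiv ℝ (fun y =>
      P.bracketForm k (r + 1) (s + 1) d c (extDeriv α y) (extDeriv β y)) z u)) =
      ∑ ν, φ ν u • M.volN ν := by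
    intro u
    rw [hasFDerivAt_bilinear hdα hdβ]
    refine LinearMap.ext fun U => ?_
    -- The formula for the product of the bracket with the dx^μ holds only on special arguments. The
    -- two sides are therefore extended to bilinear maps `B1`, `B2`, which agree along (dα, dβ) near
    -- `z`, and the Leibniz rule compares their derivatives.
    let B1 := (P.bracketForm k (r + 1) (s + 1) d c).compr₂
      ((LinearMap.applyₗ U).comp ((M.dxList (l ++ l')).comp (ev d)))
    let B2 : (E [⋀^Fin (r + 1)]→L[ℝ] ℝ) →ₗ[ℝ] (E [⋀^Fin (s + 1)]→L[ℝ] ℝ) →ₗ[ℝ] ℝ :=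
      ∑ ν, (c * C * M.volN ν U) • (M.omega ν).compl₁₂
        (P.toLin.comp ((M.dxList l).comp (ev (r + 1))))
        (P.toLin.comp ((M.dxList l').comp (ev (s + 1))))
    have hB2 : ∀ x y, B2 x y = ∑ ν, (c * C * M.volN ν U) *
        M.omega ν (P.toLin (M.dxList l (ev (r + 1) x))) (P.toLin (M.dxList l' (ev (s + 1) y))) := by
      intro x y
      simp only [B2, LinearMap.sum_apply, LinearMap.smul_apply, smul_eq_mul]
      rfl
    have hB1 : ∀ x y, B1 x y =
        M.dxList (l ++ l') (ev d (P.bracketForm k (r + 1) (s + 1) d c x y)) U := fun x y => rfl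
    have h0 := fderiv_bilinear_eq_zero hdα hdβ (B1 - B2) (by
      filter_upwards [hS.mem_nhds hz] with y hy
      rw [LinearMap.sub_apply, LinearMap.sub_apply, hB1, hB2, P.ev_bracketForm h, map_smul,
        hC _ _ (hαs y hy) (ev_hasDegree _) (hβs y hy) l l' hl hl', LinearMap.smul_apply,
        LinearMap.sum_apply, smul_eq_mul, Finset.mul_sum, sub_eq_zero]
      refine Finset.sum_congr rfl fun ν _ => ?_
      rw [LinearMap.smul_apply, smul_eq_mul]
      ring) u
    simp only [LinearMap.sub_apply] at h0
    rw [map_add, map_add, LinearMap.add_apply, ← hB1, ← hB1,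
      show B1 (fderiv ℝ (extDeriv α) z u) (extDeriv β z) + B1 (extDeriv α z)
        (fderiv ℝ (extDeriv β) z u) = B2 (fderiv ℝ (extDeriv α) z u) (extDeriv β z) +
        B2 (extDeriv α z) (fderiv ℝ (extDeriv β) z u) by linarith, hB2, hB2,
      LinearMap.sum_apply, ← Finset.sum_add_distrib]
    refine Finset.sum_congr rfl fun ν _ => ?_
    simp only [φ, LinearMap.smul_apply, LinearMap.add_apply, LinearMap.comp_apply,
      LinearMap.flip_apply, smul_eq_mul, hDα, hDβ, hf, hg, ContinuousLinearMap.coe_coe]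
    ring
  let b := Module.finBasis ℝ E
  rw [ev_extDeriv b, map_sum]
  simp only [M.dxList_exterior, hφ, ← Finset.smul_sum]
  rw [sum_exterior_coord b φ]
  -- This vector plays the role of the commutator: one chosen Hamiltonian vector is varied along the
  -- other.
  refine ⟨_, (isSharp_sum_exterior (M := M) (Z := (c * C) •
    (P.toLin (M.dxList l (Dα (P.toLin (M.dxList l' g)))) -
      P.toLin (M.dxList l' (Dβ (P.toLin (M.dxList l f)))))) ?_ fun ν v hv => ?_).smul _⟩
  · exact Submodule.smul_mem _ _ (sub_mem (P.mem _) (P.mem _))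
  · have h1 : φ ν v = c * C *
        (M.omega ν (P.toLin (M.dxList l (Dα v))) (P.toLin (M.dxList l' g)) +
          M.omega ν (P.toLin (M.dxList l f)) (P.toLin (M.dxList l' (Dβ v)))) := rfl
    have h2 : ∀ (t : ℝ) (Z : E), M.omega ν (t • Z) v = t * M.omega ν Z v := fun t Z => by
      rw [map_smul]
      rfl
    rw [h1, hJα.omega_deriv hJβ hl hl' ν hv, h2]

/-- The bracket is horizontal near `z`, and so are its partial derivatives. In Σ e^i ∧ ∂_i(bracket)
a vertical vector can thus be absorbed only by e^i, and a second one has nothing left to meet. -/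
theorem isSpecial_extDeriv_bracketForm (hj : r + 1 + j = n) (h : k + 1 + d = r + 1)
    (hS : IsOpen S) (hα : ContDiffOn ℝ ∞ α S) (hβ : ContDiffOn ℝ ∞ β S)
    (hαs : ∀ z ∈ S, M.IsSpecial j (ev (r + 1) (extDeriv α z)))
    (hβs : ∀ z ∈ S, M.IsSpecial k (ev (s + 1) (extDeriv β z))) (c : ℝ) {z : E} (hz : z ∈ S) :
    M.IsSpecial (j + k) (ev (d + 1) (extDeriv (fun y =>
      P.bracketForm k (r + 1) (s + 1) d c (extDeriv α y) (extDeriv β y)) z)) where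
  isSharp l hl := P.exists_isSharp_extDeriv_bracketForm hj h hS hα hβ hαs hβs c hz hl
  interior_interior v hv w hw := by
    have hd := ((P.contDiffOn_bracketForm (k := k) (d := d) hS hα hβ c).contDiffAt
      (hS.mem_nhds hz)).differentiableAt (by simp)
    have hh := isHor_fderiv (M := M) hd (by
      filter_upwards [hS.mem_nhds hz] with y hy
      exact P.isHor_bracketForm h (hαs y hy) c _)
    have h1 : ∀ (b : Module.Basis (Fin (Module.finrank ℝ E)) ℝ E) (T : E →ₗ[ℝ] ExtDual E),
        ∑ i, b.coord i w • T (b i) = T w := fun b T => by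
      conv_rhs => rw [← b.sum_repr w, map_sum]
      simp
    rw [ev_extDeriv (Module.finBasis ℝ E), map_sum]
    simp only [interior_exterior w, hh _ w hw, map_zero, sub_zero]
    have h2 := h1 (Module.finBasis ℝ E) ((ev d).comp (fderiv ℝ (fun y =>
      P.bracketForm k (r + 1) (s + 1) d c (extDeriv α y) (extDeriv β y)) z).toLinearMap)
    simp only [LinearMap.comp_apply, ContinuousLinearMap.coe_coe] at h2
    rw [h2]
    exact hh w v hv

end Selector

end PolyModel

/-! ### Smoothness and pullbacks of form-valued maps -/

section Smooth

variable {E F : Type*} [NormedAddCommGroup E] [NormedSpace ℝ E]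
  [NormedAddCommGroup F] [NormedSpace ℝ F]

/-- Evaluation on tuples of basis vectors is injective, and a linear left inverse recovers the form
from finitely many smooth functions. -/
theorem contDiffOn_form_of_apply [FiniteDimensional ℝ E] {k : ℕ} {G : F → E [⋀^Fin k]→L[ℝ] ℝ} {s : Set F} {r : ℕ∞ω}
    (h : ∀ v : Fin k → E, ContDiffOn ℝ r (fun x => G x v) s) : ContDiffOn ℝ r G s := by
  let b := Module.finBasis ℝ E
  let T : (E [⋀^Fin k]→L[ℝ] ℝ) →ₗ[ℝ] (Fin k → Fin (Module.finrank ℝ E)) → ℝ :=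
    { toFun := fun η t => η fun i => b (t i)
      map_add' := fun _ _ => rfl
      map_smul' := fun _ _ => rfl }
  have hT : LinearMap.ker T = ⊥ := by
    refine LinearMap.ker_eq_bot.mpr fun η ζ hηζ => ?_
    refine ContinuousAlternatingMap.toContinuousMultilinearMap_injective
      (ContinuousMultilinearMap.toMultilinearMap_injective ?_)
    exact Module.Basis.ext_multilinear (fun _ => b) fun t => congrFun hηζ t
  obtain ⟨S, hS⟩ := T.exists_leftInverse_of_injective hT
  have h1 : ContDiffOn ℝ r (fun x => T (G x)) s := contDiffOn_pi.mpr fun t => h _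
  have h2 : G = fun x => S.toContinuousLinearMap (T (G x)) :=
    funext fun x => (LinearMap.congr_fun hS (G x)).symm
  rw [h2]
  exact S.toContinuousLinearMap.contDiff.comp_contDiffOn h1

theorem contDiffOn_const_compContinuousLinearMap [FiniteDimensional ℝ E] {E' : Type*} [NormedAddCommGroup E']
    [NormedSpace ℝ E'] {k : ℕ} (η : E' [⋀^Fin k]→L[ℝ] ℝ) {L : F → E →L[ℝ] E'} {s : Set F}
    {r : ℕ∞ω} (hL : ContDiffOn ℝ r L s) :
    ContDiffOn ℝ r (fun x => η.compContinuousLinearMap (L x)) s := by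
  refine contDiffOn_form_of_apply fun v => ?_
  exact η.toContinuousMultilinearMap.contDiff.comp_contDiffOn
    (contDiffOn_pi.mpr fun i => hL.clm_apply contDiffOn_const)

variable {E' : Type*} [NormedAddCommGroup E'] [NormedSpace ℝ E']

/-- The pullback of forms along a linear map, as a linear map. -/
def compFormL (k : ℕ) (L : E →L[ℝ] E') : (E' [⋀^Fin k]→L[ℝ] ℝ) →ₗ[ℝ] E [⋀^Fin k]→L[ℝ] ℝ where
  toFun η := η.compContinuousLinearMap L
  map_add' _ _ := rfl
  map_smul' _ _ := rfl

theorem contDiffOn_compForm [FiniteDimensional ℝ E'] {k : ℕ} (L : E →L[ℝ] E') {G : E' → E' [⋀^Fin k]→L[ℝ] ℝ} {t : Set E'}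
    {r : ℕ∞ω} (hG : ContDiffOn ℝ r G t) :
    ContDiffOn ℝ r (fun z => (G (L z)).compContinuousLinearMap L) (L ⁻¹' t) :=
  (compFormL k L).toContinuousLinearMap.contDiff.comp_contDiffOn
    (hG.comp L.contDiff.contDiffOn fun _ hz => hz)

theorem fderiv_compForm_apply [FiniteDimensional ℝ E'] {k : ℕ} (L : E →L[ℝ] E') {G : E' → E' [⋀^Fin k]→L[ℝ] ℝ} {z v : E}
    (hG : DifferentiableAt ℝ G (L z)) (hv : L v = 0) :
    fderiv ℝ (fun z => (G (L z)).compContinuousLinearMap L) z v = 0 := by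
  have h := (compFormL k L).toContinuousLinearMap.hasFDerivAt.comp z
    (hG.hasFDerivAt.comp z L.hasFDerivAt)
  have h2 : fderiv ℝ (fun z => (G (L z)).compContinuousLinearMap L) z = _ := h.fderiv
  rw [h2, ContinuousLinearMap.comp_apply, ContinuousLinearMap.comp_apply, hv, map_zero, map_zero]

theorem ev_compContinuousLinearMap {k : ℕ} (L : E →L[ℝ] E') (η : E' [⋀^Fin k]→L[ℝ] ℝ) :
    ev k (η.compContinuousLinearMap L) = pullForm L.toLinearMap (ev k η) := by
  have h : (η.compContinuousLinearMap L).toAlternatingMap =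
      η.toAlternatingMap.compLinearMap L.toLinearMap := rfl
  rw [ev_apply, ev_apply, h, evalForm_compLinearMap]

theorem isHor_ev_compForm {n k : ℕ} {M : PolyModel n E} {L : E →L[ℝ] E'}
    (hL : ∀ v ∈ M.vertical, L v = 0) (η : E' [⋀^Fin k]→L[ℝ] ℝ) :
    M.IsHor (ev k (η.compContinuousLinearMap L)) := fun v hv => by
  rw [ev_compContinuousLinearMap, interior_pullForm, ContinuousLinearMap.coe_coe, hL v hv, map_zero,
    LinearMap.zero_apply, map_zero]

theorem exists_form_covectorWedge [FiniteDimensional ℝ E'] (k : ℕ) (φ : Fin k → E' →ₗ[ℝ] ℝ) :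
    ∃ η : E' [⋀^Fin k]→L[ℝ] ℝ, ∀ L : E →L[ℝ] E', ev k (η.compContinuousLinearMap L) =
      exteriorList (List.ofFn fun i => (φ i).comp L.toLinearMap) unitForm := by
  obtain ⟨η, hη⟩ := exists_toAlternatingMap_eq (covectorWedge φ)
  refine ⟨η, fun L => ?_⟩
  rw [ev_compContinuousLinearMap, ev_apply, hη, evalForm_covectorWedge, pullForm_exteriorList,
    pullForm_unitForm, List.map_ofFn]
  rfl

end Smooth

/-! ## Closed forms that are constant in a chart near a point -/

section ClosedForms

variable {n : ℕ} {X : Type*} [TopologicalSpace X] [ChartedSpace (EuclideanSpace ℝ (Fin n)) X]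

theorem contMDiffAt_symm_of_mem_maximalAtlas
    {e : OpenPartialHomeomorph X (EuclideanSpace ℝ (Fin n))}
    (he : e ∈ IsManifold.maximalAtlas (𝓡 n) ∞ X) {u : Base n} (hu : u ∈ e.target) :
    ContMDiffAt (𝓡 n) (𝓡 n) ∞ e.symm u :=
  (contMDiffOn_symm_of_mem_maximalAtlas he).contMDiffAt (e.open_target.mem_nhds hu)

/-- The chart is multiplied by a bump function that equals 1 near the point and has its support in
the chart domain. -/
theorem exists_smooth_eq_chart_nhds [IsManifold (𝓡 n) ∞ X] [T2Space X]
    {e : OpenPartialHomeomorph X (EuclideanSpace ℝ (Fin n))}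
    (he : e ∈ IsManifold.maximalAtlas (𝓡 n) ∞ X) {x : X} (hx : x ∈ e.source) :
    ∃ F : X → Base n, ContMDiff (𝓡 n) (𝓡 n) ∞ F ∧ F =ᶠ[nhds x] e := by
  obtain ⟨f, -, hf⟩ := (SmoothBumpFunction.nhds_basis_tsupport (I := 𝓡 n) x).mem_iff.mp
    (e.open_source.mem_nhds hx)
  refine ⟨fun y => f y • e y, fun y => ?_, ?_⟩
  · by_cases hy : y ∈ tsupport f
    · exact f.contMDiffAt.smul
        ((contMDiffOn_of_mem_maximalAtlas he).contMDiffAt (e.open_source.mem_nhds (hf hy)))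
    · have h : (fun y => f y • e y) =ᶠ[nhds y] fun _ => 0 := by
        filter_upwards [(isClosed_tsupport f).isOpen_compl.mem_nhds hy] with w hw
        rw [image_eq_zero_of_notMem_tsupport hw, zero_smul]
      exact contMDiffAt_const.congr_of_eventuallyEq h
  · filter_upwards [f.eventuallyEq_one] with y hy
    rw [hy, Pi.one_apply, one_smul]

theorem localForm_pullback {K : ℕ} (η : Base n [⋀^Fin K]→L[ℝ] ℝ) {F : X → Base n}
    (hF : ContMDiff (𝓡 n) (𝓡 n) ∞ F)
    {e : OpenPartialHomeomorph X (EuclideanSpace ℝ (Fin n))}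
    (he : e ∈ IsManifold.maximalAtlas (𝓡 n) ∞ X) {u : Base n} (hu : u ∈ e.target) :
    localForm (fun x => η.compContinuousLinearMap (mfderiv (𝓡 n) (𝓡 n) F x)) e u =
      η.compContinuousLinearMap (fderiv ℝ (F ∘ e.symm) u) := by
  rw [← mfderiv_eq_fderiv, mfderiv_comp u ((hF _).mdifferentiableAt (by simp))
    ((contMDiffAt_symm_of_mem_maximalAtlas he hu).mdifferentiableAt (by simp))]
  rfl

theorem contDiffOn_comp_symm {F : X → Base n} (hF : ContMDiff (𝓡 n) (𝓡 n) ∞ F)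
    {e : OpenPartialHomeomorph X (EuclideanSpace ℝ (Fin n))}
    (he : e ∈ IsManifold.maximalAtlas (𝓡 n) ∞ X) : ContDiffOn ℝ ∞ (F ∘ e.symm) e.target :=
  contMDiffOn_iff_contDiffOn.mp
    (hF.comp_contMDiffOn (contMDiffOn_symm_of_mem_maximalAtlas he))

/-- The pullback of a form with constant coefficients along a smooth map. -/
def pullbackConst {K : ℕ} (η : Base n [⋀^Fin K]→L[ℝ] ℝ) {F : X → Base n}
    (hF : ContMDiff (𝓡 n) (𝓡 n) ∞ F) : ClosedForm n X K where
  toFun x := η.compContinuousLinearMap (mfderiv (𝓡 n) (𝓡 n) F x)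
  smooth e he := by
    refine ContDiffOn.congr ?_ fun u hu => localForm_pullback η hF he hu
    have h1 : ContDiffOn ℝ ∞ (fderiv ℝ (F ∘ e.symm)) e.target :=
      (contDiffOn_comp_symm hF he).fderiv_of_isOpen e.open_target (by simp)
    exact contDiffOn_const_compContinuousLinearMap η h1
  closed e he u hu := by
    have h1 : localForm (fun x => η.compContinuousLinearMap (mfderiv (𝓡 n) (𝓡 n) F x)) e
        =ᶠ[nhds u] fun u => η.compContinuousLinearMap (fderiv ℝ (F ∘ e.symm) u) := by
      filter_upwards [e.open_target.mem_nhds hu] with w hw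
      exact localForm_pullback η hF he hw
    -- A form with constant coefficients is closed, and d commutes with pullback along `F ∘ e.symm`.
    have h2 : extDeriv (fun _ : Base n => η) ((F ∘ e.symm) u) = 0 := by
      rw [extDeriv, fderiv_fun_const]
      exact map_zero (ContinuousAlternatingMap.alternatizeUncurryFinCLM ℝ (Base n) ℝ)
    have h3 : DifferentiableAt ℝ (fun _ : Base n => η) ((F ∘ e.symm) u) := differentiableAt_const _
    have h4 := extDeriv_pullback h3
      ((contDiffOn_comp_symm hF he).contDiffAt (e.open_target.mem_nhds hu))
      (by simpa using ENat.LEInfty.out)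
    rw [h1.extDeriv_eq]
    refine h4.trans ?_
    rw [h2]
    rfl

/-- Cutting off the form itself would destroy closedness; instead it is pulled back along a global
map that agrees with the chart near the point. -/
theorem exists_closedForm_eq [IsManifold (𝓡 n) ∞ X] [T2Space X] {K : ℕ} (η : Base n [⋀^Fin K]→L[ℝ] ℝ)
    {e : OpenPartialHomeomorph X (EuclideanSpace ℝ (Fin n))}
    (he : e ∈ IsManifold.maximalAtlas (𝓡 n) ∞ X) {u : Base n} (hu : u ∈ e.target) :
    ∃ ε : ClosedForm n X K, ∀ᶠ w in nhds u, localForm ε.toFun e w = η := by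
  obtain ⟨F, hF, h⟩ := exists_smooth_eq_chart_nhds he (e.map_target hu)
  refine ⟨pullbackConst η hF, ?_⟩
  have h1 : F ∘ e.symm =ᶠ[nhds u] id := by
    have h2 := (e.continuousAt_symm hu).eventually h
    filter_upwards [h2, e.open_target.mem_nhds hu] with w hw hwt
    rw [Function.comp_apply, hw, e.right_inv hwt, id]
  filter_upwards [h1.eventuallyEq_nhds, e.open_target.mem_nhds hu] with w hw hwt
  refine (localForm_pullback η hF he hwt).trans ?_
  rw [hw.fderiv_eq, fderiv_id]
  ext v
  rfl

end ClosedForms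

/-! ### The special Hamiltonian condition in a gauge chart -/

section Local

variable {n m : ℕ}

theorem mem_formsS_iff (hn : 1 ≤ n) {a : ℕ} (ha : a ≤ n) (σ : Constr n m [⋀^Fin a]→ₗ[ℝ] ℝ) :
    σ ∈ formsS n m a ↔ ∃ V, (evalForm σ, V) ∈ (model n m).sharpRel a :=
  mem_diracForms_iff hn (mem_sharpGraphN_iff hn) ha σ

theorem mem_formsS_top_iff (hn : 1 ≤ n) {a : ℕ} (ha : a = n)
    (σ : Constr n m [⋀^Fin a]→ₗ[ℝ] ℝ) :
    σ ∈ formsS n m a ↔ ∃ X, (model n m).IsSharp (evalForm σ) X := by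
  subst ha
  exact PolyModel.mem_diracForms_top_iff hn (mem_sharpGraphN_iff hn) σ

theorem contract_smul {E : Type*} [NormedAddCommGroup E] [NormedSpace ℝ E] {k : ℕ} (a : ℕ) (c : ℝ)
    (U : ExteriorAlgebra ℝ E) (η : E [⋀^Fin k]→ₗ[ℝ] ℝ) :
    contract a (c • U) η = c • contract a U η := by
  ext v
  simp [contract]

variable {X G P : Type*}
  [TopologicalSpace X] [ChartedSpace (EuclideanSpace ℝ (Fin n)) X]
  [TopologicalSpace G] [ChartedSpace (EuclideanSpace ℝ (Fin m)) G] [Group G]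
  [TopologicalSpace P] [ChartedSpace (EuclideanSpace ℝ (Fin (n + m))) P]
  {Q : PrincipalBundle n m X G P}

theorem GaugeChart.isOpen_dom (c : GaugeChart Q) : IsOpen (c.dom : Set (Constr n m)) :=
  c.chart.open_target.preimage continuous_fst

/-! ### Basic forms -/

variable (n m) in
/-- The projection of `N` to the base coordinates. -/
def baseProj : Constr n m →L[ℝ] Base n :=
  ContinuousLinearMap.fst ℝ (Base n) ((Fin m → Fin n → ℝ) × skewMomenta n m)

theorem baseProj_vertical : ∀ v ∈ (model n m).vertical, baseProj n m v = 0 :=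
  fun _ hv => mem_model_vertical.mp hv

theorem basic_eq {k : ℕ} (ε : ClosedForm n X k) (c : GaugeChart Q) :
    basic (m := m) ε c = fun z => (localForm ε.toFun c.chart
      (baseProj n m z)).compContinuousLinearMap (baseProj n m) := rfl

theorem contDiffOn_basic {k : ℕ} (ε : ClosedForm n X k) (c : GaugeChart Q) :
    ContDiffOn ℝ ∞ (basic (m := m) ε c) c.dom := by
  rw [basic_eq]
  exact contDiffOn_compForm (baseProj n m) (ε.smooth _ c.chart_mem)

theorem isHor_ev_basic {k : ℕ} (ε : ClosedForm n X k) (c : GaugeChart Q) (z : Constr n m) :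
    (model n m).IsHor (ev k (basic ε c z)) := by
  rw [basic_eq]
  exact isHor_ev_compForm baseProj_vertical _

theorem fderiv_basic_vertical {k : ℕ} (ε : ClosedForm n X k) (c : GaugeChart Q) {z : Constr n m}
    (hz : z ∈ c.dom) {v : Constr n m} (hv : v ∈ (model n m).vertical) :
    fderiv ℝ (basic (m := m) ε c) z v = 0 := by
  rw [basic_eq]
  exact fderiv_compForm_apply (baseProj n m)
    (((ε.smooth _ c.chart_mem).contDiffAt (c.chart.open_target.mem_nhds hz)).differentiableAt
      (by simp)) (baseProj_vertical v hv)

theorem exists_basic_eq [IsManifold (𝓡 n) ∞ X] [T2Space X] (c : GaugeChart Q) {z : Constr n m}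
    (hz : z ∈ c.dom) {k : ℕ} (s : Fin k → Fin n) :
    ∃ (ε : ClosedForm n X k) (β : Constr n m [⋀^Fin k]→L[ℝ] ℝ),
      (∀ᶠ y in nhds z, basic ε c y = β) ∧
      ev k β = exteriorList (List.ofFn fun i => (model n m).dx (s i)) unitForm := by
  obtain ⟨η, hη⟩ := exists_form_covectorWedge (E := Constr n m) k
    fun i => (EuclideanSpace.proj (𝕜 := ℝ) (s i) : Base n →L[ℝ] ℝ).toLinearMap
  obtain ⟨ε, hε⟩ := exists_closedForm_eq η c.chart_mem hz
  refine ⟨ε, η.compContinuousLinearMap (baseProj n m), ?_, hη (baseProj n m)⟩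
  filter_upwards [(baseProj n m).continuous.continuousAt.eventually hε] with y hy
  rw [basic_eq]
  beta_reduce
  rw [hy]

/-! ### Special Hamiltonian forms in terms of their differentials -/

/-- Near the point dx^l is the local expression of a closed form on X, for which d(α ∧ ε) is ±dx^l ∧
dα. The vertical condition is shared by all elements of S^{r+1}. -/
theorem IsSpecialHamiltonian.isSpecial [IsManifold (𝓡 n) ∞ X] [T2Space X] (hn : 1 ≤ n) {r k : ℕ}
    (hk : r + 1 + k = n)
    {α : GaugeChart Q → Constr n m → Constr n m [⋀^Fin r]→L[ℝ] ℝ}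
    (hα : IsSpecialHamiltonian α) (c : GaugeChart Q) (hs : ContDiffOn ℝ ∞ (α c) c.dom)
    {z : Constr n m} (hz : z ∈ c.dom) :
    (model n m).IsSpecial k (ev (r + 1) (extDeriv (α c) z)) where
  interior_interior v hv w hw := by
    obtain ⟨V, hV⟩ := (mem_formsS_iff hn hα.1.1 _).mp (hα.1.2 c z hz)
    exact PolyModel.interior_interior_of_mem_sharpRel hV hv hw
  isSharp l hl := by
    subst hl
    obtain ⟨ε, β, h1, h2⟩ := exists_basic_eq c hz l.get
    have h3 := (hα.2 l.length (by omega) ε).2 c z hz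
    obtain ⟨Y, hY⟩ := (mem_formsS_top_iff hn (by omega) _).mp h3
    have hd : DifferentiableAt ℝ (α c) z :=
      (hs.contDiffAt (c.isOpen_dom.mem_nhds hz)).differentiableAt (by simp)
    have h4 := PolyModel.ev_extDeriv_wedge_const hd h1 h2
    rw [ev_apply] at h4
    rw [h4] at hY
    have h5 : (model n m).dxList l = exteriorList (List.ofFn fun i => (model n m).dx (l.get i)) := by
      rw [PolyModel.dxList]
      congr 1
      conv_lhs => rw [← List.ofFn_get l, List.map_ofFn]
      rfl
    rw [h5]
    have h6 := hY.smul ((-1 : ℝ) ^ (r * l.length) * (-1 : ℝ) ^ l.length)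
    -- The sign squares to 1, so multiplying by it once more removes it.
    rw [smul_smul, show (-1 : ℝ) ^ (r * l.length) * (-1 : ℝ) ^ l.length *
      ((-1 : ℝ) ^ (r * l.length) * (-1 : ℝ) ^ l.length) = 1 by
        rw [← pow_add, ← pow_add, ← two_mul, pow_mul]; simp, one_smul] at h6
    exact ⟨_, h6⟩

/-- Horizontality of `η` itself, and not only a condition on its differential, controls the terms of
d(η ∧ ε) in which ε is differentiated. -/
theorem isSpecialHamiltonian_of_isSpecial (hn : 1 ≤ n) {d k : ℕ} (hk : d + 1 + k = n)
    {η : GaugeChart Q → Constr n m → Constr n m [⋀^Fin d]→L[ℝ] ℝ}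
    (hs : ∀ c, ContDiffOn ℝ ∞ (η c) c.dom)
    (hh : ∀ c, ∀ z ∈ GaugeChart.dom c, (model n m).IsHor (ev d (η c z)))
    (hη : ∀ c, ∀ z ∈ GaugeChart.dom c,
      (model n m).IsSpecial k (ev (d + 1) (extDeriv (η c) z))) :
    IsSpecialHamiltonian η := by
  obtain ⟨S⟩ := (model n m).nonempty_selector
  refine ⟨⟨by omega, fun c z hz => ?_⟩, fun K hK ε => ⟨by omega, fun c z hz => ?_⟩⟩
  · exact (mem_formsS_iff hn (by omega) _).mpr
      ⟨_, (hη c z hz).mem_sharpRel S hk (ev_hasDegree _)⟩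
  · obtain rfl : K = k := by omega
    refine (mem_formsS_top_iff hn (by omega) _).mpr ?_
    have hnz := c.isOpen_dom.mem_nhds hz
    exact PolyModel.exists_isSharp_wedge (by omega)
      (((hs c).contDiffAt hnz).differentiableAt (by simp)) (hh c z hz) (hη c z hz).isSharp
      (((contDiffOn_basic ε c).contDiffAt hnz).differentiableAt (by simp))
      (Filter.Eventually.of_forall fun y => isHor_ev_basic ε c y)
      (fun v hv => fderiv_basic_vertical ε c hz hv)

end Local

/-! ## The adjoint action and logarithmic derivatives -/

section Lie

variable {m : ℕ} {G : Type*}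
  [TopologicalSpace G] [ChartedSpace (EuclideanSpace ℝ (Fin m)) G] [Group G]

theorem Ad_smul (g : G) (c : ℝ) (ξ : GroupLieAlgebra (𝓡 m) G) : Ad g (c • ξ) = c • Ad g ξ :=
  map_smul (mfderiv (𝓡 m) (𝓡 m) (fun y : G => g * y * g⁻¹) 1) c ξ

/-- `mfderiv` uses the preferred chart at `f x`; the value 1 makes this one fixed chart, in which
derivatives at different points can be compared. -/
theorem mfderiv_eq_fderiv_of_eq_one {E : Type*} [NormedAddCommGroup E] [NormedSpace ℝ E]
    {f : E → G} {x : E} (hf : MDifferentiableAt 𝓘(ℝ, E) (𝓡 m) f x) (h : f x = 1) (w : E) :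
    (mfderiv 𝓘(ℝ, E) (𝓡 m) f x w : EuclideanSpace ℝ (Fin m)) =
      fderiv ℝ (fun u => extChartAt (𝓡 m) (1 : G) (f u)) x w := by
  refine (DFunLike.congr_fun hf.mfderiv w).trans ?_
  change fderivWithin ℝ (extChartAt (𝓡 m) (f x) ∘ f ∘ id) (Set.range 𝓘(ℝ, E)) x w = _
  rw [h, ModelWithCorners.range_eq_univ, fderivWithin_univ]
  rfl

variable [LieGroup (𝓡 m) ∞ G]

theorem contMDiff_conj (g : G) : ContMDiff (𝓡 m) (𝓡 m) ∞ fun y : G => g * y * g⁻¹ :=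
  (contMDiff_mul_right (I := 𝓡 m) (n := ∞) (a := g⁻¹)).comp (contMDiff_mul_left (a := g))

theorem Ad_eq_fderiv (g : G) (ξ : GroupLieAlgebra (𝓡 m) G) :
    Ad g ξ = fderiv ℝ (fun u => extChartAt (𝓡 m) (1 : G)
      (g * (extChartAt (𝓡 m) (1 : G)).symm u * g⁻¹)) (extChartAt (𝓡 m) (1 : G) 1)
      (ξ : EuclideanSpace ℝ (Fin m)) := by
  have h : g * 1 * g⁻¹ = 1 := by group
  have h1 := ((contMDiff_conj (m := m) g 1).mdifferentiableAt (by simp)).mfderiv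
  refine (DFunLike.congr_fun h1 ξ).trans ?_
  change fderivWithin ℝ (extChartAt (𝓡 m) (g * 1 * g⁻¹) ∘ (fun y : G => g * y * g⁻¹) ∘
    (extChartAt (𝓡 m) (1 : G)).symm) (Set.range (𝓡 m)) _ ξ = _
  rw [h, ModelWithCorners.range_eq_univ, fderivWithin_univ]
  rfl

theorem Ad_Ad_inv (g : G) (ξ : GroupLieAlgebra (𝓡 m) G) : Ad g (Ad g⁻¹ ξ) = ξ := by
  have h1 : (fun y : G => g * y * g⁻¹) ∘ (fun y : G => g⁻¹ * y * g⁻¹⁻¹) = id := by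
    funext y
    simp [mul_assoc]
  have h2 := mfderiv_comp (I := 𝓡 m) (I' := 𝓡 m) (I'' := 𝓡 m) (1 : G)
    ((contMDiff_conj g _).mdifferentiableAt (by simp))
    ((contMDiff_conj g⁻¹ 1).mdifferentiableAt (by simp))
  rw [h1, mfderiv_id] at h2
  have h3 : ∀ y : G, y = 1 → ∀ η : EuclideanSpace ℝ (Fin m),
      (mfderiv (𝓡 m) (𝓡 m) (fun y : G => g * y * g⁻¹) y η : EuclideanSpace ℝ (Fin m)) =
        Ad g η := by
    rintro y rfl η
    rfl
  refine (h3 (g⁻¹ * 1 * g⁻¹⁻¹) (by group) _).symm.trans ?_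
  exact (DFunLike.congr_fun h2 ξ).symm

variable {E : Type*} [NormedAddCommGroup E] [NormedSpace ℝ E]

/-- In the chart at 1, conjugation by h(y) is jointly smooth in y and its argument near the unit,
and Ad is its partial derivative there. -/
theorem contDiffAt_Ad {h : E → G} {x : E} (hh : ContMDiffAt 𝓘(ℝ, E) (𝓡 m) ∞ h x)
    (ξ : GroupLieAlgebra (𝓡 m) G) :
    ContDiffAt ℝ ∞ (F := EuclideanSpace ℝ (Fin m)) (fun y => Ad (h y) ξ) x := by
  simp only [Ad_eq_fderiv]
  have h1 : ContDiffAt ℝ ∞ (Function.uncurry fun (y : E) (u : EuclideanSpace ℝ (Fin m)) =>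
      extChartAt (𝓡 m) (1 : G) (h y * (extChartAt (𝓡 m) (1 : G)).symm u * (h y)⁻¹))
      (x, extChartAt (𝓡 m) (1 : G) 1) := by
    rw [← contMDiffAt_iff_contDiffAt]
    have h2 : ContMDiffAt 𝓘(ℝ, E × EuclideanSpace ℝ (Fin m)) (𝓡 m) ∞
        (fun p : E × EuclideanSpace ℝ (Fin m) => h p.1) (x, extChartAt (𝓡 m) (1 : G) 1) :=
      ContMDiffAt.comp (x, extChartAt (𝓡 m) (1 : G) 1) (g := h) hh
        contDiffAt_fst.contMDiffAt
    have h3 : ContMDiffAt 𝓘(ℝ, E × EuclideanSpace ℝ (Fin m)) (𝓡 m) ∞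
        (fun p : E × EuclideanSpace ℝ (Fin m) => (extChartAt (𝓡 m) (1 : G)).symm p.2)
        (x, extChartAt (𝓡 m) (1 : G) 1) :=
      ContMDiffAt.comp (x, extChartAt (𝓡 m) (1 : G) 1) (g := (extChartAt (𝓡 m) (1 : G)).symm)
        ((contMDiffOn_extChartAt_symm (I := 𝓡 m) (n := ∞) (1 : G)).contMDiffAt
          (extChartAt_target_mem_nhds (I := 𝓡 m) (1 : G))) contDiffAt_snd.contMDiffAt
    refine ContMDiffAt.comp (x, extChartAt (𝓡 m) (1 : G) 1) (g := extChartAt (𝓡 m) (1 : G))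
      ?_ ((h2.mul h3).mul h2.inv)
    have h4 : h x * (extChartAt (𝓡 m) (1 : G)).symm (extChartAt (𝓡 m) (1 : G) 1) * (h x)⁻¹ = 1 := by
      rw [extChartAt_to_inv]
      group
    change ContMDiffAt _ _ _ _
      (h x * (extChartAt (𝓡 m) (1 : G)).symm (extChartAt (𝓡 m) (1 : G) 1) * (h x)⁻¹)
    rw [h4]
    exact contMDiffAt_extChartAt
  exact ((h1.fderiv (m := ∞) contDiffAt_const (by simp)).clm_apply contDiffAt_const)

/-- The map (y, u) ↦ h(y)⁻¹ h(u) is jointly smooth and takes the value 1 on the diagonal, so its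
partial derivative in u can be read off in the chart at 1. -/
theorem contDiffAt_logDeriv {h : E → G} {x : E}
    (hh : ∀ᶠ y in nhds x, ContMDiffAt 𝓘(ℝ, E) (𝓡 m) ∞ h y)
    {w : E → E} (hw : ContDiffAt ℝ ∞ w x) :
    ContDiffAt ℝ ∞ (F := EuclideanSpace ℝ (Fin m))
      (fun y => mfderiv 𝓘(ℝ, E) (𝓡 m) (fun u => (h y)⁻¹ * h u) y (w y)) x := by
  have h1 : ContDiffAt ℝ ∞ (Function.uncurry fun (y u : E) =>
      extChartAt (𝓡 m) (1 : G) ((h y)⁻¹ * h u)) (x, x) := by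
    rw [← contMDiffAt_iff_contDiffAt]
    have h2 : ContMDiffAt 𝓘(ℝ, E × E) (𝓡 m) ∞ (fun p : E × E => h p.1) (x, x) :=
      ContMDiffAt.comp (x, x) (g := h) hh.self_of_nhds contDiffAt_fst.contMDiffAt
    have h3 : ContMDiffAt 𝓘(ℝ, E × E) (𝓡 m) ∞ (fun p : E × E => h p.2) (x, x) :=
      ContMDiffAt.comp (x, x) (g := h) hh.self_of_nhds contDiffAt_snd.contMDiffAt
    refine ContMDiffAt.comp (x, x) (g := extChartAt (𝓡 m) (1 : G)) ?_ (h2.inv.mul h3)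
    change ContMDiffAt _ _ _ _ ((h x)⁻¹ * h x)
    rw [inv_mul_cancel]
    exact contMDiffAt_extChartAt
  have h2 := ((h1.fderiv (m := ∞) (g := fun y => y) contDiffAt_id (by simp)).clm_apply hw)
  refine h2.congr_of_eventuallyEq ?_
  filter_upwards [hh] with y hy
  refine mfderiv_eq_fderiv_of_eq_one (f := fun u => (h y)⁻¹ * h u) ?_ (inv_mul_cancel _) _
  exact (contMDiffAt_const.mul hy).mdifferentiableAt (by simp)

end Lie

/-! ## Changes of coordinates preserving the polysymplectic form up to a density -/

namespace PolyModel

variable {n : ℕ} {E E' : Type*} [NormedAddCommGroup E] [NormedSpace ℝ E]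
  [NormedAddCommGroup E'] [NormedSpace ℝ E'] {M : PolyModel n E} {M' : PolyModel n E'}

theorem vertical_symm {L : E ≃ₗ[ℝ] E'} {J w : Matrix (Fin n) (Fin n) ℝ} (hJ : J * w = 1)
    (hL : ∀ μ v, M'.dx μ (L v) = ∑ α, J μ α * M.dx α v) {X : E'} (hX : X ∈ M'.vertical) :
    L.symm X ∈ M.vertical := by
  have h1 : J.mulVec (fun α => M.dx α (L.symm X)) = 0 := by
    funext μ
    have h := hL μ (L.symm X)
    rw [L.apply_symm_apply] at h
    exact h.symm.trans (hX μ)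
  have h2 : w.mulVec (J.mulVec (fun α => M.dx α (L.symm X))) = 0 := by
    rw [h1, Matrix.mulVec_zero]
  rw [Matrix.mulVec_mulVec, mul_eq_one_comm.mp hJ, Matrix.one_mulVec] at h2
  exact fun μ => congrFun h2 μ

/-- Generators go to generators: f is pulled back by L, while X and U are moved by L⁻¹. -/
theorem map_mem_sharpRel {L : E ≃ₗ[ℝ] E'} {J w : Matrix (Fin n) (Fin n) ℝ} (hJ : J * w = 1)
    (hL : ∀ μ v, M'.dx μ (L v) = ∑ α, J μ α * M.dx α v)
    (hω : ∀ ν, ∀ X ∈ M.vertical, ∀ v ∈ M.vertical,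
      M'.omega ν (L X) (L v) = J.det⁻¹ * ∑ β, J ν β * M.omega β X v)
    {a : ℕ} {s : ExtDual E' × ExteriorAlgebra ℝ E'} (hs : s ∈ M'.sharpRel a) :
    (YangMills.pullForm L.toLinearMap s.1, ExteriorAlgebra.map L.symm.toLinearMap s.2) ∈
      M.sharpRel a := by
  let Φ : ExtDual E' × ExteriorAlgebra ℝ E' →ₗ[ℝ] ExtDual E × ExteriorAlgebra ℝ E :=
    (YangMills.pullForm L.toLinearMap).prodMap (ExteriorAlgebra.map L.symm.toLinearMap).toLinearMap
  suffices h : M'.sharpRel a ≤ (M.sharpRel a).comap Φ from h hs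
  rw [sharpRel, Submodule.span_le]
  rintro _ ⟨f, X, hf, U, hU, rfl⟩
  have hX : L.symm X ∈ M.vertical := vertical_symm hJ hL hf.1
  refine Submodule.subset_span ⟨YangMills.pullForm L.toLinearMap f, L.symm X,
    IsSharp.pullForm (M' := M') hJ hL hω hX ?_, ExteriorAlgebra.map L.symm.toLinearMap U,
    map_mem_exteriorPower _ hU, Prod.ext ?_ ?_⟩
  · rwa [LinearEquiv.coe_coe, L.apply_symm_apply]
  · refine LinearMap.ext fun W => ?_
    change f (U * ExteriorAlgebra.map L.toLinearMap W) =
      f (ExteriorAlgebra.map L.toLinearMap (ExteriorAlgebra.map L.symm.toLinearMap U * W))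
    rw [map_mul (ExteriorAlgebra.map L.toLinearMap),
      ← AlgHom.comp_apply (ExteriorAlgebra.map L.toLinearMap), ExteriorAlgebra.map_comp_map,
      LinearEquiv.comp_symm, ExteriorAlgebra.map_id, AlgHom.id_apply]
  · change ExteriorAlgebra.map L.symm.toLinearMap (ExteriorAlgebra.ι ℝ X * U) = _
    rw [map_mul, ExteriorAlgebra.map_apply_ι]
    rfl

end PolyModel

theorem contract_map_symm {E E' : Type*} [NormedAddCommGroup E] [NormedSpace ℝ E]
    [NormedAddCommGroup E'] [NormedSpace ℝ E'] (L : E ≃ₗ[ℝ] E') {k : ℕ} (d : ℕ)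
    (V : ExteriorAlgebra ℝ E') (τ : E' [⋀^Fin k]→ₗ[ℝ] ℝ) :
    contract d (ExteriorAlgebra.map L.symm.toLinearMap V) (τ.compLinearMap L.toLinearMap) =
      (contract d V τ).compLinearMap L.toLinearMap := by
  ext v
  simp only [contract, AlternatingMap.compLinearMap_apply, LinearMap.compAlternatingMap_apply,
    LinearMap.comp_apply, LinearMap.mulLeft_apply]
  rw [evalForm_compLinearMap, pullForm_apply, map_mul, ← AlgHom.comp_apply,
    ExteriorAlgebra.map_comp_map, LinearEquiv.comp_symm, ExteriorAlgebra.map_id, AlgHom.id_apply,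
    ExteriorAlgebra.map_apply_ιMulti]
  rfl

/-! ## The pairing of the transformed coordinates -/

/-- For fixed ν let q be `p` contracted with row ν of `J` in its last index. The left side is then
J.det⁻¹ times the trace of J qᵀ R R' A w, in which R R' = 1 and, by cyclicity, w J = 1 drop out. -/
theorem sum_transformed_pairing {n m : ℕ} {J w : Matrix (Fin n) (Fin n) ℝ} (hJ : J * w = 1)
    {R R' : Matrix (Fin m) (Fin m) ℝ} (hR : R * R' = 1) (p : Momenta n m) (a : Fin m → Fin n → ℝ)
    (ν : Fin n) :
    ∑ i, ∑ μ, (J.det⁻¹ * ∑ α, ∑ β, ∑ j, J μ α * J ν β * R j i * p j α β) *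
        (∑ j, R' i j * ∑ α, a j α * w α μ) =
      J.det⁻¹ * ∑ β, J ν β * ∑ i, ∑ μ, p i μ β * a i μ := by
  obtain ⟨q, hq⟩ : ∃ q : Matrix (Fin m) (Fin n) ℝ, ∀ j α, q j α = ∑ β, J ν β * p j α β :=
    ⟨Matrix.of fun j α => ∑ β, J ν β * p j α β, fun _ _ => rfl⟩
  obtain ⟨A, hA⟩ : ∃ A : Matrix (Fin m) (Fin n) ℝ, ∀ j α, A j α = a j α :=
    ⟨Matrix.of a, fun _ _ => rfl⟩
  have h1 : ∀ i μ, ∑ α, ∑ β, ∑ j, J μ α * J ν β * R j i * p j α β =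
      (J * (q.transpose * R)) μ i := fun i μ => by
    simp only [Matrix.mul_apply, Matrix.transpose_apply, hq, Finset.sum_mul, Finset.mul_sum]
    refine Finset.sum_congr rfl fun α _ => ?_
    rw [Finset.sum_comm]
    refine Finset.sum_congr rfl fun j _ => Finset.sum_congr rfl fun β _ => ?_
    ring
  have h2 : ∀ i μ, ∑ j, R' i j * ∑ α, a j α * w α μ = (R' * (A * w)) i μ := fun i μ => by
    simp only [Matrix.mul_apply, hA]
  simp only [h1, h2]
  have h3 : ∑ i, ∑ μ, (J.det⁻¹ * (J * (q.transpose * R)) μ i) * (R' * (A * w)) i μ =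
      J.det⁻¹ * Matrix.trace ((J * (q.transpose * R)) * (R' * (A * w))) := by
    rw [Finset.sum_comm, Matrix.trace, Finset.mul_sum]
    refine Finset.sum_congr rfl fun μ _ => ?_
    rw [Matrix.diag_apply, Matrix.mul_apply (M := J * (q.transpose * R)), Finset.mul_sum]
    exact Finset.sum_congr rfl fun i _ => by ring
  rw [h3]
  congr 1
  have h4 : (J * (q.transpose * R)) * (R' * (A * w)) = J * (q.transpose * (R * R') * A * w) := by
    simp only [Matrix.mul_assoc]
  rw [h4, hR, Matrix.mul_one, Matrix.trace_mul_comm, Matrix.mul_assoc,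
    mul_eq_one_comm.mp hJ, Matrix.mul_one, Matrix.trace]
  simp only [Matrix.diag_apply, Matrix.mul_apply, Matrix.transpose_apply, hq, Finset.mul_sum,
    Finset.sum_mul]
  rw [Finset.sum_congr rfl fun μ _ => Finset.sum_comm, Finset.sum_comm,
    Finset.sum_congr rfl fun β _ => Finset.sum_comm]
  refine Finset.sum_congr rfl fun β _ => Finset.sum_congr rfl fun i _ =>
    Finset.sum_congr rfl fun μ _ => ?_
  rw [hA]
  ring

/-! ## Smoothness of the changes of coordinates -/

section Transition

variable {n m : ℕ} {X G P : Type*}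
  [TopologicalSpace X] [ChartedSpace (EuclideanSpace ℝ (Fin n)) X]
  [TopologicalSpace G] [ChartedSpace (EuclideanSpace ℝ (Fin m)) G] [Group G]
  [TopologicalSpace P] [ChartedSpace (EuclideanSpace ℝ (Fin (n + m))) P]

/-- In a local trivialization the action is right translation of the group coordinate ψ, so ψ(p)⁻¹
ψ(p') carries p to p'. -/
theorem PrincipalBundle.eq_of_act (Q : PrincipalBundle n m X G P) {p p' : P}
    (h : Q.proj p = Q.proj p') : ∃ g, Q.act p g = p' := by
  obtain ⟨U, -, hx, φ, ψ, -, -, -, h4⟩ := Q.locally_trivial (Q.proj p)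
  refine ⟨(ψ p)⁻¹ * ψ p', ?_⟩
  have h5 := (h4 (Q.act p ((ψ p)⁻¹ * ψ p')) (by rwa [Q.proj_act])).1
  rw [(h4 p hx).2, Q.proj_act, mul_inv_cancel_left, h, (h4 p' (h ▸ hx)).1] at h5
  exact h5.symm

variable {Q : PrincipalBundle n m X G P}

namespace GaugeChart

theorem act_gauge (c c' : GaugeChart Q) {q : X} (hq : q ∈ c.chart.source)
    (hq' : q ∈ c'.chart.source) : Q.act (c.sec q) (gauge c c' q) = c'.sec q := by
  have h : ∃ g : G, Q.act (c.sec q) g = c'.sec q :=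
    Q.eq_of_act ((c.proj_sec q hq).trans (c'.proj_sec q hq').symm)
  rw [gauge, dif_pos h]
  exact h.choose_spec

/-- In a local trivialization the gauge transformation, defined by choice, is ψ(s)⁻¹ ψ(s') for the
two sections. -/
theorem contMDiffAt_gauge [LieGroup (𝓡 m) ∞ G] (c c' : GaugeChart Q) {q : X}
    (hq : q ∈ c.chart.source) (hq' : q ∈ c'.chart.source) :
    ContMDiffAt (𝓡 n) (𝓡 m) ∞ (gauge c c') q := by
  obtain ⟨U, hU, hx, φ, ψ, -, h2, -, h4⟩ := Q.locally_trivial q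
  have hopen : IsOpen (Q.proj ⁻¹' U) := hU.preimage Q.contMDiff_proj.continuous
  have key : ∀ e : GaugeChart Q, q ∈ e.chart.source →
      ContMDiffAt (𝓡 n) (𝓡 m) ∞ (fun y => ψ (e.sec y)) q := fun e he =>
    ContMDiffAt.comp q (g := ψ) (h2.contMDiffAt (hopen.mem_nhds (by
      rwa [Set.mem_preimage, e.proj_sec q he])))
      (e.contMDiffOn_sec.contMDiffAt (e.chart.open_source.mem_nhds he))
  refine ((key c hq).inv.mul (key c' hq')).congr_of_eventuallyEq ?_
  filter_upwards [c.chart.open_source.mem_nhds hq, c'.chart.open_source.mem_nhds hq',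
    hU.mem_nhds hx] with y hy hy' hyU
  have h := congrArg ψ (act_gauge c c' hy hy')
  rw [(h4 (c.sec y) (by rwa [c.proj_sec y hy])).2] at h
  rw [Pi.mul_apply, ← h, inv_mul_cancel_left]

/-- The coordinates `x` of the points in the common domain of two gauge charts. -/
def overlap (c c' : GaugeChart Q) : Set (Base n) := (c.chart.symm.trans c'.chart).source

theorem mem_overlap {c c' : GaugeChart Q} {x : Base n} : x ∈ overlap c c' ↔
    x ∈ c.chart.target ∧ c.chart.symm x ∈ c'.chart.source := by
  simp [overlap]

theorem isOpen_overlap (c c' : GaugeChart Q) : IsOpen (overlap c c') :=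
  (c.chart.symm.trans c'.chart).open_source

theorem changeX_mem_overlap {c c' : GaugeChart Q} {x : Base n} (hx : x ∈ overlap c c') :
    changeX c c' x ∈ overlap c' c := by
  rw [mem_overlap] at hx ⊢
  refine ⟨c'.chart.map_source hx.2, ?_⟩
  rw [changeX, c'.chart.left_inv hx.2]
  exact c.chart.map_target hx.1

theorem changeX_changeX {c c' : GaugeChart Q} {x : Base n} (hx : x ∈ overlap c c') :
    changeX c' c (changeX c c' x) = x := by
  rw [mem_overlap] at hx
  rw [changeX, changeX, c'.chart.left_inv hx.2, c.chart.right_inv hx.1]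

theorem contDiffOn_changeX (c c' : GaugeChart Q) :
    ContDiffOn ℝ ∞ (changeX c c') (overlap c c') := by
  have h := (contDiffGroupoid ∞ (𝓡 n)).compatible_of_mem_maximalAtlas c.chart_mem c'.chart_mem
  have h1 : ContDiffOn ℝ ∞ _ _ := (mem_groupoid_of_pregroupoid.mp h).1
  change ContDiffOn ℝ ∞ (c'.chart ∘ c.chart.symm) _
  simpa [contDiffPregroupoid, overlap] using h1

theorem contDiffAt_changeX {c c' : GaugeChart Q} {x : Base n} (hx : x ∈ overlap c c') :
    ContDiffAt ℝ ∞ (changeX c c') x :=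
  (contDiffOn_changeX c c').contDiffAt ((isOpen_overlap c c').mem_nhds hx)

theorem fderiv_changeX_comp {c c' : GaugeChart Q} {x : Base n} (hx : x ∈ overlap c c') :
    (fderiv ℝ (changeX c c') x).comp (fderiv ℝ (changeX c' c) (changeX c c' x)) =
      ContinuousLinearMap.id ℝ _ := by
  have hx' := changeX_mem_overlap hx
  have h1 := (contDiffAt_changeX hx').differentiableAt (by simp)
  have h2 := (contDiffAt_changeX (changeX_mem_overlap hx')).differentiableAt (by simp)
  rw [changeX_changeX hx] at h2
  have h3 : changeX c c' ∘ changeX c' c =ᶠ[nhds (changeX c c' x)] id := by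
    filter_upwards [(isOpen_overlap c' c).mem_nhds hx'] with y hy using changeX_changeX hy
  have h4 := fderiv_comp (changeX c c' x) (g := changeX c c') (by rwa [changeX_changeX hx]) h1
  rw [h3.fderiv_eq, fderiv_id, changeX_changeX hx] at h4
  exact h4.symm

theorem fderiv_changeX_apply (c c' : GaugeChart Q) (x v : Base n) (μ : Fin n) :
    fderiv ℝ (changeX c c') x v μ = ∑ α, jac c c' x μ α * v α := by
  have h : v = ∑ α, v α • EuclideanSpace.single α (1 : ℝ) := by
    ext β
    simp [Finset.sum_apply, Pi.single_apply]
  conv_lhs => rw [h]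
  simp only [map_sum, map_smul, jac]
  simp [mul_comm]

theorem jac_mul_jac {c c' : GaugeChart Q} {x : Base n} (hx : x ∈ overlap c c') :
    jac c c' x * jac c' c (changeX c c' x) = 1 := by
  ext μ ν
  have h := congrArg (fun v : Base n => v μ)
    (DFunLike.congr_fun (fderiv_changeX_comp hx) (EuclideanSpace.single ν (1 : ℝ)))
  simp only [ContinuousLinearMap.comp_apply, fderiv_changeX_apply] at h
  rw [Matrix.mul_apply, Matrix.one_apply]
  simpa [jac, Pi.single_apply, eq_comm] using h

theorem contDiffAt_jac {c c' : GaugeChart Q} {x : Base n} (hx : x ∈ overlap c c') (μ α : Fin n) :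
    ContDiffAt ℝ ∞ (fun y => jac c c' y μ α) x := by
  have h1 : ContDiffAt ℝ ∞ (fderiv ℝ (changeX c c')) x :=
    (contDiffAt_changeX hx).fderiv_right (by simp)
  exact ((EuclideanSpace.proj μ : Base n →L[ℝ] ℝ).contDiff.contDiffAt).comp x
    (h1.clm_apply contDiffAt_const)

theorem contDiffAt_inv_det_jac {c c' : GaugeChart Q} {x : Base n} (hx : x ∈ overlap c c') :
    ContDiffAt ℝ ∞ (fun y => (jac c c' y).det⁻¹) x := by
  refine ContDiffAt.inv ?_ fun h => ?_
  · simp only [Matrix.det_apply]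
    exact ContDiffAt.sum fun σ _ => ContDiffAt.const_smul _
      (contDiffAt_prod fun i _ => contDiffAt_jac hx _ _)
  · have := congrArg Matrix.det (jac_mul_jac hx)
    rw [Matrix.det_mul, h, zero_mul, Matrix.det_one] at this
    exact zero_ne_one this

theorem contMDiffAt_gauge_symm [LieGroup (𝓡 m) ∞ G] [IsManifold (𝓡 n) ∞ X] {c c' : GaugeChart Q}
    {x : Base n} (hx : x ∈ overlap c c') :
    ContMDiffAt (𝓡 n) (𝓡 m) ∞ (fun u => gauge c c' (c.chart.symm u)) x := by
  rw [mem_overlap] at hx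
  exact ContMDiffAt.comp x (g := gauge c c')
    (contMDiffAt_gauge c c' (c.chart.map_target hx.1) hx.2)
    (contMDiffAt_symm_of_mem_maximalAtlas c.chart_mem hx.1)

end GaugeChart

end Transition

/-! ## The differentials of the changes of coordinates -/

section Transition

variable {n m : ℕ} {X G P : Type*}
  [TopologicalSpace X] [ChartedSpace (EuclideanSpace ℝ (Fin n)) X]
  [TopologicalSpace G] [ChartedSpace (EuclideanSpace ℝ (Fin m)) G] [Group G]
  [TopologicalSpace P] [ChartedSpace (EuclideanSpace ℝ (Fin (n + m))) P]

/-- The matrix of `Ad g` in the basis `b`. -/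
def adMatrix (b : Module.Basis (Fin m) ℝ (GroupLieAlgebra (𝓡 m) G)) (g : G) :
    Matrix (Fin m) (Fin m) ℝ := fun i j => b.repr (Ad g (b j)) i

theorem repr_Ad_sum (b : Module.Basis (Fin m) ℝ (GroupLieAlgebra (𝓡 m) G)) (g : G)
    (s : Fin m → ℝ) (i : Fin m) :
    b.repr (Ad g (∑ j, s j • b j)) i = ∑ j, adMatrix b g i j * s j := by
  have h : Ad g (∑ j, s j • b j) = ∑ j, s j • Ad g (b j) := by
    change mfderiv (𝓡 m) (𝓡 m) (fun y : G => g * y * g⁻¹) 1 _ = _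
    rw [map_sum]
    exact Finset.sum_congr rfl fun j _ => Ad_smul g (s j) (b j)
  rw [h, map_sum, Finsupp.finsetSum_apply]
  exact Finset.sum_congr rfl fun j _ => by
    rw [map_smul, Finsupp.smul_apply, smul_eq_mul, mul_comm, adMatrix]

theorem adMatrix_mul_inv [LieGroup (𝓡 m) ∞ G]
    (b : Module.Basis (Fin m) ℝ (GroupLieAlgebra (𝓡 m) G)) (g : G) :
    adMatrix b g * adMatrix b g⁻¹ = 1 := by
  ext i k
  rw [Matrix.mul_apply, ← repr_Ad_sum b g (fun j => adMatrix b g⁻¹ j k) i]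
  have h : ∑ j, adMatrix b g⁻¹ j k • b j = Ad g⁻¹ (b k) := b.sum_repr _
  rw [h, Ad_Ad_inv, Matrix.one_apply, b.repr_self, Finsupp.single_apply]
  exact if_congr eq_comm rfl rfl

/-- A coordinate with respect to a basis of the Lie algebra. -/
def coordL (b : Module.Basis (Fin m) ℝ (GroupLieAlgebra (𝓡 m) G)) (i : Fin m) :
    EuclideanSpace ℝ (Fin m) →L[ℝ] ℝ :=
  LinearMap.toContinuousLinearMap (E := EuclideanSpace ℝ (Fin m)) (b.coord i)

theorem contDiffAt_adMatrix [LieGroup (𝓡 m) ∞ G] {E : Type*} [NormedAddCommGroup E]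
    [NormedSpace ℝ E] (b : Module.Basis (Fin m) ℝ (GroupLieAlgebra (𝓡 m) G)) {h : E → G} {x : E}
    (hh : ContMDiffAt 𝓘(ℝ, E) (𝓡 m) ∞ h x) (i j : Fin m) :
    ContDiffAt ℝ ∞ (fun y => adMatrix b (h y) i j) x :=
  (coordL b i).contDiff.contDiffAt.comp x (contDiffAt_Ad hh (b j))

theorem contDiffAt_submodule_mk {E F : Type*} [NormedAddCommGroup E] [NormedSpace ℝ E]
    [NormedAddCommGroup F] [NormedSpace ℝ F] [FiniteDimensional ℝ F] (S : Submodule ℝ F)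
    {f : E → S} {x : E} (hf : ContDiffAt ℝ ∞ (fun y => (f y : F)) x) : ContDiffAt ℝ ∞ f x := by
  obtain ⟨p, hp⟩ := S.subtype.exists_leftInverse_of_injective (by simp)
  have h := p.toContinuousLinearMap.contDiff.contDiffAt.comp x hf
  exact h.congr_of_eventuallyEq (Filter.Eventually.of_forall fun y =>
    (LinearMap.congr_fun hp (f y)).symm)

variable {Q : PrincipalBundle n m X G P}
  (b : Module.Basis (Fin m) ℝ (GroupLieAlgebra (𝓡 m) G))

namespace GaugeChart

theorem changeA_apply (c c' : GaugeChart Q) (x : Base n) (A : Fin m → Fin n → ℝ) (i : Fin m)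
    (μ : Fin n) : changeA b c c' x A i μ =
      ∑ j, adMatrix b (gauge c c' (c.chart.symm x))⁻¹ i j *
        ∑ α, A j α * jac c' c (changeX c c' x) α μ +
      b.repr (maurerCartan c c' x
        (fderiv ℝ (changeX c' c) (changeX c c' x) (EuclideanSpace.single μ 1))) i := by
  rw [← repr_Ad_sum]
  exact DFunLike.congr_fun (map_add b.repr _ _) i

theorem changeP_apply (c c' : GaugeChart Q) (x : Base n) (p : Momenta n m) (i : Fin m)
    (μ ν : Fin n) : changeP b c c' x p i μ ν =
      (jac c c' x).det⁻¹ * ∑ α, ∑ β, ∑ j, jac c c' x μ α * jac c c' x ν β *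
        adMatrix b (gauge c c' (c.chart.symm x)) j i * p j α β := rfl

theorem changeP_add_smul (c c' : GaugeChart Q) (x : Base n) (t : ℝ) (p q : Momenta n m) :
    changeP b c c' x (p + t • q) = changeP b c c' x p + t • changeP b c c' x q := by
  ext i μ ν
  simp only [changeP_apply, Pi.add_apply, Pi.smul_apply, smul_eq_mul, Finset.mul_sum,
    ← Finset.sum_add_distrib]
  refine Finset.sum_congr rfl fun α _ => Finset.sum_congr rfl fun β _ =>
    Finset.sum_congr rfl fun j _ => ?_
  ring

/-- The linear part of the change of the coordinates `A^i_μ`. -/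
def linearA (c c' : GaugeChart Q) (x : Base n) (A : Fin m → Fin n → ℝ) : Fin m → Fin n → ℝ :=
  fun i μ => ∑ j, adMatrix b (gauge c c' (c.chart.symm x))⁻¹ i j *
    ∑ α, A j α * jac c' c (changeX c c' x) α μ

theorem changeA_add_smul (c c' : GaugeChart Q) (x : Base n) (t : ℝ) (A B : Fin m → Fin n → ℝ) :
    changeA b c c' x (A + t • B) = changeA b c c' x A + t • linearA b c c' x B := by
  ext i μ
  simp only [changeA_apply, linearA, Pi.add_apply, Pi.smul_apply, smul_eq_mul, add_mul,
    Finset.sum_add_distrib, mul_add, Finset.mul_sum, mul_assoc, mul_left_comm t]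
  ring

/-- The linear part of the change of coordinates on the fibres of `N` over `X`. -/
def linearPart (c c' : GaugeChart Q) (x : Base n) (v : Constr n m) : Constr n m :=
  (0, linearA b c c' x v.2.1, ⟨changeP b c c' x v.2.2.1, changeP_mem b c c' x v.2.2.2⟩)

/-- Along a fibre x is fixed and the change of coordinates is affine, since the inhomogeneous term
h⁻¹ dh depends on x only. -/
theorem transition_add_smul (c c' : GaugeChart Q) (z : Constr n m) (t : ℝ) {v : Constr n m}
    (hv : v.1 = 0) :
    transition b c c' (z + t • v) = transition b c c' z + t • linearPart b c c' z.1 v := by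
  have h0 : (z + t • v).1 = z.1 := by simp [hv]
  refine Prod.ext ?_ (Prod.ext ?_ (Subtype.ext ?_))
  · change changeX c c' (z + t • v).1 = changeX c c' z.1 + t • (0 : Base n)
    rw [h0, smul_zero, add_zero]
  · change changeA b c c' (z + t • v).1 (z.2.1 + t • v.2.1) = _
    rw [h0, changeA_add_smul]
    rfl
  · change changeP b c c' (z + t • v).1 (z.2.2.1 + t • v.2.2.1) = _
    rw [h0, changeP_add_smul]
    rfl

variable [LieGroup (𝓡 m) ∞ G] [IsManifold (𝓡 n) ∞ X]

theorem contDiffAt_transition {c c' : GaugeChart Q} {z : Constr n m} (hz : z.1 ∈ overlap c c') :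
    ContDiffAt ℝ ∞ (transition b c c') z := by
  have hx' := changeX_mem_overlap hz
  have hfst : ContDiffAt ℝ ∞ (fun y : Constr n m => y.1) z := contDiffAt_fst
  have hgauge := contMDiffAt_gauge_symm hz
  have hjac : ∀ μ α, ContDiffAt ℝ ∞ (fun y : Constr n m => jac c c' y.1 μ α) z := fun μ α =>
    (contDiffAt_jac hz μ α).comp z hfst
  refine ContDiffAt.prodMk ((contDiffAt_changeX hz).comp z hfst) (ContDiffAt.prodMk ?_ ?_)
  · refine contDiffAt_pi.mpr fun i => contDiffAt_pi.mpr fun μ => ?_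
    simp only [changeA_apply]
    refine ContDiffAt.add (ContDiffAt.sum fun j _ => ContDiffAt.mul ?_
      (ContDiffAt.sum fun α _ => ContDiffAt.mul ?_ ?_)) ?_
    · exact (contDiffAt_adMatrix b hgauge.inv i j).comp z hfst
    · exact (contDiff_apply_apply ℝ ℝ j α).contDiffAt.comp z
        (contDiffAt_fst.comp z contDiffAt_snd)
    · exact (((contDiffAt_jac hx' α μ).comp z.1 (contDiffAt_changeX hz))).comp z hfst
    · have h1 : ContDiffAt ℝ ∞ (fderiv ℝ (changeX c' c)) (changeX c c' z.1) :=
        (contDiffAt_changeX hx').fderiv_right (by simp)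
      have h2 : ContDiffAt ℝ ∞ (fun x => fderiv ℝ (changeX c' c) (changeX c c' x)
          (EuclideanSpace.single μ (1 : ℝ))) z.1 :=
        (h1.comp z.1 (contDiffAt_changeX hz)).clm_apply contDiffAt_const
      have h3 := contDiffAt_logDeriv (G := G) (m := m) (x := z.1)
        (h := fun u => gauge c c' (c.chart.symm u)) (by
          filter_upwards [(isOpen_overlap c c').mem_nhds hz] with y hy
          exact contMDiffAt_gauge_symm hy) h2
      exact ((coordL b i).contDiff.contDiffAt.comp z.1 h3).comp z hfst
  · refine contDiffAt_submodule_mk _ (contDiffAt_pi.mpr fun i => contDiffAt_pi.mpr fun μ =>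
      contDiffAt_pi.mpr fun ν => ?_)
    simp only [changeP_apply]
    refine ((contDiffAt_inv_det_jac hz).comp z hfst).mul (ContDiffAt.sum fun α _ =>
      ContDiffAt.sum fun β _ => ContDiffAt.sum fun j _ => ContDiffAt.mul (((hjac μ α).mul
        (hjac ν β)).mul ((contDiffAt_adMatrix b hgauge j i).comp z hfst)) ?_)
    have h4 : ContDiffAt ℝ ∞ (fun y : Constr n m => (y.2.2 : Momenta n m)) z :=
      (skewMomenta n m).subtypeL.contDiff.contDiffAt.comp z
        (contDiffAt_snd.comp z contDiffAt_snd)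
    exact contDiffAt_pi.mp (contDiffAt_pi.mp (contDiffAt_pi.mp h4 j) α) β

theorem fderiv_transition_fst {c c' : GaugeChart Q} {z : Constr n m} (hz : z.1 ∈ overlap c c')
    (v : Constr n m) (μ : Fin n) :
    (fderiv ℝ (transition b c c') z v).1 μ = ∑ α, jac c c' z.1 μ α * v.1 α := by
  have h1 := ((contDiffAt_transition b hz).differentiableAt (by simp)).hasFDerivAt.fst
  have h2 : HasFDerivAt (fun y : Constr n m => changeX c c' y.1) _ z :=
    ((contDiffAt_changeX hz).differentiableAt (by simp)).hasFDerivAt.comp z hasFDerivAt_fst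
  have h3 := DFunLike.congr_fun (h1.unique h2) v
  rw [← fderiv_changeX_apply]
  exact congrArg (fun x : Base n => x μ) h3

theorem fderiv_transition_vertical {c c' : GaugeChart Q} {z : Constr n m}
    (hz : z.1 ∈ overlap c c') {v : Constr n m} (hv : v.1 = 0) :
    fderiv ℝ (transition b c c') z v = linearPart b c c' z.1 v := by
  rw [← ((contDiffAt_transition b hz).differentiableAt (by simp)).lineDeriv_eq_fderiv, lineDeriv]
  have h : (fun t : ℝ => transition b c c' (z + t • v)) =
      fun t => transition b c c' z + t • linearPart b c c' z.1 v :=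
    funext fun t => transition_add_smul b c c' z t hv
  rw [h, deriv_const_add]
  exact ((hasDerivAt_id' (0 : ℝ)).smul_const (linearPart b c c' z.1 v)).deriv.trans (one_smul _ _)

end GaugeChart

end Transition

/-! ## Invariance of the sharp relation under changes of coordinates -/

/-- The transformed pairing is, up to invertible factors, the original one, so vanishing is detected
by test vectors. -/
theorem eq_zero_of_transformed_eq_zero {n m : ℕ} {J w : Matrix (Fin n) (Fin n) ℝ} (hJ : J * w = 1)
    {R R' : Matrix (Fin m) (Fin m) ℝ} (hR : R * R' = 1) {p : Momenta n m} {a : Fin m → Fin n → ℝ}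
    (hp : ∀ i μ ν, J.det⁻¹ * ∑ α, ∑ β, ∑ j, J μ α * J ν β * R j i * p j α β = 0)
    (ha : ∀ i μ, ∑ j, R' i j * ∑ α, a j α * w α μ = 0) : p = 0 ∧ a = 0 := by
  have hdet : J.det⁻¹ ≠ 0 := inv_ne_zero fun h => by
    have := congrArg Matrix.det hJ
    rw [Matrix.det_mul, h, zero_mul, Matrix.det_one] at this
    exact zero_ne_one this
  constructor
  · funext i μ
    have h1 : J.mulVec (p i μ) = 0 := by
      funext ν
      have h2 := sum_transformed_pairing hJ hR p (Pi.single i (Pi.single μ 1)) ν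
      simp only [hp, zero_mul, Finset.sum_const_zero] at h2
      have h3 := (mul_eq_zero.mp h2.symm).resolve_left hdet
      rw [Pi.zero_apply, ← h3, Matrix.mulVec, dotProduct]
      refine Finset.sum_congr rfl fun β _ => ?_
      rw [Finset.sum_eq_single i (fun j _ hj => by simp [hj]) (by simp),
        Finset.sum_eq_single μ (fun j _ hj => by simp [hj]) (by simp)]
      simp
    have h2 := congrArg w.mulVec h1
    rwa [Matrix.mulVec_mulVec, mul_eq_one_comm.mp hJ, Matrix.one_mulVec, Matrix.mulVec_zero] at h2
  · funext i μ
    -- These test momenta are column μ of `w`; paired with row μ of `J` they give 1 and isolate `a i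
    -- μ`.
    have h2 := sum_transformed_pairing hJ hR
      (Pi.single i (Pi.single μ fun β => w β μ)) a μ
    simp only [ha, mul_zero, Finset.sum_const_zero] at h2
    have h3 := (mul_eq_zero.mp h2.symm).resolve_left hdet
    have h4 : ∀ β, ∑ j, ∑ ν, (Pi.single i (Pi.single μ fun β => w β μ) : Momenta n m) j ν β *
        a j ν = w β μ * a i μ := fun β => by
      rw [Finset.sum_eq_single i (fun j _ hj => by simp [hj]) (by simp),
        Finset.sum_eq_single μ (fun j _ hj => by simp [hj]) (by simp)]
      simp
    simp only [h4, ← mul_assoc, ← Finset.sum_mul] at h3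
    have h5 := congrFun (congrFun hJ μ) μ
    rw [Matrix.mul_apply, Matrix.one_apply_eq] at h5
    rwa [h5, one_mul] at h3

section Transition

variable {n m : ℕ} {X G P : Type*}
  [TopologicalSpace X] [ChartedSpace (EuclideanSpace ℝ (Fin n)) X]
  [TopologicalSpace G] [ChartedSpace (EuclideanSpace ℝ (Fin m)) G] [Group G]
  [TopologicalSpace P] [ChartedSpace (EuclideanSpace ℝ (Fin (n + m))) P]
  {Q : PrincipalBundle n m X G P} [LieGroup (𝓡 m) ∞ G]
  (b : Module.Basis (Fin m) ℝ (GroupLieAlgebra (𝓡 m) G))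

namespace GaugeChart

/-- Each ω^ν is a difference of two pairings of momenta with potentials, to which
`sum_transformed_pairing` applies. -/
theorem omega_linearPart {c c' : GaugeChart Q} {x : Base n} (hx : x ∈ overlap c c') (ν : Fin n)
    (Y v : Constr n m) :
    (model n m).omega ν (linearPart b c c' x Y) (linearPart b c c' x v) =
      (jac c c' x).det⁻¹ * ∑ β, jac c c' x ν β * (model n m).omega β Y v := by
  have key := sum_transformed_pairing (jac_mul_jac hx)
    (adMatrix_mul_inv b (gauge c c' (c.chart.symm x)))
  have h1 := key v.2.2.1 Y.2.1 ν
  have h2 := key Y.2.2.1 v.2.1 ν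
  have h3 : (model n m).omega ν (linearPart b c c' x Y) (linearPart b c c' x v) =
      ∑ i, ∑ μ, (changeP b c c' x v.2.2.1 i μ ν * linearA b c c' x Y.2.1 i μ) -
        ∑ i, ∑ μ, (changeP b c c' x Y.2.2.1 i μ ν * linearA b c c' x v.2.1 i μ) := by
    rw [model_omega]
    simp only [← Finset.sum_sub_distrib]
    exact Finset.sum_congr rfl fun i _ => Finset.sum_congr rfl fun μ _ =>
      congrArg₂ _ (mul_comm _ _) (mul_comm _ _)
  rw [h3]
  refine (congrArg₂ _ h1 h2).trans ?_
  rw [← mul_sub, ← Finset.sum_sub_distrib]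
  congr 1
  refine Finset.sum_congr rfl fun β _ => ?_
  rw [← mul_sub, ← Finset.sum_sub_distrib, model_omega]
  congr 1
  refine Finset.sum_congr rfl fun i _ => ?_
  rw [← Finset.sum_sub_distrib]
  exact Finset.sum_congr rfl fun μ _ => by ring

variable [IsManifold (𝓡 n) ∞ X]

theorem fderiv_transition_injective {c c' : GaugeChart Q} {z : Constr n m}
    (hz : z.1 ∈ overlap c c') : Function.Injective (fderiv ℝ (transition b c c') z) := by
  rw [injective_iff_map_eq_zero]
  intro v hv
  have h1 : v.1 = 0 := by
    have h2 : (jac c c' z.1).mulVec v.1 = 0 := by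
      funext μ
      have h3 := fderiv_transition_fst b hz v μ
      rw [hv] at h3
      exact h3.symm
    have h3 := congrArg (jac c' c (changeX c c' z.1)).mulVec h2
    rw [Matrix.mulVec_mulVec, mul_eq_one_comm.mp (jac_mul_jac hz), Matrix.one_mulVec,
      Matrix.mulVec_zero] at h3
    ext μ
    exact congrFun h3 μ
  rw [fderiv_transition_vertical b hz h1] at hv
  have h2 := eq_zero_of_transformed_eq_zero (jac_mul_jac hz)
    (adMatrix_mul_inv b (gauge c c' (c.chart.symm z.1))) (p := v.2.2.1) (a := v.2.1)
    (fun i μ ν => congrFun (congrFun (congrFun (congrArg (fun y : Constr n m => y.2.2.1) hv) i)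
      μ) ν)
    (fun i μ => congrFun (congrFun (congrArg (fun y : Constr n m => y.2.1) hv) i) μ)
  exact Prod.ext h1 (Prod.ext h2.2 (Subtype.ext h2.1))

/-- The differential of a change of coordinates as an isomorphism. -/
def transitionEquiv {c c' : GaugeChart Q} {z : Constr n m} (hz : z.1 ∈ overlap c c') :
    Constr n m ≃ₗ[ℝ] Constr n m :=
  LinearEquiv.ofInjectiveEndo (fderiv ℝ (transition b c c') z).toLinearMap
    (fderiv_transition_injective b hz)

theorem map_mem_sharpRel {c c' : GaugeChart Q} {z : Constr n m} (hz : z.1 ∈ overlap c c') {a : ℕ}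
    {s : ExtDual (Constr n m) × ExteriorAlgebra ℝ (Constr n m)}
    (hs : s ∈ (model n m).sharpRel a) :
    (pullForm (transitionEquiv b hz).toLinearMap s.1,
      ExteriorAlgebra.map (transitionEquiv b hz).symm.toLinearMap s.2) ∈
      (model n m).sharpRel a := by
  refine PolyModel.map_mem_sharpRel (jac_mul_jac hz)
    (fun μ v => fderiv_transition_fst b hz v μ) (fun ν Y hY v hv => ?_) hs
  have h := omega_linearPart b hz ν Y v
  rw [← fderiv_transition_vertical b hz (mem_model_vertical.mp hY),
    ← fderiv_transition_vertical b hz (mem_model_vertical.mp hv)] at h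
  exact h

/-- The exterior derivatives of the local expressions of a form on `N` are related by pullback. -/
theorem extDeriv_eq_pullback {k : ℕ} (η : Form Q b k) {c c' : GaugeChart Q} {z : Constr n m}
    (hz : z.1 ∈ overlap c c') :
    extDeriv (η.1 c) z = (extDeriv (η.1 c') (transition b c c' z)).compContinuousLinearMap
      (fderiv ℝ (transition b c c') z) := by
  have hz' := changeX_mem_overlap hz
  have h1 : η.1 c =ᶠ[nhds z] fun y => (η.1 c' (transition b c c' y)).compContinuousLinearMap
      (fderiv ℝ (transition b c c') y) := by
    filter_upwards [((isOpen_overlap c c').preimage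
      (continuous_fst : Continuous (Prod.fst : Constr n m → Base n))).mem_nhds hz] with y hy
    have hy' := mem_overlap.mp hy
    exact η.2.2.2 c c' y hy'.1 hy'.2
  rw [h1.extDeriv_eq]
  refine extDeriv_pullback (r := ∞) ?_ (contDiffAt_transition b hz)
    (by simpa using ENat.LEInfty.out)
  exact ((η.2.1 c').contDiffAt (c'.isOpen_dom.mem_nhds (mem_overlap.mp hz').1)).differentiableAt
    (by simp)

end GaugeChart

end Transition

/-! ## The bracket of special Hamiltonian forms -/

section Bracket

variable {n m : ℕ} {X G P : Type*}
  [TopologicalSpace X] [ChartedSpace (EuclideanSpace ℝ (Fin n)) X]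
  [TopologicalSpace G] [ChartedSpace (EuclideanSpace ℝ (Fin m)) G] [Group G]
  [TopologicalSpace P] [ChartedSpace (EuclideanSpace ℝ (Fin (n + m))) P]
  {Q : PrincipalBundle n m X G P}

theorem IsBracket.eq (hn : 1 ≤ n) {r s d : ℕ} (hr : r ≤ n - 1) (hs : s ≤ n - 1)
    (hd : r + s = d + (n - 1))
    {α : GaugeChart Q → Constr n m → Constr n m [⋀^Fin r]→L[ℝ] ℝ}
    {β : GaugeChart Q → Constr n m → Constr n m [⋀^Fin s]→L[ℝ] ℝ}
    {γ γ' : GaugeChart Q → Constr n m → Constr n m [⋀^Fin d]→L[ℝ] ℝ}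
    (hα : IsHamiltonian α) (h : IsBracket α β γ) (h' : IsBracket α β γ') (c : GaugeChart Q)
    {z : Constr n m} (hz : z ∈ c.dom) : γ c z = γ' c z := by
  obtain ⟨V, hV, h1⟩ := h c z hz
  obtain ⟨V', hV', h2⟩ := h' c z hz
  refine ContinuousAlternatingMap.toAlternatingMap_injective ?_
  rw [h1, h2, contract_eq_of_diracGraph hn (mem_sharpGraphN_iff hn) (by omega) (by omega) hd hV hV'
    (hα.2 c z hz)]

/-- The local expressions of the bracket, for a choice of representatives of the sharp map. -/
def bracketFamily (S : (model n m).Selector) {r s : ℕ} (k d : ℕ)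
    (α : GaugeChart Q → Constr n m → Constr n m [⋀^Fin r]→L[ℝ] ℝ)
    (β : GaugeChart Q → Constr n m → Constr n m [⋀^Fin s]→L[ℝ] ℝ) :
    GaugeChart Q → Constr n m → Constr n m [⋀^Fin d]→L[ℝ] ℝ :=
  fun c => Set.indicator c.dom fun z =>
    -- The factorial normalises `multivector` to a representative of ♯(dβ); for k = n-1-s the power
    -- of -1 is the sign in the bracket.
    S.bracketForm k (r + 1) (s + 1) d ((-1) ^ k * ((k + 1).factorial : ℝ)⁻¹)
      (extDeriv (α c) z) (extDeriv (β c) z)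

variable (S : (model n m).Selector) {r s k d : ℕ}
  {α : GaugeChart Q → Constr n m → Constr n m [⋀^Fin r]→L[ℝ] ℝ}
  {β : GaugeChart Q → Constr n m → Constr n m [⋀^Fin s]→L[ℝ] ℝ}

theorem bracketFamily_of_mem (k d : ℕ) (c : GaugeChart Q) {z : Constr n m} (hz : z ∈ c.dom) :
    bracketFamily S k d α β c z =
      S.bracketForm k (r + 1) (s + 1) d ((-1) ^ k * ((k + 1).factorial : ℝ)⁻¹)
        (extDeriv (α c) z) (extDeriv (β c) z) :=
  Set.indicator_of_mem hz _

theorem bracketFamily_of_notMem (k d : ℕ) (c : GaugeChart Q) {z : Constr n m} (hz : z ∉ c.dom) :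
    bracketFamily S k d α β c z = 0 :=
  Set.indicator_of_notMem hz _

theorem bracketFamily_toAlternatingMap (k d : ℕ) (c : GaugeChart Q) {z : Constr n m}
    (hz : z ∈ c.dom) : (bracketFamily S k d α β c z).toAlternatingMap =
      (-1 : ℝ) ^ k • contract d
        (((k + 1).factorial : ℝ)⁻¹ • S.multivector k (ev (s + 1) (extDeriv (β c) z)))
        (extDeriv (α c) z).toAlternatingMap := by
  rw [bracketFamily_of_mem S k d c hz, PolyModel.Selector.bracketForm_toAlternatingMap,
    contract_smul, smul_smul]

theorem contDiffOn_bracketFamily (hsα : ∀ c, ContDiffOn ℝ ∞ (α c) c.dom)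
    (hsβ : ∀ c, ContDiffOn ℝ ∞ (β c) c.dom) (c : GaugeChart Q) :
    ContDiffOn ℝ ∞ (bracketFamily S k d α β c) c.dom :=
  (S.contDiffOn_bracketForm c.isOpen_dom (hsα c) (hsβ c) _).congr fun _ hz =>
    bracketFamily_of_mem S k d c hz

variable [IsManifold (𝓡 n) ∞ X] [T2Space X]

theorem bracketFamily_mem_sharpRel (hn : 1 ≤ n) (hk : s + 1 + k = n)
    (hβ : IsSpecialHamiltonian β) (hsβ : ∀ c, ContDiffOn ℝ ∞ (β c) c.dom) (c : GaugeChart Q)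
    {z : Constr n m} (hz : z ∈ c.dom) :
    (evalForm (extDeriv (β c) z).toAlternatingMap,
      ((k + 1).factorial : ℝ)⁻¹ • S.multivector k (ev (s + 1) (extDeriv (β c) z))) ∈
      (model n m).sharpRel (s + 1) :=
  (hβ.isSpecial hn hk c (hsβ c) hz).mem_sharpRel S hk (ev_hasDegree _)

theorem isBracket_bracketFamily (hn : 1 ≤ n) (hk : s + 1 + k = n)
    (hβ : IsSpecialHamiltonian β) (hsβ : ∀ c, ContDiffOn ℝ ∞ (β c) c.dom) :
    IsBracket α β (bracketFamily S k d α β) := fun c z hz => by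
  refine ⟨_, mem_diracGraph hn (mem_sharpGraphN_iff hn) (by omega)
    (bracketFamily_mem_sharpRel S hn hk hβ hsβ c hz), ?_⟩
  rw [bracketFamily_toAlternatingMap S k d c hz, show n - 1 - s = k by omega]

theorem isSpecialHamiltonian_bracketFamily (hn : 1 ≤ n) {j : ℕ} (hj : r + 1 + j = n)
    (hk : s + 1 + k = n) (hd : k + 1 + d = r + 1)
    (hα : IsSpecialHamiltonian α) (hsα : ∀ c, ContDiffOn ℝ ∞ (α c) c.dom)
    (hβ : IsSpecialHamiltonian β) (hsβ : ∀ c, ContDiffOn ℝ ∞ (β c) c.dom) :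
    IsSpecialHamiltonian (bracketFamily S k d α β) := by
  refine isSpecialHamiltonian_of_isSpecial hn (k := j + k) (by omega)
    (contDiffOn_bracketFamily S hsα hsβ) (fun c z hz => ?_) fun c z hz => ?_
  · rw [bracketFamily_of_mem S k d c hz]
    exact S.isHor_bracketForm hd (hα.isSpecial hn hj c (hsα c) hz) _ _
  · have h : bracketFamily S k d α β c =ᶠ[nhds z] fun y =>
        S.bracketForm k (r + 1) (s + 1) d ((-1) ^ k * ((k + 1).factorial : ℝ)⁻¹)
          (extDeriv (α c) y) (extDeriv (β c) y) := by
      filter_upwards [c.isOpen_dom.mem_nhds hz] with y hy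
        using bracketFamily_of_mem S k d c hy
    rw [h.extDeriv_eq]
    exact S.isSpecial_extDeriv_bracketForm hj hd c.isOpen_dom (hsα c) (hsβ c)
      (fun y hy => hα.isSpecial hn hj c (hsα c) hy)
      (fun y hy => hβ.isSpecial hn hk c (hsβ c) hy) _ hz

variable [LieGroup (𝓡 m) ∞ G] (b : Module.Basis (Fin m) ℝ (GroupLieAlgebra (𝓡 m) G))

/-- The multivectors chosen in two gauge charts need not correspond. After transport both represent
♯(dβ), however, and contraction with dα does not see the difference. -/
theorem bracketFamily_mem_form (hn : 1 ≤ n) (hk : s + 1 + k = n) (hd : k + 1 + d = r + 1)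
    (α : Form Q b r) (β : Form Q b s) (hα : IsHamiltonian α.1) (hβ : IsSpecialHamiltonian β.1) :
    bracketFamily S k d α.1 β.1 ∈ Form Q b d := by
  refine ⟨contDiffOn_bracketFamily S α.2.1 β.2.1, fun c _ hz => bracketFamily_of_notMem S k d c hz,
    fun c c' z hz hz' => ?_⟩
  have ho : z.1 ∈ GaugeChart.overlap c c' := GaugeChart.mem_overlap.mpr ⟨hz, hz'⟩
  have hT : GaugeChart.transition b c c' z ∈ c'.dom :=
    (GaugeChart.mem_overlap.mp (GaugeChart.changeX_mem_overlap ho)).1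
  refine ContinuousAlternatingMap.toAlternatingMap_injective ?_
  have hdβ := GaugeChart.extDeriv_eq_pullback b β ho
  have hdα := GaugeChart.extDeriv_eq_pullback b α ho
  have h1 := mem_diracGraph hn (mem_sharpGraphN_iff hn) (by omega)
    (bracketFamily_mem_sharpRel S hn hk hβ β.2.1 c hz)
  have h2 := GaugeChart.map_mem_sharpRel b ho
    (bracketFamily_mem_sharpRel S hn hk hβ β.2.1 c' hT)
  rw [← evalForm_compLinearMap] at h2
  have h3 := mem_diracGraph hn (mem_sharpGraphN_iff hn) (by omega) h2
  have h4 : (extDeriv (β.1 c) z).toAlternatingMap =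
      (extDeriv (β.1 c') (GaugeChart.transition b c c' z)).toAlternatingMap.compLinearMap
        (GaugeChart.transitionEquiv b ho).toLinearMap := by
    rw [hdβ]
    rfl
  have h5 : (extDeriv (α.1 c) z).toAlternatingMap =
      (extDeriv (α.1 c') (GaugeChart.transition b c c' z)).toAlternatingMap.compLinearMap
        (GaugeChart.transitionEquiv b ho).toLinearMap := by
    rw [hdα]
    rfl
  rw [← h4] at h3
  rw [bracketFamily_toAlternatingMap S k d c hz, contract_eq_of_diracGraph hn
    (mem_sharpGraphN_iff hn) hα.1 (by omega) (by omega) h1 h3 (hα.2 c z hz), h5,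
    contract_map_symm]
  have h6 := congrArg (fun η : Constr n m [⋀^Fin d]→ₗ[ℝ] ℝ => η.compLinearMap
    (GaugeChart.transitionEquiv b ho).toLinearMap)
    (bracketFamily_toAlternatingMap (α := α.1) (β := β.1) S k d c' hT)
  exact h6.symm

/-- The bracket of special Hamiltonian forms exists, is unique, and is special Hamiltonian. -/
theorem exists_bracket (hn : 1 ≤ n) (hr : r ≤ n - 1) (hs : s ≤ n - 1) (hd : r + s = d + (n - 1))
    (α : Form Q b r) (β : Form Q b s) (hα : IsSpecialHamiltonian α.1)
    (hβ : IsSpecialHamiltonian β.1) :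
    ∃ γ : Form Q b d, IsBracket α.1 β.1 γ.1 ∧ IsSpecialHamiltonian γ.1 ∧
      ∀ γ' : Form Q b d, IsBracket α.1 β.1 γ'.1 → γ' = γ := by
  obtain ⟨S⟩ := (model n m).nonempty_selector
  obtain ⟨k, hk⟩ : ∃ k, s + 1 + k = n := ⟨n - (s + 1), by omega⟩
  obtain ⟨j, hj⟩ : ∃ j, r + 1 + j = n := ⟨n - (r + 1), by omega⟩
  have hb := isBracket_bracketFamily (α := α.1) (d := d) S hn hk hβ β.2.1
  refine ⟨⟨_, bracketFamily_mem_form S b hn hk (by omega) α β hα.1 hβ⟩, hb,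
    isSpecialHamiltonian_bracketFamily S hn hj hk (by omega) hα α.2.1 hβ β.2.1,
    fun γ' hγ' => Subtype.ext (funext fun c => funext fun z => ?_)⟩
  by_cases hz : z ∈ c.dom
  · exact IsBracket.eq hn hr hs hd hα.1 hγ' hb c hz
  · exact (γ'.2.2.1 c z hz).trans (bracketFamily_of_notMem S k d c hz).symm

end Bracket

/-! ## The image of the Legendre transformation -/

theorem det_ne_zero_of_mulVec {ι : Type*} [Fintype ι] [DecidableEq ι] {A : Matrix ι ι ℝ}
    (h : ∀ v, A.mulVec v = 0 → v = 0) : A.det ≠ 0 := fun h0 => by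
  obtain ⟨v, hv, hv'⟩ := Matrix.exists_mulVec_eq_zero_iff.mpr h0
  exact hv (h v hv')

section Legendre

variable {n m : ℕ} {X G P : Type*}
  [TopologicalSpace X] [ChartedSpace (EuclideanSpace ℝ (Fin n)) X]
  [TopologicalSpace G] [ChartedSpace (EuclideanSpace ℝ (Fin m)) G] [Group G]
  [TopologicalSpace P] [ChartedSpace (EuclideanSpace ℝ (Fin (n + m))) P]
  {Q : PrincipalBundle n m X G P}

theorem PseudoMetric.matrix_isSymm (g : PseudoMetric n X)
    (e : OpenPartialHomeomorph X (EuclideanSpace ℝ (Fin n))) (x : Base n) :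
    (g.matrix e x).IsSymm := by
  ext μ ν
  exact g.symm _ _ _

/-- The differential of the inverse chart is an isomorphism, so a kernel vector of the matrix would
give a tangent vector orthogonal to the whole tangent space. -/
theorem PseudoMetric.det_matrix_ne_zero [IsManifold (𝓡 n) ∞ X] (g : PseudoMetric n X)
    {e : OpenPartialHomeomorph X (EuclideanSpace ℝ (Fin n))}
    (he : e ∈ IsManifold.maximalAtlas (𝓡 n) ∞ X) {x : Base n} (hx : x ∈ e.target) :
    (g.matrix e x).det ≠ 0 := by
  have hd : e.MDifferentiable (𝓡 n) (𝓡 n) :=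
    ⟨(contMDiffOn_of_mem_maximalAtlas he).mdifferentiableOn (by simp),
      (contMDiffOn_symm_of_mem_maximalAtlas he).mdifferentiableOn (by simp)⟩
  refine det_ne_zero_of_mulVec fun v hv => ?_
  obtain ⟨D, hD⟩ : ∃ D : Base n →L[ℝ] TangentSpace (𝓡 n) (e.symm x),
      D = mfderiv (𝓡 n) (𝓡 n) e.symm x := ⟨_, rfl⟩
  have h1 : ∀ μ ν, g.matrix e x μ ν = g.toFun (e.symm x) (D (EuclideanSpace.single μ 1))
      (D (EuclideanSpace.single ν 1)) := fun μ ν => by rw [hD]; rfl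
  have hs : ∀ w : Base n, w = ∑ α, w α • EuclideanSpace.single α (1 : ℝ) := fun w => by
    ext β
    simp [Finset.sum_apply, Pi.single_apply]
  obtain ⟨V, hV⟩ : ∃ V : Base n, ∀ α, V α = v α := ⟨WithLp.toLp 2 v, fun _ => rfl⟩
  have h2 : ∀ μ, g.toFun (e.symm x) (D (EuclideanSpace.single μ 1)) (D V) = 0 := fun μ => by
    rw [hs V, map_sum, map_sum]
    refine Eq.trans (Finset.sum_congr rfl fun ν _ => ?_) (congrFun hv μ)
    rw [map_smul, map_smul, hV]
    exact (congrArg (fun t : ℝ => v ν * t) (h1 μ ν).symm).trans (mul_comm _ _)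
  have h3 : ∀ w, g.toFun (e.symm x) (D w) (D V) = 0 := fun w => by
    rw [hs w, map_sum, map_sum, sum_apply]
    refine Finset.sum_eq_zero fun μ _ => ?_
    rw [map_smul, map_smul, smul_apply, h2, smul_zero]
  have hx' := e.map_target hx
  have h4 : D V = 0 := by
    refine g.nondegenerate _ _ fun w => ?_
    rw [g.symm]
    have h5 := DFunLike.congr_fun (hd.symm_comp_deriv hx') w
    rw [e.right_inv hx, ← hD] at h5
    have h6 := h3 (mfderiv (𝓡 n) (𝓡 n) e (e.symm x) w)
    rwa [show D (mfderiv (𝓡 n) (𝓡 n) e (e.symm x) w) = w from h5] at h6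
  have h5 := DFunLike.congr_fun (hd.comp_symm_deriv hx) V
  rw [← hD] at h5
  have h6 : V = 0 := h5.symm.trans ((congrArg (mfderiv (𝓡 n) (𝓡 n) e (e.symm x)) h4).trans
    (map_zero _))
  funext α
  rw [← hV, h6]
  rfl

theorem det_gram_ne_zero {V : Type*} [AddCommGroup V] [Module ℝ V] {κ : V →ₗ[ℝ] V →ₗ[ℝ] ℝ}
    (κ_symm : ∀ ξ η, κ ξ η = κ η ξ) (κ_nondegenerate : ∀ ξ, (∀ η, κ ξ η = 0) → ξ = 0)
    (b : Module.Basis (Fin m) ℝ V) :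
    (Matrix.of fun i j => κ (b i) (b j)).det ≠ 0 := by
  refine det_ne_zero_of_mulVec fun v hv => ?_
  obtain ⟨ξ, hξ⟩ : ∃ ξ, ξ = ∑ j, v j • b j := ⟨_, rfl⟩
  have h1 : ∀ i, κ (b i) ξ = 0 := fun i => by
    rw [hξ, map_sum]
    refine Eq.trans (Finset.sum_congr rfl fun j _ => ?_) (congrFun hv i)
    rw [map_smul, smul_eq_mul, mul_comm]
    rfl
  have h2 : ξ = 0 := by
    refine κ_nondegenerate _ fun η => ?_
    rw [κ_symm, ← b.sum_repr η, map_sum, LinearMap.sum_apply]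
    exact Finset.sum_eq_zero fun i _ => by rw [map_smul, LinearMap.smul_apply, h1, smul_zero]
  funext j
  exact Fintype.linearIndependent_iff.mp b.linearIndependent v (hξ.symm.trans h2) j

/-- The indices of the coordinates `A^i_{μ,ν}`. -/
abbrev JetIndex (n m : ℕ) : Type := Fin m × Fin n × Fin n

/-- The involution of the indices that exchanges `μ` and `ν`. -/
def swapIndex (n m : ℕ) : JetIndex n m ≃ JetIndex n m :=
  (Equiv.refl _).prodCongr (Equiv.prodComm _ _)

theorem sum_jetIndex (f : Fin m → Fin m → Fin n → Fin n → Fin n → Fin n → ℝ) :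
    ∑ i, ∑ j, ∑ μ, ∑ ν, ∑ α, ∑ β, f i j μ ν α β =
      ∑ x : JetIndex n m, ∑ y : JetIndex n m, f x.1 y.1 x.2.1 x.2.2 y.2.1 y.2.2 := by
  simp only [Fintype.sum_prod_type]
  refine Finset.sum_congr rfl fun i _ => ?_
  rw [Finset.sum_comm]
  refine Finset.sum_congr rfl fun μ _ => ?_
  rw [Finset.sum_comm]

variable (b : Module.Basis (Fin m) ℝ (GroupLieAlgebra (𝓡 m) G)) (g : PseudoMetric n X)
  (κ : GroupLieAlgebra (𝓡 m) G →ₗ[ℝ] GroupLieAlgebra (𝓡 m) G →ₗ[ℝ] ℝ)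

theorem bracket_swap (ξ η : GroupLieAlgebra (𝓡 m) G) : ⁅ξ, η⁆ = -⁅η, ξ⁆ :=
  VectorField.mlieBracket_swap_apply

theorem sum_bracket_swap (A : Fin m → Fin n → ℝ) (i : Fin m) (μ ν : Fin n) :
    ∑ j, ∑ k, b.repr ⁅b j, b k⁆ i * A j μ * A k ν =
      -∑ j, ∑ k, b.repr ⁅b j, b k⁆ i * A j ν * A k μ := by
  rw [Finset.sum_comm, ← Finset.sum_neg_distrib]
  refine Finset.sum_congr rfl fun j _ => ?_
  rw [← Finset.sum_neg_distrib]
  refine Finset.sum_congr rfl fun k _ => ?_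
  have h : b.repr ⁅b k, b j⁆ i = -b.repr ⁅b j, b k⁆ i := by
    rw [bracket_swap (b k), map_neg, Finsupp.neg_apply]
  rw [h]
  ring

/-- The curvature as a function of the indices. -/
def curvatureVec (A : Fin m → Fin n → ℝ) (a : Fin m → Fin n → Fin n → ℝ) (x : JetIndex n m) : ℝ :=
  curvature b A a x.1 x.2.1 x.2.2

/-- The matrix of the quadratic form in the Yang–Mills Lagrangian. -/
def lagrangianMatrix (c : GaugeChart Q) (x : Base n) :
    Matrix (JetIndex n m) (JetIndex n m) ℝ :=
  Matrix.of fun y z => κ (b y.1) (b z.1) *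
    ((g.matrix c.chart x)⁻¹ y.2.1 z.2.1 * (g.matrix c.chart x)⁻¹ y.2.2 z.2.2)

theorem lagrangian_eq (c : GaugeChart Q) (x : Base n) (A : Fin m → Fin n → ℝ)
    (a : Fin m → Fin n → Fin n → ℝ) :
    lagrangian b g κ c x A a = -(1 / 4) * (∑ y, ∑ z, lagrangianMatrix b g κ c x y z *
      (curvatureVec b A a y * curvatureVec b A a z)) * √|(g.matrix c.chart x).det| := by
  rw [lagrangian, sum_jetIndex]
  congr 2
  refine Finset.sum_congr rfl fun y _ => Finset.sum_congr rfl fun z _ => ?_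
  rw [lagrangianMatrix, Matrix.of_apply, curvatureVec, curvatureVec]
  ring

theorem curvatureVec_add_smul (A : Fin m → Fin n → ℝ) (a h : Fin m → Fin n → Fin n → ℝ) (t : ℝ)
    (y : JetIndex n m) : curvatureVec b A (a + t • h) y =
      curvatureVec b A a y + t * (h y.1 y.2.2 y.2.1 - h y.1 y.2.1 y.2.2) := by
  simp only [curvatureVec, curvature, Pi.add_apply, Pi.smul_apply, smul_eq_mul]
  ring

theorem differentiable_lagrangian (c : GaugeChart Q) (x : Base n) (A : Fin m → Fin n → ℝ) :
    Differentiable ℝ (lagrangian b g κ c x A) := by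
  have h : lagrangian b g κ c x A = _ := funext fun a => lagrangian_eq b g κ c x A a
  rw [h]
  have h1 : ∀ y, Differentiable ℝ fun a => curvatureVec b A a y := fun y => by
    simp only [curvatureVec, curvature]
    fun_prop
  fun_prop

/-- Along a line in the jet coordinates the curvature is affine and the Lagrangian quadratic;
symmetry of the matrix merges the two cross terms. -/
theorem fderiv_lagrangian (κ_symm : ∀ ξ η, κ ξ η = κ η ξ) (c : GaugeChart Q) (x : Base n)
    (A : Fin m → Fin n → ℝ) (a h : Fin m → Fin n → Fin n → ℝ) :
    fderiv ℝ (lagrangian b g κ c x A) a h = -(1 / 2) *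
      (∑ y : JetIndex n m, (h y.1 y.2.2 y.2.1 - h y.1 y.2.1 y.2.2) *
        (lagrangianMatrix b g κ c x).mulVec (curvatureVec b A a) y) *
      √|(g.matrix c.chart x).det| := by
  rw [← (differentiable_lagrangian b g κ c x A a).lineDeriv_eq_fderiv, lineDeriv]
  simp only [lagrangian_eq, curvatureVec_add_smul]
  set M := lagrangianMatrix b g κ c x with hM
  set F := curvatureVec b A a
  set δ : JetIndex n m → ℝ := fun y => h y.1 y.2.2 y.2.1 - h y.1 y.2.1 y.2.2
  have hsymm : ∀ y z, M y z = M z y := fun y z => by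
    simp only [hM, lagrangianMatrix, Matrix.of_apply]
    have h1 : (g.matrix c.chart x)⁻¹.IsSymm := (g.matrix_isSymm c.chart x).inv
    rw [κ_symm, h1.apply z.2.1 y.2.1, h1.apply z.2.2 y.2.2]
  have h1 : ∀ y, HasDerivAt (fun t : ℝ => F y + t * δ y) (δ y) 0 := fun y => by
    simpa using ((hasDerivAt_id' (0 : ℝ)).mul_const (δ y)).const_add (F y)
  have h2 := ((HasDerivAt.fun_sum (u := Finset.univ) fun y _ =>
    HasDerivAt.fun_sum (u := Finset.univ) fun z _ =>
      ((h1 y).fun_mul (h1 z)).const_mul (M y z)).const_mul (-(1 / 4))).mul_const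
        √|(g.matrix c.chart x).det|
  refine h2.deriv.trans ?_
  simp only [zero_mul, add_zero, mul_add, Finset.sum_add_distrib]
  have h3 : ∑ y, ∑ z, M y z * (δ y * F z) = ∑ y, δ y * M.mulVec F y := by
    refine Finset.sum_congr rfl fun y _ => ?_
    rw [Matrix.mulVec, dotProduct, Finset.mul_sum]
    exact Finset.sum_congr rfl fun z _ => by ring
  have h4 : ∑ y, ∑ z, M y z * (F y * δ z) = ∑ y, δ y * M.mulVec F y := by
    rw [← h3, Finset.sum_comm]
    exact Finset.sum_congr rfl fun y _ => Finset.sum_congr rfl fun z _ => by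
      rw [hsymm]
      ring
  rw [h3, h4]
  ring

theorem legendre_snd_snd (κ_symm : ∀ ξ η, κ ξ η = κ η ξ) (c : GaugeChart Q) (x : Base n)
    (A : Fin m → Fin n → ℝ) (a : Fin m → Fin n → Fin n → ℝ) (i : Fin m) (μ ν : Fin n) :
    (legendre b g κ c (x, A, a)).2.2 i μ ν = 1 / 2 *
      ((lagrangianMatrix b g κ c x).mulVec (curvatureVec b A a) (i, μ, ν) -
        (lagrangianMatrix b g κ c x).mulVec (curvatureVec b A a) (i, ν, μ)) *
      √|(g.matrix c.chart x).det| := by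
  refine (fderiv_lagrangian b g κ κ_symm c x A a _).trans ?_
  set W := (lagrangianMatrix b g κ c x).mulVec (curvatureVec b A a)
  have h1 : ∀ μ ν : Fin n, ∀ y : JetIndex n m,
      (Pi.single i (Pi.single μ (Pi.single ν 1)) : Momenta n m) y.1 y.2.1 y.2.2 =
        if y = (i, μ, ν) then 1 else 0 := fun μ ν y => by
    obtain ⟨j, α, β⟩ := y
    by_cases hj : j = i
    · subst hj
      by_cases hα : α = μ
      · subst hα
        by_cases hβ : β = ν
        · subst hβ
          simp
        · simp [hβ]
      · simp [hα]
    · simp [hj]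
  have h2 : ∀ y : JetIndex n m,
      (Pi.single i (Pi.single μ (Pi.single ν 1)) : Momenta n m) y.1 y.2.2 y.2.1 =
        if y = (i, ν, μ) then 1 else 0 := fun y => by
    refine (h1 μ ν (swapIndex n m y)).trans (if_congr ?_ rfl rfl)
    exact (swapIndex n m).eq_symm_apply.symm
  simp only [h1, h2, sub_mul, Finset.sum_sub_distrib, ite_mul, one_mul, zero_mul,
    Finset.sum_ite_eq', Finset.mem_univ, if_true]
  ring

theorem exists_curvatureVec_eq (A : Fin m → Fin n → ℝ) {F : JetIndex n m → ℝ}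
    (hF : ∀ y, F (swapIndex n m y) = -F y) : ∃ a, curvatureVec b A a = F := by
  -- The curvature is a_{νμ} - a_{μν} + B_{μν} with B skew, so a = (B - F)/2 yields F.
  refine ⟨fun i μ ν => 1 / 2 * (∑ j, ∑ k, b.repr ⁅b j, b k⁆ i * A j μ * A k ν - F (i, μ, ν)), ?_⟩
  funext y
  obtain ⟨i, μ, ν⟩ := y
  have h1 : F (i, ν, μ) = -F (i, μ, ν) := hF (i, μ, ν)
  simp only [curvatureVec, curvature, h1]
  rw [sum_bracket_swap b A i ν μ]
  ring

-- The matrix is a Kronecker product of the Gram matrix of `κ` with two copies of the inverse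
-- metric. Its inverse is unchanged when μ and ν are exchanged in both rows and columns, so skew
-- momenta have skew preimages.
open Kronecker in
theorem exists_mulVec_eq [IsManifold (𝓡 n) ∞ X] (κ_symm : ∀ ξ η, κ ξ η = κ η ξ)
    (κ_nondegenerate : ∀ ξ, (∀ η, κ ξ η = 0) → ξ = 0) (c : GaugeChart Q) {x : Base n}
    (hx : x ∈ c.chart.target) {p : JetIndex n m → ℝ} (hp : ∀ y, p (swapIndex n m y) = -p y) :
    ∃ F : JetIndex n m → ℝ, (lagrangianMatrix b g κ c x).mulVec F = p ∧
      ∀ y, F (swapIndex n m y) = -F y := by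
  have hg := g.det_matrix_ne_zero c.chart_mem hx
  have hκ := det_gram_ne_zero κ_symm κ_nondegenerate b
  set K : Matrix (Fin m) (Fin m) ℝ := Matrix.of fun i j => κ (b i) (b j)
  set γ := g.matrix c.chart x
  have h1 : lagrangianMatrix b g κ c x = K ⊗ₖ (γ⁻¹ ⊗ₖ γ⁻¹) := rfl
  have h2 : lagrangianMatrix b g κ c x * (K⁻¹ ⊗ₖ (γ ⊗ₖ γ)) = 1 := by
    rw [h1, ← Matrix.mul_kronecker_mul, ← Matrix.mul_kronecker_mul,
      Matrix.mul_nonsing_inv _ (Ne.isUnit hκ), Matrix.nonsing_inv_mul _ (Ne.isUnit hg),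
      Matrix.one_kronecker_one, Matrix.one_kronecker_one]
  refine ⟨(K⁻¹ ⊗ₖ (γ ⊗ₖ γ)).mulVec p, ?_, fun y => ?_⟩
  · rw [Matrix.mulVec_mulVec, h2, Matrix.one_mulVec]
  · simp only [Matrix.mulVec, dotProduct]
    rw [← (swapIndex n m).sum_comp, ← Finset.sum_neg_distrib]
    refine Finset.sum_congr rfl fun z _ => ?_
    rw [hp, mul_neg]
    congr 2
    exact congrArg (fun t : ℝ => K⁻¹ y.1 z.1 * t) (mul_comm (γ y.2.2 z.2.2) (γ y.2.1 z.2.1))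

theorem image_legendre [IsManifold (𝓡 n) ∞ X] (κ_symm : ∀ ξ η, κ ξ η = κ η ξ)
    (κ_nondegenerate : ∀ ξ, (∀ η, κ ξ η = 0) → ξ = 0) (c : GaugeChart Q) :
    legendre b g κ c '' {j | j.1 ∈ c.chart.target} = incl n m '' c.dom := by
  apply Set.Subset.antisymm
  · rintro _ ⟨⟨x, A, a⟩, hx, rfl⟩
    refine ⟨(x, A, ⟨(legendre b g κ c (x, A, a)).2.2, fun i μ ν => ?_⟩), hx, rfl⟩
    rw [legendre_snd_snd b g κ κ_symm, legendre_snd_snd b g κ κ_symm]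
    ring
  · rintro _ ⟨⟨x, A, p⟩, hx, rfl⟩
    have hs : √|(g.matrix c.chart x).det| ≠ 0 :=
      Real.sqrt_ne_zero'.mpr (abs_pos.mpr (g.det_matrix_ne_zero c.chart_mem hx))
    have hp : ∀ i μ ν, p.1 i ν μ = -p.1 i μ ν := fun i μ ν => by
      linarith [p.2 i μ ν]
    -- Dividing by the metric density compensates the factor in `legendre_snd_snd`; on skew momenta
    -- the antisymmetrization there is the identity.
    obtain ⟨F, hF, hF'⟩ := exists_mulVec_eq b g κ κ_symm κ_nondegenerate c hx
      (p := fun y => (√|(g.matrix c.chart x).det|)⁻¹ * p.1 y.1 y.2.1 y.2.2)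
      (fun y => by
        rw [← mul_neg, ← hp]
        rfl)
    obtain ⟨a, ha⟩ := exists_curvatureVec_eq b A hF'
    refine ⟨(x, A, a), hx, Prod.ext rfl (Prod.ext rfl ?_)⟩
    funext i μ ν
    rw [legendre_snd_snd b g κ κ_symm, ha, hF]
    change _ = p.1 i μ ν
    simp only [hp i μ ν]
    field_simp
    ring

end Legendre

/-! ## Linearity of the conditions on Hamiltonian forms -/

theorem contDiffOn_wedge {E : Type*} [NormedAddCommGroup E] [NormedSpace ℝ E]
    [FiniteDimensional ℝ E] {a k : ℕ} {η : E → E [⋀^Fin a]→L[ℝ] ℝ} {ζ : E → E [⋀^Fin k]→L[ℝ] ℝ}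
    {s : Set E} (hη : ContDiffOn ℝ ∞ η s) (hζ : ContDiffOn ℝ ∞ ζ s) :
    ContDiffOn ℝ ∞ (fun z => wedge (η z) (ζ z)) s :=
  contDiffOn_bilinear hη hζ (wedgeC a k)

section Linear

variable {n m : ℕ} {X G P : Type*}
  [TopologicalSpace X] [ChartedSpace (EuclideanSpace ℝ (Fin n)) X]
  [TopologicalSpace G] [ChartedSpace (EuclideanSpace ℝ (Fin m)) G] [Group G]
  [TopologicalSpace P] [ChartedSpace (EuclideanSpace ℝ (Fin (n + m))) P]
  {Q : PrincipalBundle n m X G P} {a : ℕ}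
  {α β : GaugeChart Q → Constr n m → Constr n m [⋀^Fin a]→L[ℝ] ℝ}

/-- Smoothness enters because `extDeriv` is additive only where both summands are differentiable;
scalar multiples need no such condition. -/
theorem IsHamiltonian.add (hα : IsHamiltonian α) (hβ : IsHamiltonian β)
    (hsα : ∀ c, ContDiffOn ℝ ∞ (α c) c.dom) (hsβ : ∀ c, ContDiffOn ℝ ∞ (β c) c.dom) :
    IsHamiltonian (α + β) := by
  refine ⟨hα.1, fun c z hz => ?_⟩
  have hnz := c.isOpen_dom.mem_nhds hz
  have h := extDeriv_add (((hsα c).contDiffAt hnz).differentiableAt (by simp))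
    (((hsβ c).contDiffAt hnz).differentiableAt (by simp))
  rw [Pi.add_apply, h]
  exact add_mem (hα.2 c z hz) (hβ.2 c z hz)

theorem IsHamiltonian.smul (t : ℝ) (hα : IsHamiltonian α) : IsHamiltonian (t • α) := by
  refine ⟨hα.1, fun c z hz => ?_⟩
  rw [Pi.smul_apply, extDeriv_smul]
  exact Submodule.smul_mem _ t (hα.2 c z hz)

theorem contDiffOn_wedge_basic (hsα : ∀ c, ContDiffOn ℝ ∞ (α c) c.dom) {k : ℕ}
    (ε : ClosedForm n X k) (c : GaugeChart Q) :
    ContDiffOn ℝ ∞ (fun z => wedge (α c z) (basic ε c z)) c.dom :=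
  contDiffOn_wedge (hsα c) (contDiffOn_basic ε c)

theorem IsSpecialHamiltonian.add (hα : IsSpecialHamiltonian α) (hβ : IsSpecialHamiltonian β)
    (hsα : ∀ c, ContDiffOn ℝ ∞ (α c) c.dom) (hsβ : ∀ c, ContDiffOn ℝ ∞ (β c) c.dom) :
    IsSpecialHamiltonian (α + β) := by
  refine ⟨hα.1.add hβ.1 hsα hsβ, fun k hk ε => ?_⟩
  have h := (hα.2 k hk ε).add (hβ.2 k hk ε) (contDiffOn_wedge_basic hsα ε)
    (contDiffOn_wedge_basic hsβ ε)
  have h1 : (fun (c : GaugeChart Q) z => wedge ((α + β) c z) (basic ε c z)) =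
      (fun c z => wedge (α c z) (basic ε c z)) + fun c z => wedge (β c z) (basic ε c z) :=
    funext fun c => funext fun z =>
      LinearMap.map_add₂ (wedgeC a k) (α c z) (β c z) (basic ε c z)
  rwa [h1]

theorem IsSpecialHamiltonian.smul (t : ℝ) (hα : IsSpecialHamiltonian α) :
    IsSpecialHamiltonian (t • α) := by
  refine ⟨hα.1.smul t, fun k hk ε => ?_⟩
  have h1 : (fun (c : GaugeChart Q) z => wedge ((t • α) c z) (basic ε c z)) =
      t • fun c z => wedge (α c z) (basic ε c z) :=
    funext fun c => funext fun z => LinearMap.map_smul₂ (wedgeC a k) t (α c z) (basic ε c z)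
  rw [h1]
  exact (hα.2 k hk ε).smul t

theorem isHamiltonian_zero (ha : a + 1 ≤ n) :
    IsHamiltonian (0 : GaugeChart Q → Constr n m → Constr n m [⋀^Fin a]→L[ℝ] ℝ) := by
  refine ⟨ha, fun c z _ => ?_⟩
  have h := extDeriv_smul (x := z) (0 : ℝ) (0 : Constr n m → Constr n m [⋀^Fin a]→L[ℝ] ℝ)
  rw [zero_smul, zero_smul] at h
  rw [Pi.zero_apply, h]
  exact zero_mem _

theorem isSpecialHamiltonian_zero (hn : 1 ≤ n) (ha : a ≤ n - 1) :
    IsSpecialHamiltonian (0 : GaugeChart Q → Constr n m → Constr n m [⋀^Fin a]→L[ℝ] ℝ) := by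
  refine ⟨isHamiltonian_zero (by omega), fun k hk ε => ?_⟩
  have h1 : (fun (c : GaugeChart Q) z => wedge ((0 : GaugeChart Q → Constr n m →
      Constr n m [⋀^Fin a]→L[ℝ] ℝ) c z) (basic ε c z)) = 0 :=
    funext fun c => funext fun z =>
      LinearMap.congr_fun (map_zero (wedgeC (E := Constr n m) a k)) (basic ε c z)
  rw [h1]
  exact isHamiltonian_zero (by omega)

/-- The special Hamiltonian forms of degree `a` as a linear subspace. -/
def specialHamiltonian (hn : 1 ≤ n) (Q : PrincipalBundle n m X G P)
    (b : Module.Basis (Fin m) ℝ (GroupLieAlgebra (𝓡 m) G)) (ha : a ≤ n - 1) :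
    Submodule ℝ (Form Q b a) where
  carrier := {α | IsSpecialHamiltonian α.1}
  add_mem' {α β} hα hβ := IsSpecialHamiltonian.add hα hβ α.2.1 β.2.1
  zero_mem' := isSpecialHamiltonian_zero hn ha
  smul_mem' t _ hα := IsSpecialHamiltonian.smul t hα

end Linear

end

end YangMills

/-! ### The main theorem -/

open scoped Manifold ContDiff in
open YangMills in
theorem mainTheorem10 (n m : ℕ) (hn : 1 ≤ n)
    {X G P : Type*}
    [TopologicalSpace X] [ChartedSpace (EuclideanSpace ℝ (Fin n)) X] [IsManifold (𝓡 n) ∞ X]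
    [T2Space X] [SecondCountableTopology X]
    [TopologicalSpace G] [ChartedSpace (EuclideanSpace ℝ (Fin m)) G] [Group G]
    [LieGroup (𝓡 m) ∞ G] [T2Space G] [SecondCountableTopology G]
    [TopologicalSpace P] [ChartedSpace (EuclideanSpace ℝ (Fin (n + m))) P]
    [IsManifold (𝓡 (n + m)) ∞ P] [T2Space P] [SecondCountableTopology P]
    (Q : PrincipalBundle n m X G P) (g : PseudoMetric n X)
    (κ : GroupLieAlgebra (𝓡 m) G →ₗ[ℝ] GroupLieAlgebra (𝓡 m) G →ₗ[ℝ] ℝ)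
    (κ_symm : ∀ ξ η, κ ξ η = κ η ξ)
    (κ_nondegenerate : ∀ ξ, (∀ η, κ ξ η = 0) → ξ = 0)
    (κ_Ad : ∀ (h : G) (ξ η : GroupLieAlgebra (𝓡 m) G), κ (Ad h ξ) (Ad h η) = κ ξ η)
    (b : Module.Basis (Fin m) ℝ (GroupLieAlgebra (𝓡 m) G)) :
    -- the image of the Legendre transformation is `N = {p^{μν}_i + p^{νμ}_i = 0}`
    (∀ c : GaugeChart Q,
      legendre b g κ c '' {j | j.1 ∈ c.chart.target} = incl n m '' c.dom) ∧
    -- the maps `♯_a` on `N` are well defined modulo `K_{n+1-a}`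
    (∀ a, 1 ≤ a → a ≤ n →
      (∀ σ, σ ∈ formsS n m a ↔ ∃ V, (σ, V) ∈ sharpGraph n m a) ∧
      (∀ σ V V', (σ, V) ∈ sharpGraph n m a → (σ, V') ∈ sharpGraph n m a →
        V - V' ∈ annK n m (n + 1 - a))) ∧
    -- special Hamiltonian forms of each degree are a linear subspace
    (∀ a, a ≤ n - 1 → ∃ W : Submodule ℝ (Form Q b a), ∀ α : Form Q b a,
      α ∈ W ↔ IsSpecialHamiltonian α.1) ∧
    -- special Hamiltonian forms are closed under the bracket
    (∀ r s d, r ≤ n - 1 → s ≤ n - 1 → r + s = d + (n - 1) →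
      ∀ (α : Form Q b r) (β : Form Q b s),
        IsSpecialHamiltonian α.1 → IsSpecialHamiltonian β.1 →
        ∃ γ : Form Q b d, IsBracket α.1 β.1 γ.1 ∧ IsSpecialHamiltonian γ.1 ∧
          ∀ γ' : Form Q b d, IsBracket α.1 β.1 γ'.1 → γ' = γ) := by
  refine ⟨image_legendre b g κ κ_symm κ_nondegenerate, fun a ha han => ⟨fun σ =>
    mem_diracForms_iff_exists hn (mem_sharpGraphN_iff hn) han σ, fun σ V V' h h' =>
    diracGraph_unique hn (mem_sharpGraphN_iff hn) ha han h h'⟩,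
    fun a ha => ⟨specialHamiltonian hn Q b ha, fun α => Iff.rfl⟩,
    fun r s d hr hs hd α β hα hβ => exists_bracket b hn hr hs hd α β hα hβ⟩
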